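/- Let $q\in\mathbb C$, $0<|q|<1$, fix a square root $q^{1/2}$ of $q$ and write $q^{k/2}=(q^{1/2})^k$. Put $(x;q)_k=\prod_{j=0}^{k-1}(1-xq^j)$, $(x)_\infty=\prod_{j\ge0}(1-xq^j)$, $(x_1,\dots,x_r)_\infty=(x_1)_\infty\cdots(x_r)_\infty$. Let $$\phi(a;b,c,d,e,f,g,h)={}_{10}\phi_9\!\left({a,\,q\sqrt a,\,-q\sqrt a,\,b,\,c,\,d,\,e,\,f,\,g,\,h\atop \sqrt a,\,-\sqrt a,\,\frac{aq}b,\,\frac{aq}c,\,\frac{aq}d,\,\frac{aq}e,\,\frac{aq}f,\,\frac{aq}g,\,\frac{aq}h};q,q\right),$$ $$W(a;b,c,d,e,f)={}_8\phi_7\!\left({a,\,q\sqrt a,\,-q\sqrt a,\,b,\,c,\,d,\,e,\,f\atop \sqrt a,\,-\sqrt a,\,\frac{aq}b,\,\frac{aq}c,\,\frac{aq}d,\,\frac{aq}e,\,\frac{aq}f};q,\frac{a^2q^2}{bcdef}\right)$$ when the argument has modulus less than $1$, and the analytic continuation otherwise, and $$\widetilde W(a;b,c,d,e,f)=\Big(\frac{aq}b,\frac{aq}c,\frac{aq}d,\frac{aq}e,\frac{aq}f\Big)_\infty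 W(a;b,c,d,e,f),$$ where in the product $\frac{(aq/x)_\infty}{(aq/x;q)_k}$ is read as $(aq^{k+1}/x)_\infty$, so that $\widetilde W$ is defined also when some $aq^{k+1}=x$. Let $m\ge3$ be an integer, and let $a,b,c,d,e,f$ be nonzero complex numbers with $$s:=\frac{a^3q^3}{bcdef}=q^m,\qquad \sqrt s:=q^{m/2}.$$ Assume that $a\ne q^k$ for all $k\in\mathbb Z$ and that $xq^k\ne a$ for all $k\ge0$ and $x\in\{b,c,d,e,f\}$. Put $$\widetilde W_1=\widetilde W(a;b,c,d,e,f),\qquad \widetilde W_2=\widetilde W\Big(\frac qa;\frac qb,\frac qc,\frac qd,\frac qe,\frac qf\Big),$$ and assume $\widetilde W_1\ne0$. Define, with all products over $x\in\{b,c,d,e,f\}$, $$\begin{aligned}a_n=\Big[&\frac{q^{-n+1/2}}{\sqrt s}(1-sq^{n-1})\big(1-\tfrac saq^{n-1}\big)\big(1-\tfrac saq^{n-2}\big)\frac{\prod_x(1-\frac axq^{n+1})}{1-sq^{2n}}\\&+\frac{q^{-n+3/2}}{\sqrt s}(1-q^n)(1-aq^n)(1-aq^{n+1})\frac{\prod_x(1-\frac{xs}aq^{n-2})}{1-sq^{2n-2}}\\&+\frac{\sqrt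 s}aq^{n-1/2}(1-sq^{2n-1})\big(1-\tfrac s{aq^2}\big)\prod_x(1-x)\Big]\Big/\Big[(1-sq^{2n-1})\big(1-\tfrac saq^{n-2}\big)(1-aq^{n+1})\Big],\end{aligned}$$ $$b_n=\frac{q^{-2n+3}}s(1-q^n)(1-sq^{n-2})\frac{\prod_x(1-\frac axq^n)(1-\frac{xs}aq^{n-2})}{(1-sq^{2n-1})(1-sq^{2n-2})^2(1-sq^{2n-3})}.$$ Then the continued fraction $\frac1{a_0}\,{\atop-}\,\frac{b_1}{a_1}\,{\atop-}\,\frac{b_2}{a_2}\,{\atop-\cdots}$ converges, and its value is $$\frac{q^{(m-3)/2}(1-q^{m-1})(1-\frac aq)}{(1-\frac{q^{m-1}}a)(1-\frac ab)(1-\frac ac)(1-\frac ad)(1-\frac ae)(1-\frac af)}\left[\phi\Big(\frac qa;\frac qb,\frac qc,\frac qd,\frac qe,\frac qf,q^{-m+2},q\Big)-\frac{\widetilde W_2}{\widetilde W_1}\,\frac{(a)_\infty(aq)_\infty(q)_\infty}{(\frac{q^m}a)_\infty(\frac{q^{m-1}}a)_\infty(q^m)_\infty}\,\frac1{1-q^{m-1}}\prod_x\frac{(\frac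 xaq^{m-1})_\infty}{(\frac{xq}a)_\infty}\right].$$ -/

import Mathlib

open Filter Topology

/-- The finite `q`-shifted factorial `(x; q)_k = (1 - x)(1 - xq)⋯(1 - xq^{k-1})`. -/
noncomputable def qFac (q x : ℂ) (k : ℕ) : ℂ :=
  ∏ j ∈ Finset.range k, (1 - x * q ^ j)

/-- The infinite product `(x)_∞ = (x; q)_∞ = (1 - x)(1 - xq)(1 - xq²)⋯`. -/
noncomputable def qInf (q x : ℂ) : ℂ :=
  ∏' j : ℕ, (1 - x * q ^ j)

/-- `(x₁, …, x_r; q)_k = (x₁; q)_k ⋯ (x_r; q)_k`. -/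
noncomputable def qFacs (q : ℂ) (xs : List ℂ) (k : ℕ) : ℂ :=
  (xs.map fun x => qFac q x k).prod

/-- `(x₁, …, x_r)_∞ = (x₁)_∞ ⋯ (x_r)_∞`. -/
noncomputable def qInfs (q : ℂ) (xs : List ℂ) : ℂ :=
  (xs.map fun x => qInf q x).prod

/-- The `k`-th coefficient `(A₁, …, A_{r+1}; q)_k / (q, B₁, …, B_r; q)_k` of the basic
hypergeometric series `_{r+1}φ_r` with upper parameters `A` and lower parameters `B`. -/
noncomputable def basicHypCoeff (q : ℂ) (A B : List ℂ) (k : ℕ) : ℂ :=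
  qFacs q A k / (qFac q q k * qFacs q B k)

/-- The basic hypergeometric series `_{r+1}φ_r(A; B; q, z)`. -/
noncomputable def basicHyp (q : ℂ) (A B : List ℂ) (z : ℂ) : ℂ :=
  ∑' k : ℕ, basicHypCoeff q A B k * z ^ k

/-- A square root of `a`; the series below do not depend on which one is used. -/
noncomputable def sqrtC (a : ℂ) : ℂ := a ^ (1 / 2 : ℂ)

/-- Upper parameters `a, q√a, -q√a, b₁, …, b_r` of a very well poised series. -/
noncomputable def vwpUpper (q a : ℂ) (bs : List ℂ) : List ℂ :=
  a :: (q * sqrtC a) :: (-(q * sqrtC a)) :: bs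

/-- Lower parameters `√a, -√a, aq/b₁, …, aq/b_r` of a very well poised series. -/
noncomputable def vwpLower (q a : ℂ) (bs : List ℂ) : List ℂ :=
  sqrtC a :: (-sqrtC a) :: bs.map fun b => a * q / b

/-- The very well poised series `φ(a; b, c, d, e, f, g, h) = ₁₀φ₉(…; q, q)`. -/
noncomputable def phi109 (q a b c d e f g h : ℂ) : ℂ :=
  basicHyp q (vwpUpper q a [b, c, d, e, f, g, h]) (vwpLower q a [b, c, d, e, f, g, h]) q

/-- The `k`-th coefficient of
`(aq/b, aq/c, aq/d, aq/e, aq/f)_∞ · ₈φ₇(a, q√a, -q√a, b, …, f; √a, -√a, aq/b, …, aq/f; q, z)`,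
where `(aq/b)_∞ / (aq/b; q)_k` is written as `(aq^{k+1}/b)_∞` and the four factors with `±√a`
are multiplied out, so that it makes sense also when some `aq^{k+1} = b`
(`wTildeCoeff_eq` below shows the agreement whenever the `₈φ₇` is defined). -/
noncomputable def wTildeCoeff (q a b c d e f : ℂ) (k : ℕ) : ℂ :=
  (1 - a * q ^ (2 * k)) / (1 - a) * (qFacs q [a, b, c, d, e, f] k / qFac q q k) *
    qInfs q [a * q ^ (k + 1) / b, a * q ^ (k + 1) / c, a * q ^ (k + 1) / d,
      a * q ^ (k + 1) / e, a * q ^ (k + 1) / f]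

/-- `F` is the analytic continuation of the power series `∑ u_k z^k` from the unit disc
to the complement of the points `1, q⁻¹, q⁻², …`. -/
def IsContinuation (q : ℂ) (u : ℕ → ℂ) (F : ℂ → ℂ) : Prop :=
  AnalyticOnNhd ℂ F {z | ∀ j : ℕ, z * q ^ j ≠ 1} ∧
    ∀ z : ℂ, ‖z‖ < 1 → HasSum (fun k => u k * z ^ k) (F z)

/-- `W̃(a; b, c, d, e, f) = (aq/b, …, aq/f)_∞ · W(a; b, c, d, e, f)`, where `W` is the very well
poised `₈φ₇` with argument `z = a²q²/(bcdef)` for `|z| < 1`, and its analytic continuation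
otherwise. -/
noncomputable def wTilde (q a b c d e f : ℂ) : ℂ :=
  Classical.epsilon (IsContinuation q (wTildeCoeff q a b c d e f))
    (a ^ 2 * q ^ 2 / (b * c * d * e * f))

/-- The coefficient `a_n`; here `rq` is `q^{1/2}` and `rs` is `√s`. -/
noncomputable def recA (q rq s rs a b c d e f : ℂ) (n : ℕ) : ℂ :=
  (q ^ (-(n : ℤ)) * rq / rs
      * (1 - s * q ^ ((n : ℤ) - 1)) * (1 - s / a * q ^ ((n : ℤ) - 1))
      * (1 - s / a * q ^ ((n : ℤ) - 2))
      * ((1 - a / b * q ^ (n + 1)) * (1 - a / c * q ^ (n + 1)) * (1 - a / d * q ^ (n + 1))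
          * (1 - a / e * q ^ (n + 1)) * (1 - a / f * q ^ (n + 1))
        / (1 - s * q ^ (2 * n)))
    + q ^ (-(n : ℤ)) * rq ^ 3 / rs
      * (1 - q ^ n) * (1 - a * q ^ n) * (1 - a * q ^ (n + 1))
      * ((1 - b * s / a * q ^ ((n : ℤ) - 2)) * (1 - c * s / a * q ^ ((n : ℤ) - 2))
          * (1 - d * s / a * q ^ ((n : ℤ) - 2)) * (1 - e * s / a * q ^ ((n : ℤ) - 2))
          * (1 - f * s / a * q ^ ((n : ℤ) - 2))
        / (1 - s * q ^ (2 * (n : ℤ) - 2)))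
    + rs / a * (q ^ n / rq)
      * (1 - s * q ^ (2 * (n : ℤ) - 1)) * (1 - s / (a * q ^ 2))
      * (1 - b) * (1 - c) * (1 - d) * (1 - e) * (1 - f))
  / ((1 - s * q ^ (2 * (n : ℤ) - 1)) * (1 - s / a * q ^ ((n : ℤ) - 2)) * (1 - a * q ^ (n + 1)))

/-- The coefficient `b_n`. -/
noncomputable def recB (q s a b c d e f : ℂ) (n : ℕ) : ℂ :=
  q ^ (-2 * (n : ℤ) + 3) / s * (1 - q ^ n) * (1 - s * q ^ ((n : ℤ) - 2))
    * (1 - a / b * q ^ n) * (1 - a / c * q ^ n) * (1 - a / d * q ^ n)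
    * (1 - a / e * q ^ n) * (1 - a / f * q ^ n)
    * ((1 - b * s / a * q ^ ((n : ℤ) - 2)) * (1 - c * s / a * q ^ ((n : ℤ) - 2))
        * (1 - d * s / a * q ^ ((n : ℤ) - 2)) * (1 - e * s / a * q ^ ((n : ℤ) - 2))
        * (1 - f * s / a * q ^ ((n : ℤ) - 2))
      / ((1 - s * q ^ (2 * (n : ℤ) - 1)) * (1 - s * q ^ (2 * (n : ℤ) - 2)) ^ 2
        * (1 - s * q ^ (2 * (n : ℤ) - 3))))

/-- The continued fraction `1/(α₀ - β₁/(α₁ - β₂/(α₂ - ⋯)))`. -/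
noncomputable def contFrac (α β : ℕ → ℂ) : GenContFract ℂ where
  h := 0
  s := Stream'.Seq.ofStream fun n => ⟨if n = 0 then 1 else -β n, α n⟩

/-- The generalized continued fraction `g` converges to the number `L`: its convergents
(numerator over denominator) are defined from some index on and tend to `L`. -/
def CFConvergesTo (g : GenContFract ℂ) (L : ℂ) : Prop :=
  (∀ᶠ n in atTop, g.dens n ≠ 0) ∧ Tendsto g.convs atTop (𝓝 L)

theorem qFac_mul_qInf {q : ℂ} (hq : ‖q‖ < 1) (x : ℂ) (k : ℕ) :
    qFac q x k * qInf q (x * q ^ k) = qInf q x := by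
  have hm : Multipliable fun n : ℕ => 1 - x * q ^ (n + k) := by
    have hs : Summable fun n : ℕ => ‖-(x * q ^ (n + k))‖ := by
      have h1 : Summable fun n : ℕ => (‖x‖ * ‖q‖ ^ k) * ‖q‖ ^ n :=
        (summable_geometric_of_lt_one (norm_nonneg q) hq).mul_left _
      refine h1.congr fun n => ?_
      rw [norm_neg, norm_mul, norm_pow, pow_add]
      ring
    simpa [sub_eq_add_neg] using multipliable_one_add_of_summable hs
  have h := Multipliable.prod_mul_tprod_nat_mul' (f := fun n : ℕ => 1 - x * q ^ n) (k := k) hm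
  rw [qFac, qInf, qInf, ← h]
  congr 1
  refine tprod_congr fun j => ?_
  rw [pow_add]
  ring

theorem sqrtC_sq (a : ℂ) : sqrtC a ^ 2 = a := by
  have h := Complex.cpow_nat_inv_pow a (n := 2) two_ne_zero
  rw [sqrtC, one_div]
  exact_mod_cast h

theorem qFac_sqrt_ratio (q a : ℂ) (k : ℕ) :
    qFac q (q * sqrtC a) k * qFac q (-(q * sqrtC a)) k * (1 - a) =
      qFac q (sqrtC a) k * qFac q (-sqrtC a) k * (1 - a * q ^ (2 * k)) := by
  have hr := sqrtC_sq a
  induction k with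
  | zero => simp [qFac]
  | succ k ih =>
    simp only [qFac, Finset.prod_range_succ] at ih ⊢
    generalize sqrtC a = r at *
    subst hr
    linear_combination (1 - r ^ 2 * q ^ (2 * (k + 1))) * ih

/-- Where the `₈φ₇` is defined, `wTildeCoeff` is the coefficient of the product of
`(aq/b, …, aq/f)_∞` and the `₈φ₇`. -/
theorem wTildeCoeff_eq {q a b c d e f : ℂ} (hq : ‖q‖ < 1) (k : ℕ)
    (ha : ∀ j : ℕ, a * q ^ (2 * j) ≠ 1)
    (hx : ∀ x ∈ [b, c, d, e, f], ∀ j : ℕ, a * q / x * q ^ j ≠ 1) :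
    wTildeCoeff q a b c d e f k =
      qInfs q [a * q / b, a * q / c, a * q / d, a * q / e, a * q / f] *
        basicHypCoeff q (vwpUpper q a [b, c, d, e, f]) (vwpLower q a [b, c, d, e, f]) k := by
  have hr := sqrtC_sq a
  have key : ∀ x ∈ [b, c, d, e, f],
      qFac q (a * q / x) k ≠ 0 ∧
        qInf q (a * q / x) = qFac q (a * q / x) k * qInf q (a * q ^ (k + 1) / x) := by
    intro x hxm
    constructor
    · exact Finset.prod_ne_zero_iff.2 fun j _ => sub_ne_zero.2 (hx x hxm j).symm
    · rw [← qFac_mul_qInf hq (a * q / x) k]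
      congr 2
      ring
  obtain ⟨hb, eb⟩ := key b (by simp)
  obtain ⟨hc, ec⟩ := key c (by simp)
  obtain ⟨hd, ed⟩ := key d (by simp)
  obtain ⟨he, ee⟩ := key e (by simp)
  obtain ⟨hf, ef⟩ := key f (by simp)
  have h1 : (1 : ℂ) - a ≠ 0 := sub_ne_zero.2 (by simpa using (ha 0).symm)
  have hs : qFac q (sqrtC a) k * qFac q (-sqrtC a) k ≠ 0 := by
    rw [qFac, qFac, ← Finset.prod_mul_distrib]
    refine Finset.prod_ne_zero_iff.2 fun j _ => ?_
    have : (1 - sqrtC a * q ^ j) * (1 - -sqrtC a * q ^ j) = 1 - a * q ^ (2 * j) := by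
      linear_combination -(q ^ (2 * j)) * hr
    rw [this]
    exact sub_ne_zero.2 (ha j).symm
  have e0 : (1 - a * q ^ (2 * k)) / (1 - a) =
      qFac q (q * sqrtC a) k * qFac q (-(q * sqrtC a)) k /
        (qFac q (sqrtC a) k * qFac q (-sqrtC a) k) := by
    rw [div_eq_div_iff h1 hs, qFac_sqrt_ratio]
    ring
  have hs1 := left_ne_zero_of_mul hs
  have hs2 := right_ne_zero_of_mul hs
  simp only [wTildeCoeff, basicHypCoeff, vwpUpper, vwpLower, qInfs, qFacs, List.map_cons,
    List.map_nil, List.prod_cons, List.prod_nil, eb, ec, ed, ee, ef, e0]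
  generalize qInf q (a * q ^ (k + 1) / b) = ib
  generalize qInf q (a * q ^ (k + 1) / c) = ic
  generalize qInf q (a * q ^ (k + 1) / d) = id'
  generalize qInf q (a * q ^ (k + 1) / e) = ie
  generalize qInf q (a * q ^ (k + 1) / f) = if'
  generalize qFac q (a * q / b) k = lb at *
  generalize qFac q (a * q / c) k = lc at *
  generalize qFac q (a * q / d) k = ld at *
  generalize qFac q (a * q / e) k = le at *
  generalize qFac q (a * q / f) k = lf at *
  generalize qFac q (sqrtC a) k = s1 at *
  generalize qFac q (-sqrtC a) k = s2 at *
  generalize qFac q q k = w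
  have hL : lb * lc * ld * le * lf ≠ 0 :=
    mul_ne_zero (mul_ne_zero (mul_ne_zero (mul_ne_zero hb hc) hd) he) hf
  rw [div_mul_div_comm, div_mul_eq_mul_div, ← mul_div_assoc, ← mul_div_mul_right _ _ hL]
  congr 1 <;> ring

/-- The analytic continuation is unique. -/
theorem IsContinuation.unique {q : ℂ} {u : ℕ → ℂ} {F G : ℂ → ℂ}
    (hF : IsContinuation q u F) (hG : IsContinuation q u G) :
    ∀ z : ℂ, (∀ j : ℕ, z * q ^ j ≠ 1) → F z = G z := by
  have hU : IsPreconnected {z : ℂ | ∀ j : ℕ, z * q ^ j ≠ 1} := by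
    have hc : (Set.range fun j : ℕ => (q ^ j)⁻¹).Countable := Set.countable_range _
    have hE : {z : ℂ | ∀ j : ℕ, z * q ^ j ≠ 1} =
        ((Set.range fun j : ℕ => (q ^ j)⁻¹) \ {0})ᶜ := by
      ext z
      simp only [Set.mem_ofPred_eq, Set.mem_compl_iff, Set.mem_sdiff, Set.mem_range,
        Set.mem_singleton_iff, not_and, not_not]
      constructor
      · rintro h ⟨j, rfl⟩
        by_contra h0
        exact h j (inv_mul_cancel₀ fun h1 => h0 (by simp [h1]))
      · intro h j hj
        have hz : z = 0 := h ⟨j, (eq_inv_of_mul_eq_one_left hj).symm⟩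
        simp [hz] at hj
    rw [hE]
    exact ((hc.mono Set.sdiff_subset).isPathConnected_compl_of_one_lt_rank
      (by simp)).isConnected.isPreconnected
  intro z hz
  refine hF.1.eqOn_of_preconnected_of_eventuallyEq hG.1 hU (z₀ := 0) (by simp) ?_ hz
  filter_upwards [Metric.ball_mem_nhds (0 : ℂ) one_pos] with w hw
  have hw' : ‖w‖ < 1 := by simpa using hw
  exact (hF.2 w hw').unique (hG.2 w hw')

/-!
The coefficients `a_n`, `b_n` are those of the three-term recurrence `X_{n+1} = a_n X_n - b_n X_{n-1}`,
and a solution of it is given by a terminating very well poised `₁₀φ₉`, namely a multiple of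
`∏ (aq/x_i; q)_n · ₁₀φ₉(a; b, c, d, e, f, s q^{n-1}, q^{-n})` (`vwpSum`, `vwpSum_eq_phi109`).
The recurrence (`StepRegular.recurrence`) is proved termwise, with a telescoping certificate.
Suitably rescaled, this solution has the initial values of the denominators of the continued
fraction.

The coefficient `a_n` and the product of the two outer coefficients of the recurrence do not change
under `a ↦ q/a`, `x ↦ q/x`, `s ↦ q⁴/s`, `q^n ↦ s q^{n-2}` (`stepMid_reflect`,
`stepUp_mul_stepDown_reflect`). Since `s = q^m`, the last substitution shifts the index by `m - 2`,
so that the reflected series is again a terminating series and gives a second solution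
`Y`. Continued down to index `-1`, it meets a series one of whose parameters is `1`, which
collapses to its first term (`vwpSum_eq_prod`).

If `X` are the denominators and `Y_n / X_n → l`, the numerators are the combination of `X` and `Y`
fixed by the initial values, and the continued fraction converges to `(Y_0 - l) / δ`, where
`δ = a_0 Y_0 - Y_1` (`cfConvergesTo_of_recurrence`). The limit `l` comes from the limits of both
terminating series, which are `W̃_1` and `W̃_2` (`tendsto_vwpSum`), and from the quotient of the
normalizing factors, a quotient of shifted factorials (`prod_stepUp_reflect`).

The argument of the limiting `₈φ₇` may have modulus at least `1`, where the series diverges and `W̃`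
is an analytic continuation. Abel summation handles this: it rewrites a power series with
coefficients `u` at `z` as `(1 - z)⁻¹` times one at `zq`, whose coefficients are the `q`-differences
of `u`. The terminating sums transform in the same way (`truncSum_qDiff`). The coefficients here are
smooth functions of `q^k`, uniformly in `n`, so their iterated `q`-differences stay bounded
(`QSmooth`). After `J` summations with `|z q^J| < 1`, dominated convergence gives the limit, and the
transformed series is the continuation (`tendsto_truncSum`).
-/

/-! ### Elementary facts on shifted factorials -/

theorem qFac_zero (q y : ℂ) : qFac q y 0 = 1 := by simp [qFac]

theorem qFac_succ (q y : ℂ) (k : ℕ) : qFac q y (k + 1) = qFac q y k * (1 - y * q ^ k) := by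
  simp [qFac, Finset.prod_range_succ]

theorem qFac_succ' (q y : ℂ) (k : ℕ) : qFac q y (k + 1) = (1 - y) * qFac q (y * q) k := by
  simp only [qFac, Finset.prod_range_succ', pow_zero, mul_one, pow_succ']
  rw [mul_comm]
  simp only [mul_assoc]

theorem qFac_mul_shift (q y : ℂ) (k : ℕ) :
    qFac q y k * (1 - y * q ^ k) = (1 - y) * qFac q (y * q) k := by
  rw [← qFac_succ, qFac_succ']

theorem qFac_ne_zero {q y : ℂ} {k : ℕ} (h : ∀ j < k, y * q ^ j ≠ 1) : qFac q y k ≠ 0 :=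
  Finset.prod_ne_zero_iff.2 fun j hj => sub_ne_zero.2 (h j (Finset.mem_range.1 hj)).symm

/-- The product `(1 - y)(q - y)⋯(q^{k-1} - y)`. It is a multiple of `(y⁻¹; q)_k`, and for
`y = q^n` it vanishes once `k > n`. -/
noncomputable def qSub (q y : ℂ) (k : ℕ) : ℂ :=
  ∏ j ∈ Finset.range k, (q ^ j - y)

theorem qSub_succ (q y : ℂ) (k : ℕ) : qSub q y (k + 1) = qSub q y k * (q ^ k - y) := by
  simp [qSub, Finset.prod_range_succ]

theorem qSub_succ_shift (q y : ℂ) (k : ℕ) :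
    qSub q (y * q) (k + 1) = (1 - y * q) * q ^ k * qSub q y k := by
  induction k with
  | zero => simp [qSub]
  | succ k ih =>
    rw [qSub_succ, ih, qSub_succ]
    ring

theorem qSub_mul_shift (q y : ℂ) (k : ℕ) :
    qSub q (y * q) k * (q ^ k - y * q) = (1 - y * q) * q ^ k * qSub q y k := by
  rw [← qSub_succ, qSub_succ_shift]

theorem qSub_pow_of_lt (q : ℂ) {n k : ℕ} (h : n < k) : qSub q (q ^ n) k = 0 :=
  Finset.prod_eq_zero (Finset.mem_range.2 h) (sub_self _)

theorem qSub_ne_zero {q y : ℂ} {k : ℕ} (h : ∀ j < k, y ≠ q ^ j) : qSub q y k ≠ 0 :=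
  Finset.prod_ne_zero_iff.2 fun j hj => sub_ne_zero.2 (h j (Finset.mem_range.1 hj)).symm

theorem pow_ne_one_of_norm_lt_one {q : ℂ} (hq1 : ‖q‖ < 1) {k : ℕ} (hk : k ≠ 0) : q ^ k ≠ 1 := by
  intro h
  have h1 := pow_lt_one₀ (norm_nonneg q) hq1 hk
  rw [← norm_pow, h, norm_one] at h1
  exact lt_irrefl _ h1

theorem zpow_ne_one_of_norm_lt_one {q : ℂ} (hq1 : ‖q‖ < 1) {k : ℤ} (hk : k ≠ 0) :
    q ^ k ≠ 1 := by
  intro h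
  have h1 : q ^ k.natAbs = 1 := by
    rcases Int.natAbs_eq k with h2 | h2
    · rw [h2, zpow_natCast] at h
      exact h
    · rw [h2, zpow_neg, zpow_natCast, inv_eq_one] at h
      exact h
  exact pow_ne_one_of_norm_lt_one hq1 (Int.natAbs_ne_zero.2 hk) h1

/-! ### The polynomial identity behind the recurrence -/

/-- The coefficients of `∏ (1 - x_i y)` and of `∏ (1 - y/x_i)` are the same up to order and the
factor `∏ x_i`. With these coefficients as unknowns, the identities in `q`-series below become
polynomial identities that do not involve the `x_i` themselves. -/
theorem exists_prod_expansion {K : Type*} [Field K] (x : Fin 5 → K) (hx : ∀ i, x i ≠ 0) :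
    ∃ e1 e2 e3 e4 : K,
      (∀ y, ∏ i, (1 - x i * y) = 1 - e1 * y + e2 * y ^ 2 - e3 * y ^ 3 + e4 * y ^ 4
        - (∏ i, x i) * y ^ 5) ∧
      ∀ y, ∏ i, (1 - y / x i) =
        1 + (-e4 * y + e3 * y ^ 2 - e2 * y ^ 3 + e1 * y ^ 4 - y ^ 5) / ∏ i, x i := by
  have hP0 : ∏ i, x i ≠ 0 := Finset.prod_ne_zero_iff.2 fun i _ => hx i
  refine ⟨x 0 + x 1 + x 2 + x 3 + x 4,
    x 0 * x 1 + x 0 * x 2 + x 0 * x 3 + x 0 * x 4 + x 1 * x 2 + x 1 * x 3 + x 1 * x 4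
      + x 2 * x 3 + x 2 * x 4 + x 3 * x 4,
    x 0 * x 1 * x 2 + x 0 * x 1 * x 3 + x 0 * x 1 * x 4 + x 0 * x 2 * x 3 + x 0 * x 2 * x 4
      + x 0 * x 3 * x 4 + x 1 * x 2 * x 3 + x 1 * x 2 * x 4 + x 1 * x 3 * x 4 + x 2 * x 3 * x 4,
    x 0 * x 1 * x 2 * x 3 + x 0 * x 1 * x 2 * x 4 + x 0 * x 1 * x 3 * x 4
      + x 0 * x 2 * x 3 * x 4 + x 1 * x 2 * x 3 * x 4, fun y => ?_, fun y => ?_⟩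
  · simp only [Fin.prod_univ_five]
    ring
  · have h' : ∏ i, (1 - y / x i) = (∏ i, (x i - y)) / ∏ i, x i := by
      rw [← Finset.prod_div_distrib]
      refine Finset.prod_congr rfl fun i _ => ?_
      rw [sub_div, div_self (hx i)]
    rw [h', div_eq_iff hP0, add_mul, div_mul_cancel₀ _ hP0]
    simp only [Fin.prod_univ_five]
    ring

set_option maxRecDepth 20000 in
set_option maxHeartbeats 1000000 in
/-- The core of `very_well_poised_identity`. Here `N = q^n`, `w = q^k`, `u = s q^n / (a q²)`, and
`E y`, `R y` stand for `∏ (1 - x_i y)`, `∏ (1 - y/x_i)`; the denominators are variables so that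
they can be cleared without being expanded. -/
theorem very_well_poised_identity_aux {K : Type*} [Field K]
    {a q N u w e1 e2 e3 e4 d1 d4 d5 d6 d7 d8 d9 d10 : K}
    (ha : a ≠ 0) (hq : q ≠ 0) (hN : N ≠ 0) (hu : u ≠ 0) (hw : w ≠ 0)
    (h4 : d4 ≠ 0) (h5 : d5 ≠ 0) (h6 : d6 ≠ 0) (h7 : d7 ≠ 0) (h8 : d8 ≠ 0) (h9 : d9 ≠ 0)
    (h10 : d10 ≠ 0)
    (k1 : d1 = 1 - a * q * u * N) (k4 : d4 = 1 - a * q * N * w) (k5 : d5 = w - q * N)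
    (k6 : d6 = 1 - a * u * w) (k7 : d7 = w - u) (k8 : d8 = 1 - a * w ^ 2)
    (k9 : d9 = 1 - a * q * N) (k10 : d10 = 1 - u)
    (E : K → K)
    (hE : ∀ y, E y = 1 - e1 * y + e2 * y ^ 2 - e3 * y ^ 3 + e4 * y ^ 4
      - (a ^ 2 * q * N / u) * y ^ 5)
    (R : K → K)
    (hR : ∀ y, R y = 1 + (-e4 * y + e3 * y ^ 2 - e2 * y ^ 3 + e1 * y ^ 4 - y ^ 5)
      / (a ^ 2 * q * N / u)) :
    R (a * q * N) * (1 - w) * (1 - a * w) / (d4 * d5 * d9)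
        - E u * (1 - w) * (1 - a * w) / (d6 * d7 * d10) - u * d1 * E 1 / (d9 * d10)
      = d1 / (d8 * w) * (-(1 - a * w) * u * E w / (d4 * d7)
          + (1 - w) * (q * N) * R (a * w) / (d5 * d6)) := by
  simp only [hE, hR]
  field_simp
  subst k1 k4 k5 k6 k7 k8 k9 k10
  ring

/-- The recurrence for a single term of the very well poised series, divided by that term: the
right-hand side is the increment of the telescoping certificate. -/
theorem very_well_poised_identity {K : Type*} [Field K] {a q N u w : K} {x : Fin 5 → K}
    (ha : a ≠ 0) (hq : q ≠ 0) (hN : N ≠ 0) (hu : u ≠ 0) (hw : w ≠ 0)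
    (hx : ∀ i, x i ≠ 0) (hprod : ∏ i, x i = a ^ 2 * q * N / u)
    (h2 : 1 - a * q ^ 2 * u * N ≠ 0) (h3 : 1 - a * u * N ≠ 0)
    (h4 : 1 - a * q * N * w ≠ 0) (h5 : w - q * N ≠ 0) (h6 : 1 - a * u * w ≠ 0)
    (h7 : w - u ≠ 0) (h8 : 1 - a * w ^ 2 ≠ 0) (h9 : 1 - a * q * N ≠ 0) (h10 : 1 - u ≠ 0) :
    (∏ i, (1 - a * q * N / x i)) * (1 - q * N) * (1 - a * q * u * w) * (w - q * u)
          / ((1 - a * q ^ 2 * u * N) * (1 - a * q * N * w) * (w - q * N))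
        + q * (∏ i, (1 - x i * u)) * (1 - a * u) * (1 - a * N * w) * (w - N)
          / ((1 - a * u * N) * (1 - a * u * w) * (w - u))
        - ((1 - a * q * u) * (1 - q * u) * (∏ i, (1 - a * q * N / x i))
            / ((1 - a * q ^ 2 * u * N) * (1 - a * q * N))
          + q * (1 - N) * (1 - a * N) * (∏ i, (1 - x i * u)) / ((1 - a * u * N) * (1 - u))
          + q * u * (1 - a * q * u * N) * (N - u) * (∏ i, (1 - x i))
            / ((1 - u) * (1 - a * q * N)))
      = q * (1 - a * q * u * N) * (N - u) / ((1 - a * w ^ 2) * w)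
        * (-(1 - a * w) * u * (∏ i, (1 - x i * w)) / ((1 - a * q * N * w) * (w - u))
          + (1 - w) * (q * N) * (∏ i, (1 - a * w / x i)) / ((w - q * N) * (1 - a * u * w))) := by
  obtain ⟨e1, e2, e3, e4, hE, hR⟩ := exists_prod_expansion x hx
  rw [hprod] at hE hR
  have key := very_well_poised_identity_aux ha hq hN hu hw h4 h5 h6 h7 h8 h9 h10
    rfl rfl rfl rfl rfl rfl rfl rfl _ hE _ hR
  have b1 : (∏ i, (1 - a * q * N / x i)) * (1 - q * N) * (1 - a * q * u * w) * (w - q * u)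
        / ((1 - a * q ^ 2 * u * N) * (1 - a * q * N * w) * (w - q * N))
      - (1 - a * q * u) * (1 - q * u) * (∏ i, (1 - a * q * N / x i))
        / ((1 - a * q ^ 2 * u * N) * (1 - a * q * N))
      = q * (N - u) * ((∏ i, (1 - a * q * N / x i)) * (1 - w) * (1 - a * w)
        / ((1 - a * q * N * w) * (w - q * N) * (1 - a * q * N))) := by
    rw [div_sub_div _ _ (mul_ne_zero (mul_ne_zero h2 h4) h5) (mul_ne_zero h2 h9), ← mul_div_assoc,
      div_eq_div_iff (mul_ne_zero (mul_ne_zero (mul_ne_zero h2 h4) h5) (mul_ne_zero h2 h9))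
        (mul_ne_zero (mul_ne_zero h4 h5) h9)]
    ring
  have b2 : q * (∏ i, (1 - x i * u)) * (1 - a * u) * (1 - a * N * w) * (w - N)
        / ((1 - a * u * N) * (1 - a * u * w) * (w - u))
      - q * (1 - N) * (1 - a * N) * (∏ i, (1 - x i * u)) / ((1 - a * u * N) * (1 - u))
      = -(q * (N - u)) * ((∏ i, (1 - x i * u)) * (1 - w) * (1 - a * w)
        / ((1 - a * u * w) * (w - u) * (1 - u))) := by
    rw [div_sub_div _ _ (mul_ne_zero (mul_ne_zero h3 h6) h7) (mul_ne_zero h3 h10), ← mul_div_assoc,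
      div_eq_div_iff (mul_ne_zero (mul_ne_zero (mul_ne_zero h3 h6) h7) (mul_ne_zero h3 h10))
        (mul_ne_zero (mul_ne_zero h6 h7) h10)]
    ring
  simp only [mul_one] at key
  linear_combination b1 + b2 + q * (N - u) * key

/-! ### The terminating very well poised series and its recurrence -/

/-- The `k`-th term of `∏ (aq/x_i; q)_n` times the terminating `₁₀φ₉` with parameters
`a; x₀, …, x₄, s q^{n-1}, q^{-n}`; the factor `(aq/x_i; q)_n / (aq/x_i; q)_k` is written as
`(aq^{k+1}/x_i; q)_{n-k}`, so that no lower parameter `aq/x_i` has to be avoided, and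
`(q^{-n}; q)_k q^k / (aq^{2-n}/s; q)_k` is written with `qSub`. -/
noncomputable def vwpTerm (q a s : ℂ) (x : Fin 5 → ℂ) (n k : ℕ) : ℂ :=
  (1 - a * q ^ (2 * k)) / (1 - a) * (qFac q a k * (∏ i, qFac q (x i) k) / qFac q q k)
    * (∏ i, qFac q (a * q ^ (k + 1) / x i) (n - k))
    * (qFac q (s * q ^ n / q) k / qFac q (a * q ^ (n + 1)) k)
    * ((s / (a * q)) ^ k * (qSub q (q ^ n) k / qSub q (s * q ^ n / (a * q ^ 2)) k))

/-- The terminating series `∏ (aq/x_i; q)_n · ₁₀φ₉(a; x₀, …, x₄, s q^{n-1}, q^{-n})`. -/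
noncomputable def vwpSum (q a s : ℂ) (x : Fin 5 → ℂ) (n : ℕ) : ℂ :=
  ∑ k ∈ Finset.range (n + 1), vwpTerm q a s x n k

/-- The coefficient of the series of index `n + 1` in the recurrence of `vwpSum`. -/
noncomputable def stepUp (q κ a s : ℂ) (n : ℕ) : ℂ :=
  κ / q ^ n * (1 - s * q ^ n / q) * (1 - s * q ^ n / (a * q))
    / ((1 - s * q ^ (2 * n)) * (1 - s * q ^ (2 * n) / q) * (1 - a * q ^ (n + 1)))

/-- The coefficient of the series of index `n - 1` in the recurrence of `vwpSum`. -/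
noncomputable def stepDown (q κ a s : ℂ) (x : Fin 5 → ℂ) (n : ℕ) : ℂ :=
  κ * q / q ^ n * (1 - q ^ n) * (1 - a * q ^ n) * (∏ i, (1 - x i * (s * q ^ n / (a * q ^ 2))))
    * (∏ i, (1 - a * q ^ n / x i))
    / ((1 - s * q ^ (2 * n) / q ^ 2) * (1 - s * q ^ (2 * n) / q) * (1 - s * q ^ n / (a * q ^ 2)))

theorem inv_qFac_mul_left {q y : ℂ} {k : ℕ} (h1 : 1 - y ≠ 0) (h2 : 1 - y * q ^ k ≠ 0) :
    (qFac q (y * q) k)⁻¹ = (qFac q y k)⁻¹ * ((1 - y) / (1 - y * q ^ k)) := by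
  have h := qFac_mul_shift q y k
  rw [← mul_div_cancel_left₀ (qFac q (y * q) k) h1, ← h]
  field_simp

theorem qFac_mul_left {q y : ℂ} {k : ℕ} (h1 : 1 - y ≠ 0) :
    qFac q (y * q) k = qFac q y k * ((1 - y * q ^ k) / (1 - y)) := by
  rw [← mul_div_assoc, qFac_mul_shift, mul_div_cancel_left₀ _ h1]

theorem qSub_mul_left {q y : ℂ} {k : ℕ} (h2 : q ^ k - y * q ≠ 0) :
    qSub q (y * q) k = qSub q y k * ((1 - y * q) * q ^ k / (q ^ k - y * q)) := by
  rw [← mul_div_cancel_right₀ (qSub q (y * q) k) h2, qSub_mul_shift]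
  ring

theorem inv_qSub_mul_left {q y : ℂ} {k : ℕ} (h2 : q ^ k - y * q ≠ 0) :
    (qSub q (y * q) k)⁻¹ = (qSub q y k)⁻¹ * ((q ^ k - y * q) / ((1 - y * q) * q ^ k)) := by
  rw [qSub_mul_left h2, mul_inv, inv_div]

theorem vwpTerm_succ_left {q a s : ℂ} {x : Fin 5 → ℂ} {n k : ℕ} (hq : q ≠ 0) (hk : k ≤ n)
    (h1 : 1 - s * q ^ n / q ≠ 0) (h2 : 1 - a * q ^ (n + 1) * q ^ k ≠ 0)
    (h2' : 1 - a * q ^ (n + 1) ≠ 0)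
    (h3 : q ^ k - q ^ n * q ≠ 0) (h4 : q ^ k - s * q ^ n / (a * q ^ 2) * q ≠ 0) :
    vwpTerm q a s x (n + 1) k = vwpTerm q a s x n k * ((∏ i, (1 - a * q * q ^ n / x i))
      * ((1 - s * q ^ n / q * q ^ k) / (1 - s * q ^ n / q))
      * ((1 - a * q ^ (n + 1)) / (1 - a * q ^ (n + 1) * q ^ k))
      * (((1 - q ^ n * q) * q ^ k / (q ^ k - q ^ n * q))
        * ((q ^ k - s * q ^ n / (a * q ^ 2) * q)
          / ((1 - s * q ^ n / (a * q ^ 2) * q) * q ^ k)))) := by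
  have hw : q ^ k ≠ 0 := pow_ne_zero _ hq
  have e1 : (∏ i, qFac q (a * q ^ (k + 1) / x i) (n + 1 - k)) =
      (∏ i, qFac q (a * q ^ (k + 1) / x i) (n - k)) * ∏ i, (1 - a * q * q ^ n / x i) := by
    rw [← Finset.prod_mul_distrib]
    refine Finset.prod_congr rfl fun i _ => ?_
    rw [Nat.sub_add_comm hk, qFac_succ]
    congr 2
    have : q ^ n = q ^ k * q ^ (n - k) := by rw [← pow_add]; congr 1; omega
    rw [this]
    ring
  have e2 := qFac_mul_left (q := q) (k := k) h1
  have e3 := inv_qFac_mul_left h2' h2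
  have e4 := qSub_mul_left h3
  have e5 := inv_qSub_mul_left h4
  have f2 : s * q ^ n / q * q = s * q ^ (n + 1) / q := by ring
  have f3 : a * q ^ (n + 1) * q = a * q ^ (n + 1 + 1) := by ring
  have f5 : s * q ^ n / (a * q ^ 2) * q = s * q ^ (n + 1) / (a * q ^ 2) := by ring
  rw [f2] at e2
  rw [f3] at e3
  rw [← pow_succ] at e4
  simp only [f5] at e5 ⊢
  rw [← pow_succ q n] at h3 ⊢
  rw [vwpTerm, vwpTerm, div_eq_mul_inv (qFac q (s * q ^ (n + 1) / q) k),
    div_eq_mul_inv (qSub q (q ^ (n + 1)) k), e1, e2, e3, e4, e5]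
  ring

theorem vwpTerm_down {q a s : ℂ} {x : Fin 5 → ℂ} {n k : ℕ} (hq : q ≠ 0) (hk : k ≤ n + 1)
    (hk0 : k ≠ 0)
    (h1 : 1 - s * q ^ n / q * q ^ k ≠ 0) (h2 : 1 - a * q ^ (n + 1) * q ^ k ≠ 0)
    (h2' : 1 - a * q ^ (n + 1) ≠ 0) (hQ : ∀ j : ℕ, j ≠ 0 → q ^ j ≠ 1)
    (h4 : q ^ k - s * q ^ n / (a * q ^ 2) * q ≠ 0)
    (h5 : 1 - s * q ^ n / (a * q ^ 2) * q ≠ 0) :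
    (∏ i, (1 - a * q ^ (n + 1) / x i)) * vwpTerm q a s x n k =
      vwpTerm q a s x (n + 1) k * (
      ((1 - s * q ^ n / q) / (1 - s * q ^ n / q * q ^ k))
      * ((1 - a * q ^ (n + 1) * q ^ k) / (1 - a * q ^ (n + 1)))
      * (((q ^ k - q ^ n * q) / ((1 - q ^ n * q) * q ^ k))
        * ((1 - s * q ^ n / (a * q ^ 2) * q) * q ^ k
          / (q ^ k - s * q ^ n / (a * q ^ 2) * q)))) := by
  have hw : q ^ k ≠ 0 := pow_ne_zero _ hq
  rcases Nat.lt_or_ge n k with hnk | hnk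
  · obtain rfl : k = n + 1 := by omega
    rw [vwpTerm, qSub_pow_of_lt q hnk, pow_succ q n, sub_self]
    simp
  have h3' : q ^ k - q ^ n * q ≠ 0 := by
    have : q ^ n * q = q ^ k * q ^ (n + 1 - k) := by
      rw [← pow_add, ← pow_succ]; congr 1; omega
    rw [this, ← mul_one_sub]
    exact mul_ne_zero hw (sub_ne_zero.2 (hQ _ (by omega)).symm)
  have h3 : 1 - q ^ n * q ≠ 0 := by
    rw [← pow_succ]
    exact sub_ne_zero.2 (hQ _ n.succ_ne_zero).symm
  by_cases h0 : 1 - s * q ^ n / q = 0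
  · have : qFac q (s * q ^ n / q) k = 0 := by
      obtain ⟨j, rfl⟩ := Nat.exists_eq_succ_of_ne_zero hk0
      rw [Nat.succ_eq_add_one, qFac_succ', h0, zero_mul]
    rw [vwpTerm, this, h0]
    simp
  rw [vwpTerm_succ_left hq hnk h0 h2 h2' h3' h4,
    show a * q * q ^ n = a * q ^ (n + 1) by ring]
  generalize vwpTerm q a s x n k = T
  generalize s * q ^ n / q = σ at *
  generalize s * q ^ n / (a * q ^ 2) * q = υ at *
  generalize q ^ n * q = M at *
  field_simp

theorem vwpTerm_succ_right {q a s : ℂ} {x : Fin 5 → ℂ} {n k : ℕ} (hq : q ≠ 0) (hk : k < n)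
    (hs : s ≠ 0) (ha : a ≠ 0)
    (h1 : 1 - a * (q ^ k) ^ 2 ≠ 0) (h2 : 1 - q * q ^ k ≠ 0)
    (h5 : 1 - a * (q ^ (k + 1)) ^ 2 ≠ 0)
    (h6 : 1 - a * q * (s * q ^ n / (a * q ^ 2)) * q ^ k ≠ 0) (h7 : q ^ k - q ^ n ≠ 0) :
    vwpTerm q a s x n k * ((1 - a * q ^ k) * (∏ i, (1 - x i * q ^ k)) / ((1 - a * (q ^ k) ^ 2)
        * q ^ k * (1 - a * q * q ^ n * q ^ k) * (q ^ k - s * q ^ n / (a * q ^ 2)))) =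
      vwpTerm q a s x n (k + 1) * ((1 - q ^ (k + 1)) * q ^ n
        * (∏ i, (1 - a * q ^ (k + 1) / x i)) / ((1 - a * (q ^ (k + 1)) ^ 2)
        * q ^ (k + 1) * (q ^ k - q ^ n)
        * (1 - a * q * (s * q ^ n / (a * q ^ 2)) * q ^ k) * (s * q ^ n / (a * q ^ 2)))) := by
  have hw : q ^ k ≠ 0 := pow_ne_zero _ hq
  have hN : q ^ n ≠ 0 := pow_ne_zero _ hq
  have e1 : (∏ i, qFac q (a * q ^ (k + 1) / x i) (n - k)) =
      (∏ i, (1 - a * q ^ (k + 1) / x i)) * ∏ i, qFac q (a * q ^ (k + 1 + 1) / x i) (n - (k + 1)) := by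
    rw [← Finset.prod_mul_distrib]
    refine Finset.prod_congr rfl fun i _ => ?_
    rw [show n - k = n - (k + 1) + 1 by omega, qFac_succ']
    congr 2
    ring
  have e2 : (∏ i, qFac q (x i) (k + 1)) = (∏ i, qFac q (x i) k) * ∏ i, (1 - x i * q ^ k) := by
    rw [← Finset.prod_mul_distrib]
    exact Finset.prod_congr rfl fun i _ => qFac_succ _ _ _
  rw [vwpTerm, vwpTerm, e1, e2]
  simp only [qFac_succ, qSub_succ]
  have hu : s / (a * q) = q * (s * q ^ n / (a * q ^ 2)) / q ^ n := by
    field_simp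
  have hσ : s * q ^ n / q = a * q * (s * q ^ n / (a * q ^ 2)) := by
    field_simp
  have hu0 : s * q ^ n / (a * q ^ 2) ≠ 0 := by positivity
  have g1 : 1 - a * q ^ (2 * k) = 1 - a * (q ^ k) ^ 2 := by ring
  have g2 : 1 - a * q ^ (2 * (k + 1)) = 1 - a * (q ^ (k + 1)) ^ 2 := by ring
  have g3 : 1 - a * q ^ (n + 1) * q ^ k = 1 - a * q * q ^ n * q ^ k := by ring
  have g4 : 1 - q ^ (k + 1) = 1 - q * q ^ k := by ring
  rw [pow_succ (s / (a * q)) k, g1, g2, g3, g4]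
  generalize (s / (a * q)) ^ k = Z
  rw [hu, hσ]
  generalize s * q ^ n / (a * q ^ 2) = u at *
  generalize 1 - a * (q ^ k) ^ 2 = D1 at *
  generalize 1 - a * (q ^ (k + 1)) ^ 2 = D2 at *
  generalize 1 - a * q * q ^ n * q ^ k = D3
  generalize 1 - a * q * u * q ^ k = D4 at *
  generalize 1 - q * q ^ k = D5 at *
  generalize q ^ k - u = D6
  generalize q ^ k - q ^ n = D7 at *
  generalize q ^ n = N at *
  rw [pow_succ q (k + 1), pow_succ q k]
  generalize q ^ k = w at *
  generalize (∏ i, (1 - a * (w * q) / x i)) = P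
  generalize (∏ i, (1 - x i * w)) = X
  generalize (∏ i, qFac q (x i) k) = B
  generalize (∏ i, qFac q (a * (w * q * q) / x i) (n - (k + 1))) = Q
  generalize qFac q a k = A
  simp only [div_eq_mul_inv, mul_inv]
  generalize (qFac q q k)⁻¹ = C
  generalize (1 - a)⁻¹ = G
  generalize qFac q (a * q * u) k = U
  generalize (qFac q (a * q ^ (n + 1)) k)⁻¹ = V
  generalize qSub q N k = R
  generalize (qSub q u k)⁻¹ = S
  have c1 := mul_inv_cancel₀ h1
  have c2 := mul_inv_cancel₀ h5
  have c3 := mul_inv_cancel₀ h6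
  have c4 := mul_inv_cancel₀ h2
  have c5 := mul_inv_cancel₀ h7
  have c6 := mul_inv_cancel₀ hN
  have c7 := mul_inv_cancel₀ hq
  have c8 := mul_inv_cancel₀ hu0
  trans G * A * B * C * P * Q * U * V * Z * R * S * (1 - a * w) * X * w⁻¹ * D3⁻¹ * D6⁻¹
  · linear_combination
      (G * A * B * C * P * Q * U * V * Z * R * S * (1 - a * w) * X * w⁻¹ * D3⁻¹ * D6⁻¹) * c1
  · trans (G * A * B * C * P * Q * U * V * Z * R * S * (1 - a * w) * X * w⁻¹ * D3⁻¹ * D6⁻¹)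
      * ((D2 * D2⁻¹) * (D4 * D4⁻¹) * (D5 * D5⁻¹) * (D7 * D7⁻¹) * (N * N⁻¹) * (q * q⁻¹) * (u * u⁻¹))
    · rw [c2, c3, c4, c5, c6, c7, c8]
      ring
    · ring

/-- The coefficient of the series of index `n` in the recurrence of `vwpSum`; up to the choice of
`κ = q^{1/2}/√s` it is the number `a_n`. -/
noncomputable def stepMid (q κ a s : ℂ) (x : Fin 5 → ℂ) (n : ℕ) : ℂ :=
  κ / q ^ n / (1 - s * q ^ (2 * n) / q) *
    ((1 - s * q ^ n / q) * (1 - s * q ^ n / (a * q)) * (∏ i, (1 - a * q * q ^ n / x i))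
          / ((1 - s * q ^ (2 * n)) * (1 - a * q * q ^ n))
        + q * (1 - q ^ n) * (1 - a * q ^ n) * (∏ i, (1 - x i * (s * q ^ n / (a * q ^ 2))))
          / ((1 - s * q ^ (2 * n) / q ^ 2) * (1 - s * q ^ n / (a * q ^ 2)))
        + q * (s * q ^ n / (a * q ^ 2)) * (1 - s * q ^ (2 * n) / q)
          * (q ^ n - s * q ^ n / (a * q ^ 2)) * (∏ i, (1 - x i))
          / ((1 - s * q ^ n / (a * q ^ 2)) * (1 - a * q * q ^ n)))

theorem recA_eq {q rq s rs a b c d e f : ℂ} {n : ℕ} (hq : q ≠ 0) (hrq : rq ^ 2 = q)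
    (hrs : rs ^ 2 = s) (hs : s ≠ 0) (ha : a ≠ 0)
    (h1 : 1 - s * q ^ (2 * n) / q ≠ 0) (h2 : 1 - a * q * q ^ n ≠ 0)
    (h3 : 1 - s * q ^ n / (a * q ^ 2) ≠ 0) :
    recA q rq s rs a b c d e f n = stepMid q (rq / rs) a s ![b, c, d, e, f] n := by
  have hN : q ^ n ≠ 0 := pow_ne_zero _ hq
  have hrq0 : rq ≠ 0 := by rintro rfl; exact hq (by simpa using hrq.symm)
  have hrs0 : rs ≠ 0 := by rintro rfl; exact hs (by simpa using hrs.symm)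
  have z1 : q ^ (-(n : ℤ)) = (q ^ n)⁻¹ := by rw [zpow_neg, zpow_natCast]
  have z2 : q ^ ((n : ℤ) - 1) = q ^ n / q := by rw [zpow_sub₀ hq, zpow_natCast, zpow_one]
  have z3 : q ^ ((n : ℤ) - 2) = q ^ n / q ^ 2 := by
    rw [zpow_sub₀ hq, zpow_natCast]; rfl
  have z4 : q ^ (2 * (n : ℤ) - 1) = q ^ (2 * n) / q := by
    rw [zpow_sub₀ hq, zpow_one]; congr 1
  have z5 : q ^ (2 * (n : ℤ) - 2) = q ^ (2 * n) / q ^ 2 := by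
    rw [zpow_sub₀ hq]; congr 1
  rw [recA, stepMid, z1, z2, z3, z4, z5]
  simp only [Fin.prod_univ_five, Matrix.cons_val]
  have e0 : ∀ y : ℂ, 1 - y * (s * q ^ n / (a * q ^ 2)) = 1 - y * s / a * (q ^ n / q ^ 2) :=
    fun y => by ring
  have e1 : ∀ y : ℂ, 1 - a * q * q ^ n / y = 1 - a / y * q ^ (n + 1) := fun y => by ring
  have e2 : 1 - s * q ^ n / (a * q ^ 2) = 1 - s / a * (q ^ n / q ^ 2) := by ring
  have e3 : 1 - s * q ^ n / (a * q) = 1 - s / a * (q ^ n / q) := by ring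
  have e4 : 1 - s * q ^ (2 * n) / q = 1 - s * (q ^ (2 * n) / q) := by ring
  have e5 : 1 - s * q ^ (2 * n) / q ^ 2 = 1 - s * (q ^ (2 * n) / q ^ 2) := by ring
  have e6 : 1 - a * q * q ^ n = 1 - a * q ^ (n + 1) := by ring
  have e7 : q ^ n - s * q ^ n / (a * q ^ 2) = q ^ n * (1 - s / (a * q ^ 2)) := by ring
  have e8 : 1 - s * q ^ n / q = 1 - s * (q ^ n / q) := by ring
  have e9 : q * (s * q ^ n / (a * q ^ 2)) = rs ^ 2 * q ^ n / (a * rq ^ 2) := by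
    rw [hrs, hrq]; field_simp
  rw [e2] at h3
  rw [e4] at h1
  rw [e6] at h2
  simp only [e0, e1, e2, e3, e4, e5, e6, e7, e8]
  have k1 : q * (s * q ^ n / (a * q ^ 2)) = rs ^ 2 * q ^ n / (a * rq ^ 2) := e9
  rw [k1]
  generalize 1 - s / a * (q ^ n / q ^ 2) = D1 at *
  generalize 1 - s * (q ^ (2 * n) / q) = D2 at *
  generalize 1 - a * q ^ (n + 1) = D3 at *
  generalize (1 - a / b * q ^ (n + 1)) * (1 - a / c * q ^ (n + 1)) * (1 - a / d * q ^ (n + 1)) *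
    (1 - a / e * q ^ (n + 1)) * (1 - a / f * q ^ (n + 1)) = X1
  generalize (1 - b * s / a * (q ^ n / q ^ 2)) * (1 - c * s / a * (q ^ n / q ^ 2)) *
    (1 - d * s / a * (q ^ n / q ^ 2)) * (1 - e * s / a * (q ^ n / q ^ 2)) *
    (1 - f * s / a * (q ^ n / q ^ 2)) = X2
  have hX3 : rs / a * (q ^ n / rq) * D2 * (1 - s / (a * q ^ 2)) * (1 - b) * (1 - c) * (1 - d)
      * (1 - e) * (1 - f) = rs / a * (q ^ n / rq) * D2 * (1 - s / (a * q ^ 2)) * ((1 - b) * (1 - c) * (1 - d)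
      * (1 - e) * (1 - f)) := by ring
  rw [hX3]
  generalize (1 - b) * (1 - c) * (1 - d) * (1 - e) * (1 - f) = X3
  generalize 1 - s * (q ^ n / q) = Y1
  generalize 1 - s / a * (q ^ n / q) = Y2
  generalize 1 - s / (a * q ^ 2) = Y3
  simp only [div_eq_mul_inv, mul_inv]
  generalize (1 - s * q ^ (2 * n))⁻¹ = Z1
  generalize (1 - s * (q ^ (2 * n) * (q ^ 2)⁻¹))⁻¹ = Z2
  generalize q ^ n = N at *
  subst hrq
  generalize 1 - a * N = Y4
  generalize 1 - N = Y5
  field_simp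

theorem vwpTerm_last {q κ a s : ℂ} {x : Fin 5 → ℂ} {n : ℕ} (hq : q ≠ 0) (ha : a ≠ 0)
    (h1 : 1 - s * q ^ n / q ≠ 0) (h2 : 1 - a * q ^ (n + 1) ≠ 0)
    (h3 : 1 - q * q ^ n ≠ 0) (h4 : 1 - s * q ^ n / (a * q) ≠ 0)
    (h5 : 1 - s * q ^ (2 * n) / q ≠ 0) (h6 : 1 - s * q ^ (2 * n) ≠ 0)
    (h7 : 1 - a * (q ^ n) ^ 2 ≠ 0) (h8 : 1 - a * q ^ (2 * (n + 1)) ≠ 0)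
    (h9 : q ^ n - s * q ^ n / (a * q ^ 2) ≠ 0) :
    stepUp q κ a s n * vwpTerm q a s x (n + 1) (n + 1) =
      κ * q * (q ^ n - s * q ^ n / (a * q ^ 2)) * (s * q ^ n / (a * q ^ 2)) / q ^ n *
        (vwpTerm q a s x n n * ((1 - a * q ^ n) * (∏ i, (1 - x i * q ^ n)) /
          ((1 - a * (q ^ n) ^ 2) * q ^ n * (1 - a * q * q ^ n * q ^ n)
            * (q ^ n - s * q ^ n / (a * q ^ 2))))) := by
  have hN : q ^ n ≠ 0 := pow_ne_zero _ hq
  have e2 : (∏ i, qFac q (x i) (n + 1)) = (∏ i, qFac q (x i) n) * ∏ i, (1 - x i * q ^ n) := by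
    rw [← Finset.prod_mul_distrib]
    exact Finset.prod_congr rfl fun i _ => qFac_succ _ _ _
  have e3 : qFac q (s * q ^ (n + 1) / q) (n + 1) = qFac q (s * q ^ n / q) n
      * ((1 - s * q ^ (2 * n) / q) * (1 - s * q ^ (2 * n)) / (1 - s * q ^ n / q)) := by
    have k1 : 1 - s * q ^ n / q * q ^ (n + 1) = 1 - s * q ^ (2 * n) := by field_simp; ring
    have k2 : 1 - s * q ^ n / q * q ^ n = 1 - s * q ^ (2 * n) / q := by ring
    rw [show s * q ^ (n + 1) / q = s * q ^ n / q * q by ring, qFac_mul_left h1, qFac_succ, k1, k2]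
    ring
  have e4 : (qFac q (a * q ^ (n + 1 + 1)) (n + 1))⁻¹ = (qFac q (a * q ^ (n + 1)) n)⁻¹
      * ((1 - a * q ^ (n + 1)) / ((1 - a * q * q ^ n * q ^ n) * (1 - a * q ^ (2 * (n + 1))))) := by
    rw [show a * q ^ (n + 1 + 1) = a * q ^ (n + 1) * q by ring, inv_qFac_mul_left h2, qFac_succ]
    · have k1 : 1 - a * q ^ (n + 1) * q ^ (n + 1) = 1 - a * q ^ (2 * (n + 1)) := by ring
      have k2 : 1 - a * q ^ (n + 1) * q ^ n = 1 - a * q * q ^ n * q ^ n := by ring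
      rw [k1, k2, mul_inv, div_eq_mul_inv, div_eq_mul_inv, mul_inv]
      ring
    · convert h8 using 1
      ring
  have e5 : qSub q (q ^ (n + 1)) (n + 1) = (1 - q * q ^ n) * q ^ n * qSub q (q ^ n) n := by
    rw [pow_succ q n, qSub_succ_shift, mul_comm (q ^ n) q]
  have e6 : qSub q (s * q ^ (n + 1) / (a * q ^ 2)) (n + 1) =
      (1 - s * q ^ n / (a * q)) * q ^ n * qSub q (s * q ^ n / (a * q ^ 2)) n := by
    rw [show s * q ^ (n + 1) / (a * q ^ 2) = s * q ^ n / (a * q ^ 2) * q by ring,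
      qSub_succ_shift]
    congr 3
    field_simp
  have hz : s / (a * q) = q * (s * q ^ n / (a * q ^ 2)) / q ^ n := by field_simp
  rw [stepUp, vwpTerm, vwpTerm, e2, e5, e6, pow_succ (s / (a * q)) n, Nat.sub_self, Nat.sub_self]
  have hz' : (s / (a * q)) ^ n * (s / (a * q)) =
    (s / (a * q)) ^ n * (q * (s * q ^ n / (a * q ^ 2)) / q ^ n) := by rw [← hz]
  rw [hz']
  generalize (s / (a * q)) ^ n = Z
  rw [qFac_succ q a, qFac_succ q q, div_eq_mul_inv (qFac q (s * q ^ (n + 1) / q) (n + 1)), e3, e4,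
    show a * q ^ (2 * n) = a * (q ^ n) ^ 2 by ring]
  simp only [qFac_zero, Finset.prod_const_one]
  generalize s * q ^ n / (a * q ^ 2) = u at *
  generalize 1 - a * (q ^ n) ^ 2 = D1 at *
  generalize 1 - s * q ^ (2 * n) / q = D2 at *
  generalize 1 - s * q ^ (2 * n) = D3 at *
  generalize 1 - s * q ^ n / (a * q) = D4 at *
  generalize 1 - s * q ^ n / q = D5 at *
  generalize 1 - a * q ^ (n + 1) = D6 at *
  generalize 1 - q * q ^ n = D7 at *
  generalize 1 - a * q ^ (2 * (n + 1)) = D8 at *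
  generalize 1 - a * q * q ^ n * q ^ n = D9 at *
  generalize q ^ n - u = D10 at *
  generalize (∏ i, (1 - x i * q ^ n)) = X
  generalize (∏ i, qFac q (x i) n) = B
  generalize qFac q a n = A
  generalize qFac q (s * q ^ n / q) n = U
  simp only [div_eq_mul_inv, mul_inv]
  generalize (qFac q q n)⁻¹ = C
  generalize (1 - a)⁻¹ = G
  generalize (qFac q (a * q ^ (n + 1)) n)⁻¹ = V
  generalize qSub q (q ^ n) n = R
  generalize (qSub q u n)⁻¹ = S
  generalize 1 - a * q ^ n = Y
  generalize q ^ n = N at *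
  trans κ * q * u * N⁻¹ * N⁻¹ * G * A * B * C * U * V * Z * R * S * Y * X * D9⁻¹
  · trans (κ * q * u * N⁻¹ * N⁻¹ * G * A * B * C * U * V * Z * R * S * Y * X * D9⁻¹)
      * ((D5 * D5⁻¹) * (D4 * D4⁻¹) * (D3 * D3⁻¹) * (D2 * D2⁻¹) * (D6 * D6⁻¹) * (D8 * D8⁻¹)
        * (D7 * D7⁻¹) * (N * N⁻¹))
    · ring
    · simp only [mul_inv_cancel₀ h1, mul_inv_cancel₀ h2, mul_inv_cancel₀ h3, mul_inv_cancel₀ h4,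
        mul_inv_cancel₀ h5, mul_inv_cancel₀ h6, mul_inv_cancel₀ h8, mul_inv_cancel₀ hN, mul_one]
  · trans (κ * q * u * N⁻¹ * N⁻¹ * G * A * B * C * U * V * Z * R * S * Y * X * D9⁻¹)
      * ((D1 * D1⁻¹) * (D10 * D10⁻¹))
    · simp only [mul_inv_cancel₀ h7, mul_inv_cancel₀ h9, mul_one]
    · ring

/-- The telescoping certificate of the recurrence: applied termwise, the recurrence has the partial
sums `telescoper q a s x n k` for `k ≤ n`, up to a factor that does not depend on `k`. -/
noncomputable def telescoper (q a s : ℂ) (x : Fin 5 → ℂ) (n k : ℕ) : ℂ :=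
  vwpTerm q a s x n k * ((1 - a * q ^ k) * (∏ i, (1 - x i * q ^ k)) / ((1 - a * (q ^ k) ^ 2)
    * q ^ k * (1 - a * q * q ^ n * q ^ k) * (q ^ k - s * q ^ n / (a * q ^ 2))))

/-- The conditions under which the recurrence of `vwpSum` at index `n` is proved: the balancing
condition, and the nonvanishing of all denominators. -/
structure StepRegular (q a s : ℂ) (x : Fin 5 → ℂ) (n : ℕ) : Prop where
  q_ne : q ≠ 0
  a_ne : a ≠ 0
  s_ne : s ≠ 0
  x_ne : ∀ i, x i ≠ 0
  prod_eq : (∏ i, x i) * s = a ^ 3 * q ^ 3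
  pow_ne : ∀ j : ℕ, j ≠ 0 → q ^ j ≠ 1
  a_pow_ne : ∀ j : ℕ, a * q ^ j ≠ 1
  s_pow_ne : ∀ i j : ℕ, s * q ^ i ≠ a * q ^ j
  low_ne : ∀ j : ℕ, s * q ^ n * q ^ j ≠ q
  down_ne : s * q ^ (2 * n) ≠ q ^ 2

namespace StepRegular

variable {q a s : ℂ} {x : Fin 5 → ℂ} {n : ℕ}

theorem sub_pow_ne (h : StepRegular q a s x n) (j : ℕ) : q ^ j - s * q ^ n / (a * q ^ 2) ≠ 0 := by
  have hq := h.q_ne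
  have ha := h.a_ne
  intro h0
  refine h.s_pow_ne n (j + 2) ?_
  field_simp at h0
  linear_combination -h0

theorem one_sub_ne (h : StepRegular q a s x n) (j : ℕ) : 1 - a * q ^ j ≠ 0 :=
  sub_ne_zero.2 (h.a_pow_ne j).symm

theorem low_ne' (h : StepRegular q a s x n) (j : ℕ) : 1 - s * q ^ n / q * q ^ j ≠ 0 := by
  have hq := h.q_ne
  intro h0
  refine h.low_ne j ?_
  field_simp at h0
  linear_combination -h0

theorem pow_sub_pow_ne (h : StepRegular q a s x n) {i j : ℕ} (hij : i < j) : q ^ i - q ^ j ≠ 0 := by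
  obtain ⟨l, rfl⟩ := Nat.exists_eq_add_of_lt hij
  rw [add_assoc, pow_add, ← mul_one_sub]
  exact mul_ne_zero (pow_ne_zero _ h.q_ne) (sub_ne_zero.2 (h.pow_ne _ l.succ_ne_zero).symm)

theorem up_eq (h : StepRegular q a s x n) (κ : ℂ) {k : ℕ} (hk : k ≤ n) :
    stepUp q κ a s n * vwpTerm q a s x (n + 1) k = vwpTerm q a s x n k
      * (κ / q ^ n / (1 - s * q ^ (2 * n) / q)) *
      ((∏ i, (1 - a * q * q ^ n / x i)) * (1 - q * q ^ n)
        * (1 - a * q * (s * q ^ n / (a * q ^ 2)) * q ^ k)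
        * (q ^ k - q * (s * q ^ n / (a * q ^ 2)))
        / ((1 - a * q ^ 2 * (s * q ^ n / (a * q ^ 2)) * q ^ n) * (1 - a * q * q ^ n * q ^ k)
          * (q ^ k - q * q ^ n))) := by
  have hq := h.q_ne
  have ha := h.a_ne
  have hw : q ^ k ≠ 0 := pow_ne_zero _ hq
  have d1 : 1 - s * q ^ n / q ≠ 0 := by simpa using h.low_ne' 0
  have d2 : 1 - a * q ^ (n + 1) * q ^ k ≠ 0 := by
    have := h.one_sub_ne (n + 1 + k); rwa [pow_add, ← mul_assoc] at this
  have d3 : q ^ k - q ^ n * q ≠ 0 := by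
    rw [← pow_succ]; exact h.pow_sub_pow_ne (Nat.lt_succ_of_le hk)
  have d4 : ∀ k : ℕ, q ^ k - s * q ^ n / (a * q ^ 2) * q ≠ 0 := by
    intro k h0
    refine h.s_pow_ne n (k + 1) ?_
    field_simp at h0
    linear_combination -h0
  have d5 : 1 - s * q ^ n / (a * q ^ 2) * q ≠ 0 := by simpa using d4 0
  rw [vwpTerm_succ_left hq hk d1 d2 (h.one_sub_ne _) d3 (d4 k), stepUp]
  have e1 : s * q ^ n / q = a * q * (s * q ^ n / (a * q ^ 2)) := by field_simp
  have e2 : s * q ^ n / (a * q) = s * q ^ n / (a * q ^ 2) * q := by field_simp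
  have e3 : s * q ^ (2 * n) = a * q ^ 2 * (s * q ^ n / (a * q ^ 2)) * q ^ n := by
    field_simp; ring
  have e4 : a * q ^ (n + 1) * q ^ k = a * q * q ^ n * q ^ k := by ring
  have d6 := h.one_sub_ne (n + 1)
  rw [e1] at d1
  rw [e4] at d2
  rw [e1, e2, e3, e4, mul_comm q (s * q ^ n / (a * q ^ 2)), mul_comm q (q ^ n)]
  generalize s * q ^ n / (a * q ^ 2) = u at *
  generalize 1 - a * q * u = D1 at *
  generalize 1 - a * q * q ^ n * q ^ k = D2 at *
  generalize q ^ k - q ^ n * q = D3 at *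
  generalize 1 - u * q = D5 at *
  generalize 1 - a * q ^ (n + 1) = D6 at *
  generalize vwpTerm q a s x n k = T
  generalize (∏ i, (1 - a * q * q ^ n / x i)) = P
  simp only [div_eq_mul_inv, mul_inv]
  generalize (1 - a * q ^ 2 * u * q ^ n)⁻¹ = G
  generalize (1 - a * q ^ 2 * u * q ^ n * q⁻¹)⁻¹ = G'
  generalize (q ^ n)⁻¹ = L
  trans T * κ * L * G * G' * P * (1 - q ^ n * q) * (1 - a * q * u * q ^ k) * (q ^ k - u * q)
    * D2⁻¹ * D3⁻¹ * ((D1 * D1⁻¹) * (D5 * D5⁻¹) * (D6 * D6⁻¹) * (q ^ k * (q ^ k)⁻¹))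
  · ring
  · rw [mul_inv_cancel₀ d1, mul_inv_cancel₀ d5, mul_inv_cancel₀ d6, mul_inv_cancel₀ hw]
    ring

theorem down_eq {p : ℕ} (h : StepRegular q a s x (p + 1)) (κ : ℂ) {k : ℕ} (hk0 : k ≠ 0)
    (hk : k ≤ p + 1) :
    stepDown q κ a s x (p + 1) * vwpTerm q a s x p k = vwpTerm q a s x (p + 1) k
      * (κ / q ^ (p + 1) / (1 - s * q ^ (2 * (p + 1)) / q)) *
      (q * (∏ i, (1 - x i * (s * q ^ (p + 1) / (a * q ^ 2))))
        * (1 - a * (s * q ^ (p + 1) / (a * q ^ 2))) * (1 - a * q ^ (p + 1) * q ^ k)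
        * (q ^ k - q ^ (p + 1))
        / ((1 - a * (s * q ^ (p + 1) / (a * q ^ 2)) * q ^ (p + 1))
          * (1 - a * (s * q ^ (p + 1) / (a * q ^ 2)) * q ^ k)
          * (q ^ k - s * q ^ (p + 1) / (a * q ^ 2)))) := by
  have hq := h.q_ne
  have ha := h.a_ne
  have hw : q ^ k ≠ 0 := pow_ne_zero _ hq
  have e1 : s * q ^ p / (a * q ^ 2) * q = s * q ^ (p + 1) / (a * q ^ 2) := by ring
  have e2 : s * q ^ p / q = a * (s * q ^ (p + 1) / (a * q ^ 2)) := by field_simp; ring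
  have d1 : 1 - s * q ^ p / q * q ^ k ≠ 0 := by
    obtain ⟨j, rfl⟩ := Nat.exists_eq_succ_of_ne_zero hk0
    have := h.low_ne' j
    convert this using 2
    rw [Nat.succ_eq_add_one]
    ring
  have d2 : 1 - a * q ^ (p + 1) * q ^ k ≠ 0 := by
    have := h.one_sub_ne (p + 1 + k); rwa [pow_add, ← mul_assoc] at this
  have d3 := h.one_sub_ne (p + 1)
  have d4 := h.sub_pow_ne k
  have d5 : 1 - s * q ^ (p + 1) / (a * q ^ 2) ≠ 0 := by simpa using h.sub_pow_ne 0
  have key := vwpTerm_down (x := x) hq hk hk0 d1 d2 d3 h.pow_ne (by rwa [e1]) (by rwa [e1])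
  have d6 : 1 - q ^ (p + 1) ≠ 0 := sub_ne_zero.2 (h.pow_ne _ p.succ_ne_zero).symm
  rw [e1, e2, ← pow_succ] at key
  rw [e2] at d1
  have e3 : s * q ^ (2 * (p + 1)) / q ^ 2 =
      a * (s * q ^ (p + 1) / (a * q ^ 2)) * q ^ (p + 1) := by field_simp; ring
  rw [stepDown, e3]
  generalize s * q ^ (p + 1) / (a * q ^ 2) = u at *
  generalize vwpTerm q a s x p k = T' at *
  generalize vwpTerm q a s x (p + 1) k = T at *
  generalize (∏ i, (1 - a * q ^ (p + 1) / x i)) = P at *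
  trans κ * q / q ^ (p + 1) * (1 - q ^ (p + 1)) * (1 - a * q ^ (p + 1)) * (∏ i, (1 - x i * u))
    / ((1 - a * u * q ^ (p + 1)) * (1 - s * q ^ (2 * (p + 1)) / q) * (1 - u)) * (P * T')
  · ring
  rw [key]
  generalize 1 - a * u * q ^ k = D1 at *
  generalize 1 - a * q ^ (p + 1) * q ^ k = D2 at *
  generalize 1 - a * q ^ (p + 1) = D3 at *
  generalize q ^ k - u = D4 at *
  generalize 1 - u = D5 at *
  generalize 1 - q ^ (p + 1) = D6 at *
  generalize (∏ i, (1 - x i * u)) = X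
  simp only [div_eq_mul_inv, mul_inv]
  generalize (1 - a * u * q ^ (p + 1))⁻¹ = G
  generalize (1 - s * q ^ (2 * (p + 1)) * q⁻¹)⁻¹ = G'
  generalize (q ^ (p + 1))⁻¹ = L
  trans T * κ * L * q * G * G' * X * (1 - a * u) * (q ^ k - q ^ (p + 1)) * D2
    * D1⁻¹ * D4⁻¹ * ((D3 * D3⁻¹) * (D5 * D5⁻¹) * (D6 * D6⁻¹) * (q ^ k * (q ^ k)⁻¹))
  · ring
  · rw [mul_inv_cancel₀ d3, mul_inv_cancel₀ d5, mul_inv_cancel₀ d6, mul_inv_cancel₀ hw]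
    ring

end StepRegular

namespace StepRegular

variable {q a s : ℂ} {x : Fin 5 → ℂ} {n : ℕ}

theorem vwpTerm_zero_right (h : StepRegular q a s x n) (p : ℕ) :
    vwpTerm q a s x p 0 = ∏ i, qFac q (a * q / x i) p := by
  have h1 : 1 - a ≠ 0 := by simpa using h.one_sub_ne 0
  simp [vwpTerm, qFac_zero, qSub, div_self h1]

theorem down_zero (h : StepRegular q a s x n) (κ : ℂ) :
    stepDown q κ a s x n * vwpTerm q a s x (n - 1) 0 = vwpTerm q a s x n 0
      * (κ / q ^ n / (1 - s * q ^ (2 * n) / q)) *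
      (q * (1 - q ^ n) * (1 - a * q ^ n) * (∏ i, (1 - x i * (s * q ^ n / (a * q ^ 2))))
          / ((1 - s * q ^ (2 * n) / q ^ 2) * (1 - s * q ^ n / (a * q ^ 2)))) := by
  cases n with
  | zero => simp [stepDown]
  | succ p =>
    have e : vwpTerm q a s x (p + 1) 0 =
        (∏ i, (1 - a * q ^ (p + 1) / x i)) * vwpTerm q a s x p 0 := by
      rw [h.vwpTerm_zero_right, h.vwpTerm_zero_right, ← Finset.prod_mul_distrib]
      refine Finset.prod_congr rfl fun i _ => ?_
      rw [qFac_succ]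
      ring
    rw [e, stepDown, Nat.add_sub_cancel]
    simp only [div_eq_mul_inv, mul_inv]
    ring

theorem start_eq (h : StepRegular q a s x n) (κ : ℂ) :
    stepUp q κ a s n * vwpTerm q a s x (n + 1) 0 - stepMid q κ a s x n * vwpTerm q a s x n 0
        + stepDown q κ a s x n * vwpTerm q a s x (n - 1) 0 =
      -(κ * q * (q ^ n - s * q ^ n / (a * q ^ 2)) * (s * q ^ n / (a * q ^ 2)) / q ^ n)
        * telescoper q a s x n 0 := by
  have hq := h.q_ne
  have ha := h.a_ne
  have d0 : 1 - a ≠ 0 := by simpa using h.one_sub_ne 0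
  have d1 : 1 - s * q ^ (2 * n) / q ≠ 0 := by
    have := h.low_ne' n
    convert this using 2
    ring
  have d2 : 1 - a * q * q ^ n ≠ 0 := by
    have := h.one_sub_ne (n + 1); rwa [pow_succ', ← mul_assoc] at this
  have d3 : 1 - q * q ^ n ≠ 0 := by
    have := h.pow_sub_pow_ne (Nat.succ_pos n); rwa [pow_zero, Nat.succ_eq_add_one, pow_succ'] at this
  rw [h.up_eq κ (Nat.zero_le n), h.down_zero, stepMid, telescoper]
  have e1 : s * q ^ n / q = a * q * (s * q ^ n / (a * q ^ 2)) := by field_simp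
  have e2 : s * q ^ n / (a * q) = q * (s * q ^ n / (a * q ^ 2)) := by field_simp
  have e3 : s * q ^ (2 * n) = a * q ^ 2 * (s * q ^ n / (a * q ^ 2)) * q ^ n := by
    field_simp; ring
  rw [e1, e2]
  simp only [pow_zero, mul_one, one_pow]
  rw [← e3]
  generalize s * q ^ n / (a * q ^ 2) = u at *
  generalize 1 - s * q ^ (2 * n) / q = D1 at *
  generalize 1 - a * q * q ^ n = D2 at *
  generalize 1 - q * q ^ n = D3 at *
  generalize vwpTerm q a s x n 0 = T
  generalize (∏ i, (1 - a * q * q ^ n / x i)) = P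
  generalize (∏ i, (1 - x i * u)) = P'
  generalize (∏ i, (1 - x i)) = P''
  simp only [div_eq_mul_inv, mul_inv]
  generalize (1 - s * q ^ (2 * n))⁻¹ = G
  generalize (1 - s * q ^ (2 * n) * (q ^ 2)⁻¹)⁻¹ = G'
  generalize (1 - u)⁻¹ = G''
  generalize (q ^ n)⁻¹ = L
  have c1 := mul_inv_cancel₀ d1
  have c3 := mul_inv_cancel₀ d3
  have c0 := mul_inv_cancel₀ d0
  linear_combination (T * κ * L * D1⁻¹ * P * (1 - a * q * u) * (1 - q * u) * G * D2⁻¹) * c3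
    - (T * κ * L * q * u * (q ^ n - u) * P'' * G'' * D2⁻¹) * c1
    + (κ * q * (q ^ n - u) * u * L * T * P'' * D2⁻¹ * G'') * c0

theorem telescoper_succ (h : StepRegular q a s x n) {k : ℕ} (hk : k < n) :
    telescoper q a s x n k =
      vwpTerm q a s x n (k + 1) * ((1 - q ^ (k + 1)) * q ^ n
        * (∏ i, (1 - a * q ^ (k + 1) / x i)) / ((1 - a * (q ^ (k + 1)) ^ 2)
        * q ^ (k + 1) * (q ^ k - q ^ n)
        * (1 - a * q * (s * q ^ n / (a * q ^ 2)) * q ^ k) * (s * q ^ n / (a * q ^ 2)))) := by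
  have hq := h.q_ne
  have ha := h.a_ne
  refine vwpTerm_succ_right hq hk h.s_ne ha ?_ ?_ ?_ ?_ (h.pow_sub_pow_ne hk)
  · rw [← pow_mul]; exact h.one_sub_ne _
  · have := h.pow_sub_pow_ne (Nat.succ_pos k)
    rwa [pow_zero, Nat.succ_eq_add_one, pow_succ'] at this
  · rw [← pow_mul]; exact h.one_sub_ne _
  · have e1 : s * q ^ n / q = a * q * (s * q ^ n / (a * q ^ 2)) := by field_simp
    rw [← e1]
    exact h.low_ne' k

theorem step_eq (h : StepRegular q a s x n) (κ : ℂ) {k : ℕ} (hk : k < n) :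
    stepUp q κ a s n * vwpTerm q a s x (n + 1) (k + 1)
        - stepMid q κ a s x n * vwpTerm q a s x n (k + 1)
        + stepDown q κ a s x n * vwpTerm q a s x (n - 1) (k + 1) =
      -(κ * q * (q ^ n - s * q ^ n / (a * q ^ 2)) * (s * q ^ n / (a * q ^ 2)) / q ^ n)
        * (telescoper q a s x n (k + 1) - telescoper q a s x n k) := by
  have hq := h.q_ne
  have ha := h.a_ne
  have hN : q ^ n ≠ 0 := pow_ne_zero _ hq
  have hw : q ^ (k + 1) ≠ 0 := pow_ne_zero _ hq
  have hu : s * q ^ n / (a * q ^ 2) ≠ 0 :=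
    div_ne_zero (mul_ne_zero h.s_ne hN) (mul_ne_zero ha (pow_ne_zero _ hq))
  have e1 : s * q ^ n / q = a * q * (s * q ^ n / (a * q ^ 2)) := by field_simp
  have e2 : s * q ^ n / (a * q) = q * (s * q ^ n / (a * q ^ 2)) := by field_simp
  have e3 : s * q ^ (2 * n) = a * q ^ 2 * (s * q ^ n / (a * q ^ 2)) * q ^ n := by
    field_simp; ring
  have e4 : s * q ^ (2 * n) / q = a * q * (s * q ^ n / (a * q ^ 2)) * q ^ n := by
    field_simp; ring
  have e5 : s * q ^ (2 * n) / q ^ 2 = a * (s * q ^ n / (a * q ^ 2)) * q ^ n := by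
    field_simp; ring
  have d1 : 1 - s * q ^ (2 * n) / q ≠ 0 := by
    have := h.low_ne' n
    convert this using 2
    ring
  have d2 : 1 - s * q ^ (2 * n) ≠ 0 := by
    have := h.low_ne' (n + 1)
    convert this using 2
    field_simp
    ring
  have d3 : 1 - s * q ^ (2 * n) / q ^ 2 ≠ 0 := by
    intro h0
    refine h.down_ne ?_
    field_simp at h0
    linear_combination -h0
  have d4 : 1 - a * q * q ^ n * q ^ (k + 1) ≠ 0 := by
    have := h.one_sub_ne (n + 1 + (k + 1))
    rwa [pow_add, ← mul_assoc, pow_succ' q n, ← mul_assoc] at this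
  have d5 : q ^ (k + 1) - q * q ^ n ≠ 0 := by
    rw [← pow_succ']; exact h.pow_sub_pow_ne (by omega)
  have d6 : 1 - a * (s * q ^ n / (a * q ^ 2)) * q ^ (k + 1) ≠ 0 := by
    have := h.low_ne' k
    rw [e1] at this
    convert this using 2
    ring
  have d8 : 1 - a * (q ^ (k + 1)) ^ 2 ≠ 0 := by rw [← pow_mul]; exact h.one_sub_ne _
  have d9 : 1 - a * q * q ^ n ≠ 0 := by
    have := h.one_sub_ne (n + 1); rwa [pow_succ', ← mul_assoc] at this
  have d10 : 1 - s * q ^ n / (a * q ^ 2) ≠ 0 := by simpa using h.sub_pow_ne 0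
  obtain ⟨p, rfl⟩ : ∃ p, n = p + 1 := Nat.exists_eq_succ_of_ne_zero (by omega)
  have hprod : ∏ i, x i = a ^ 2 * q * q ^ (p + 1) / (s * q ^ (p + 1) / (a * q ^ 2)) := by
    have := h.prod_eq
    have hs := h.s_ne
    field_simp
    linear_combination this
  have key := very_well_poised_identity ha hq hN hu hw h.x_ne hprod (by rwa [← e3])
    (by rwa [← e5]) d4 d5 d6 (h.sub_pow_ne _) d8 d9 d10
  rw [h.up_eq κ (show k + 1 ≤ p + 1 from hk), Nat.add_sub_cancel,
    h.down_eq κ k.succ_ne_zero (show k + 1 ≤ p + 1 from hk), stepMid, h.telescoper_succ hk,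
    telescoper]
  rw [e5, e4, e3, e1, e2]
  rw [e4] at d1
  have e6 : q ^ k - q ^ (p + 1) = (q ^ (k + 1) - q * q ^ (p + 1)) / q := by field_simp; ring
  have e7 : a * q * (s * q ^ (p + 1) / (a * q ^ 2)) * q ^ k =
    a * (s * q ^ (p + 1) / (a * q ^ 2)) * q ^ (k + 1) := by ring
  rw [e6, e7]
  generalize s * q ^ (p + 1) / (a * q ^ 2) = u at *
  generalize q ^ (p + 1) = N at *
  generalize q ^ (k + 1) = w at *
  generalize vwpTerm q a s x (p + 1) (k + 1) = T
  trans T * (κ / N / (1 - a * q * u * N)) * (q * (1 - a * q * u * N) * (N - u) / ((1 - a * w ^ 2) * w)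
        * (-(1 - a * w) * u * (∏ i, (1 - x i * w)) / ((1 - a * q * N * w) * (w - u))
          + (1 - w) * (q * N) * (∏ i, (1 - a * w / x i)) / ((w - q * N) * (1 - a * u * w))))
  · rw [← key]
    ring
  · clear key
    generalize (∏ i, (1 - x i * w)) = X
    generalize (∏ i, (1 - a * w / x i)) = Y
    generalize 1 - a * q * u * N = D1 at *
    simp only [div_eq_mul_inv, mul_inv]
    generalize (1 - a * w ^ 2)⁻¹ = I1
    generalize (1 - a * q * N * w)⁻¹ = I2
    generalize (w - u)⁻¹ = I3
    generalize (w - q * N)⁻¹ = I4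
    generalize (1 - a * u * w)⁻¹ = I5
    have c1 := mul_inv_cancel₀ d1
    have c2 := mul_inv_cancel₀ hu
    rw [inv_inv]
    linear_combination (T * κ * N⁻¹ * q * (N - u) * I1 * w⁻¹ * (-(1 - a * w) * u * X * I2 * I3
      + (1 - w) * q * N * Y * I4 * I5)) * c1
      - (κ * q * (N - u) * N⁻¹ * T * (1 - w) * N * Y * I1 * w⁻¹ * I4 * q * I5) * c2

theorem partial_sum_eq (h : StepRegular q a s x n) (κ : ℂ) {k : ℕ} (hk : k ≤ n) :
    ∑ j ∈ Finset.range (k + 1), (stepUp q κ a s n * vwpTerm q a s x (n + 1) j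
        - stepMid q κ a s x n * vwpTerm q a s x n j
        + stepDown q κ a s x n * vwpTerm q a s x (n - 1) j) =
      -(κ * q * (q ^ n - s * q ^ n / (a * q ^ 2)) * (s * q ^ n / (a * q ^ 2)) / q ^ n)
        * telescoper q a s x n k := by
  induction k with
  | zero => rw [zero_add, Finset.sum_range_one, h.start_eq]
  | succ k ih =>
    rw [Finset.sum_range_succ, ih (by omega), h.step_eq κ (by omega)]
    ring

/-- The three term recurrence of the terminating very well poised series. -/
theorem recurrence (h : StepRegular q a s x n) (κ : ℂ) :
    stepUp q κ a s n * vwpSum q a s x (n + 1) - stepMid q κ a s x n * vwpSum q a s x n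
      + stepDown q κ a s x n * vwpSum q a s x (n - 1) = 0 := by
  have hq := h.q_ne
  have ha := h.a_ne
  have hlast : stepUp q κ a s n * vwpTerm q a s x (n + 1) (n + 1) =
      κ * q * (q ^ n - s * q ^ n / (a * q ^ 2)) * (s * q ^ n / (a * q ^ 2)) / q ^ n *
        telescoper q a s x n n := by
    refine vwpTerm_last hq ha ?_ (h.one_sub_ne _) ?_ ?_ ?_ ?_ ?_ (h.one_sub_ne _) (h.sub_pow_ne n)
    · simpa using h.low_ne' 0
    · have := h.pow_sub_pow_ne (Nat.succ_pos n)
      rwa [pow_zero, Nat.succ_eq_add_one, pow_succ'] at this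
    · intro h0
      refine h.s_pow_ne n 1 ?_
      field_simp at h0
      linear_combination -h0
    · have := h.low_ne' n
      convert this using 2
      ring
    · have := h.low_ne' (n + 1)
      convert this using 2
      field_simp
      ring
    · rw [← pow_mul]; exact h.one_sub_ne _
  have hdown : stepDown q κ a s x n * vwpSum q a s x (n - 1) =
      ∑ j ∈ Finset.range (n + 1), stepDown q κ a s x n * vwpTerm q a s x (n - 1) j := by
    rw [← Finset.mul_sum, vwpSum]
    cases n with
    | zero => simp [stepDown]
    | succ p =>
      rw [Nat.add_sub_cancel, Finset.sum_range_succ _ (p + 1)]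
      have : vwpTerm q a s x p (p + 1) = 0 := by
        simp [vwpTerm, qSub_pow_of_lt q (Nat.lt_succ_self p)]
      rw [this, add_zero]
  have hps := h.partial_sum_eq κ le_rfl
  rw [Finset.sum_add_distrib, Finset.sum_sub_distrib, ← Finset.mul_sum, ← Finset.mul_sum,
    ← hdown] at hps
  rw [vwpSum, Finset.sum_range_succ, mul_add, hlast, vwpSum]
  linear_combination hps

end StepRegular

/-! ### Bounds and limits of shifted factorials -/

theorem summable_norm_mul_pow {q : ℂ} (hq1 : ‖q‖ < 1) (y : ℂ) :
    Summable fun j : ℕ => ‖-(y * q ^ j)‖ := by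
  have h1 : Summable fun n : ℕ => ‖y‖ * ‖q‖ ^ n :=
    (summable_geometric_of_lt_one (norm_nonneg q) hq1).mul_left _
  refine h1.congr fun n => ?_
  rw [norm_neg, norm_mul, norm_pow]

theorem qFac_tendsto {q : ℂ} (hq1 : ‖q‖ < 1) (y : ℂ) :
    Tendsto (qFac q y) atTop (𝓝 (qInf q y)) := by
  have h : Multipliable fun j : ℕ => 1 - y * q ^ j := by
    simpa [sub_eq_add_neg] using multipliable_one_add_of_summable (summable_norm_mul_pow hq1 y)
  exact h.tendsto_prod_tprod_nat

theorem qInf_ne_zero {q y : ℂ} (hq1 : ‖q‖ < 1) (h : ∀ j : ℕ, y * q ^ j ≠ 1) : qInf q y ≠ 0 := by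
  have := tprod_one_add_ne_zero_of_summable (f := fun j : ℕ => -(y * q ^ j))
    (fun j => by rw [← sub_eq_add_neg]; exact sub_ne_zero.2 (h j).symm)
    (summable_norm_mul_pow hq1 y)
  simpa [qInf, sub_eq_add_neg] using this

theorem norm_qFac_le {q : ℂ} (hq1 : ‖q‖ < 1) {y : ℂ} {B : ℝ} (hy : ‖y‖ ≤ B) (k : ℕ) :
    ‖qFac q y k‖ ≤ Real.exp (B * (1 - ‖q‖)⁻¹) := by
  have hB : 0 ≤ B := (norm_nonneg y).trans hy
  rw [qFac, norm_prod]
  calc ∏ j ∈ Finset.range k, ‖1 - y * q ^ j‖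
      ≤ ∏ j ∈ Finset.range k, (1 + B * ‖q‖ ^ j) := by
        refine Finset.prod_le_prod (fun _ _ => norm_nonneg _) fun j _ => ?_
        refine (norm_sub_le _ _).trans ?_
        rw [norm_one, norm_mul, norm_pow]
        gcongr
    _ ≤ Real.exp (∑ j ∈ Finset.range k, B * ‖q‖ ^ j) :=
        Real.prod_one_add_le_exp_sum _ fun j => by positivity
    _ ≤ Real.exp (B * (1 - ‖q‖)⁻¹) := by
        rw [← Finset.mul_sum, ← tsum_geometric_of_lt_one (norm_nonneg q) hq1]
        gcongr
        exact (summable_geometric_of_lt_one (norm_nonneg q) hq1).sum_le_tsum _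
          fun j _ => by positivity

theorem exists_norm_inv_qFac_le {q y : ℂ} (hq1 : ‖q‖ < 1) (h : ∀ j : ℕ, y * q ^ j ≠ 1) :
    ∃ C : ℝ, ∀ k, ‖(qFac q y k)⁻¹‖ ≤ C := by
  have ht := ((qFac_tendsto hq1 y).inv₀ (qInf_ne_zero hq1 h)).norm
  obtain ⟨C, hC⟩ := ht.bddAbove_range
  exact ⟨C, fun k => hC ⟨k, rfl⟩⟩

/-! ### Sequences that are smooth in `q^k` -/

/-- The `q`-difference `k ↦ (c_k - c_{k-1}) / q^k`, with `c_{-1} = 0`. -/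
noncomputable def qDiff (q : ℂ) (c : ℕ → ℂ) : ℕ → ℂ
  | 0 => c 0
  | k + 1 => (c (k + 1) - c k) / q ^ (k + 1)

/-- The shift `k ↦ c_{k-1}`, with `c_{-1} = 0`. -/
def shiftRight (c : ℕ → ℂ) : ℕ → ℂ
  | 0 => 0
  | k + 1 => c k

/-- The triangular array `c n k`, `k ≤ n`, is bounded together with its `q`-differences in `k` up
to order `J`. Entries with `k > n` are irrelevant. An array `H_n(q^k)`, with `H_n` a bounded family
of functions analytic near the closed disc that contains all `q^k`, has this property. -/
def QSmooth (q : ℂ) : ℕ → (ℕ → ℕ → ℂ) → Prop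
  | 0, c => ∃ C : ℝ, ∀ n, ∀ k ≤ n, ‖c n k‖ ≤ C
  | J + 1, c => (∃ C : ℝ, ∀ n, ∀ k ≤ n, ‖c n k‖ ≤ C) ∧ QSmooth q J fun n => qDiff q (c n)

namespace QSmooth

variable {q : ℂ} {J : ℕ} {c d : ℕ → ℕ → ℂ}

theorem bounded (h : QSmooth q J c) : ∃ C : ℝ, ∀ n, ∀ k ≤ n, ‖c n k‖ ≤ C := by
  cases J with
  | zero => exact h
  | succ J => exact h.1

theorem of_succ (h : QSmooth q (J + 1) c) : QSmooth q J c := by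
  induction J generalizing c with
  | zero => exact h.1
  | succ J ih => exact ⟨h.1, ih h.2⟩

theorem congr (h : QSmooth q J c) (hcd : ∀ n, ∀ k ≤ n, c n k = d n k) : QSmooth q J d := by
  induction J generalizing c d with
  | zero =>
    obtain ⟨C, hC⟩ := h
    exact ⟨C, fun n k hk => hcd n k hk ▸ hC n k hk⟩
  | succ J ih =>
    obtain ⟨⟨C, hC⟩, h2⟩ := h
    refine ⟨⟨C, fun n k hk => hcd n k hk ▸ hC n k hk⟩, ih h2 fun n k hk => ?_⟩
    cases k with
    | zero => exact hcd n 0 hk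
    | succ k => simp only [qDiff, hcd n (k + 1) hk, hcd n k (by omega)]

theorem add (hc : QSmooth q J c) (hd : QSmooth q J d) : QSmooth q J fun n k => c n k + d n k := by
  induction J generalizing c d with
  | zero =>
    obtain ⟨C, hC⟩ := hc
    obtain ⟨D, hD⟩ := hd
    exact ⟨C + D, fun n k hk => (norm_add_le _ _).trans (add_le_add (hC n k hk) (hD n k hk))⟩
  | succ J ih =>
    obtain ⟨⟨C, hC⟩, h2⟩ := hc
    obtain ⟨⟨D, hD⟩, h3⟩ := hd
    refine ⟨⟨C + D, fun n k hk => (norm_add_le _ _).trans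
      (add_le_add (hC n k hk) (hD n k hk))⟩, (ih h2 h3).congr fun n k _ => ?_⟩
    cases k with
    | zero => rfl
    | succ k => simp only [qDiff]; ring

theorem const_mul {g : ℕ → ℂ} {B : ℝ} (hg : ∀ n, ‖g n‖ ≤ B) (hc : QSmooth q J c) :
    QSmooth q J fun n k => g n * c n k := by
  have key : ∀ c : ℕ → ℕ → ℂ, (∃ C : ℝ, ∀ n, ∀ k ≤ n, ‖c n k‖ ≤ C) →
      ∃ C : ℝ, ∀ n, ∀ k ≤ n, ‖g n * c n k‖ ≤ C := by
    rintro c ⟨C, hC⟩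
    refine ⟨B * C, fun n k hk => ?_⟩
    rw [norm_mul]
    exact mul_le_mul (hg n) (hC n k hk) (norm_nonneg _) ((norm_nonneg _).trans (hg n))
  induction J generalizing c with
  | zero => exact key c hc
  | succ J ih =>
    refine ⟨key c hc.1, (ih hc.2).congr fun n k _ => ?_⟩
    cases k with
    | zero => rfl
    | succ k => simp only [qDiff]; ring

theorem shift (hc : QSmooth q J c) : QSmooth q J fun n => shiftRight (c n) := by
  have key : ∀ c : ℕ → ℕ → ℂ, (∃ C : ℝ, ∀ n, ∀ k ≤ n, ‖c n k‖ ≤ C) →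
      ∃ C : ℝ, ∀ n, ∀ k ≤ n, ‖shiftRight (c n) k‖ ≤ C := by
    rintro c ⟨C, hC⟩
    refine ⟨C, fun n k hk => ?_⟩
    cases k with
    | zero => rw [shiftRight, norm_zero]; exact (norm_nonneg _).trans (hC 0 0 le_rfl)
    | succ k => exact hC n k (by omega)
  induction J generalizing c with
  | zero => exact key c hc
  | succ J ih =>
    refine ⟨key c hc.1, ((ih hc.2).const_mul (g := fun _ => q⁻¹) fun _ => le_rfl).congr
      fun n k _ => ?_⟩
    match k with
    | 0 => simp [qDiff, shiftRight]
    | 1 => simp [qDiff, shiftRight]; ring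
    | k + 2 => simp only [qDiff, shiftRight]; ring

/-- The `q`-difference satisfies a Leibniz rule, so smooth arrays are closed under products. -/
theorem mul (hc : QSmooth q J c) (hd : QSmooth q J d) :
    QSmooth q J fun n k => c n k * d n k := by
  have key : ∀ c d : ℕ → ℕ → ℂ, (∃ C : ℝ, ∀ n, ∀ k ≤ n, ‖c n k‖ ≤ C) →
      (∃ C : ℝ, ∀ n, ∀ k ≤ n, ‖d n k‖ ≤ C) → ∃ C : ℝ, ∀ n, ∀ k ≤ n, ‖c n k * d n k‖ ≤ C := by
    rintro c d ⟨C, hC⟩ ⟨D, hD⟩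
    refine ⟨C * D, fun n k hk => ?_⟩
    rw [norm_mul]
    exact mul_le_mul (hC n k hk) (hD n k hk) (norm_nonneg _) ((norm_nonneg _).trans (hC n k hk))
  induction J generalizing c d with
  | zero => exact key c d hc hd
  | succ J ih =>
    refine ⟨key c d hc.1 hd.1, ((ih hc.2 hd.of_succ).add (ih hc.of_succ.shift hd.2)).congr
      fun n k _ => ?_⟩
    cases k with
    | zero => simp [qDiff, shiftRight]
    | succ k => simp only [qDiff, shiftRight]; ring

theorem of_finite_support (hq : q ≠ 0) (hq1 : ‖q‖ < 1) (K : ℕ) {C : ℝ}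
    (hC : ∀ n, ∀ k ≤ n, ‖c n k‖ ≤ C) (h0 : ∀ n, ∀ k ≤ n, K ≤ k → c n k = 0) : QSmooth q J c := by
  induction J generalizing c K C with
  | zero => exact ⟨C, hC⟩
  | succ J ih =>
    have hC0 : 0 ≤ C := (norm_nonneg _).trans (hC 0 0 le_rfl)
    have hqK : 1 ≤ (‖q‖ ^ (K + 1))⁻¹ :=
      (one_le_inv₀ (by positivity)).2 (pow_le_one₀ (norm_nonneg q) hq1.le)
    refine ⟨⟨C, hC⟩, ih (K + 1) (C := 2 * C * (‖q‖ ^ (K + 1))⁻¹) ?_ ?_⟩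
    · intro n k hk
      cases k with
      | zero =>
        refine (hC n 0 hk).trans ?_
        nlinarith
      | succ k =>
        rcases lt_or_ge K (k + 1) with h | h
        · rw [qDiff, h0 n _ hk h.le, h0 n k (by omega) (by omega)]
          simp only [sub_self, zero_div, norm_zero]
          positivity
        · rw [qDiff, norm_div, div_eq_mul_inv, norm_pow]
          have h1 : ‖c n (k + 1) - c n k‖ ≤ 2 * C := by
            refine (norm_sub_le _ _).trans ?_
            linarith [hC n _ hk, hC n k (by omega)]
          have h2 : (‖q‖ ^ (k + 1))⁻¹ ≤ (‖q‖ ^ (K + 1))⁻¹ :=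
            inv_anti₀ (by positivity) (pow_le_pow_of_le_one (norm_nonneg q) hq1.le (by omega))
          exact mul_le_mul h1 h2 (by positivity) (by positivity)
    · intro n k hk hKk
      obtain ⟨k, rfl⟩ : ∃ l, k = l + 1 := Nat.exists_eq_succ_of_ne_zero (by omega)
      rw [qDiff, h0 n _ hk (by omega), h0 n k (by omega) (by omega)]
      simp

/-- The value of the `q`-difference at `k = 0`, where the convention `c_{-1} = 0` interferes, does
not matter for smoothness. -/
theorem of_qDiff (hq : q ≠ 0) (hq1 : ‖q‖ < 1) {C : ℝ} (hC : ∀ n, ∀ k ≤ n, ‖c n k‖ ≤ C)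
    (hd : QSmooth q J d) (h : ∀ n k, k + 1 ≤ n → (c n (k + 1) - c n k) = q ^ (k + 1) * d n (k + 1)) :
    QSmooth q (J + 1) c := by
  obtain ⟨D, hD⟩ := hd.bounded
  have hfin : QSmooth q J fun n k => if k = 0 then c n 0 - d n 0 else 0 := by
    refine of_finite_support hq hq1 1 (C := C + D) (fun n k hk => ?_) fun n k _ hk => ?_
    · split_ifs
      · exact (norm_sub_le _ _).trans (add_le_add (hC n 0 (Nat.zero_le n)) (hD n 0 (Nat.zero_le n)))
      · rw [norm_zero]
        exact add_nonneg ((norm_nonneg _).trans (hC 0 0 le_rfl))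
          ((norm_nonneg _).trans (hD 0 0 le_rfl))
    · rw [if_neg (by omega)]
  refine ⟨⟨C, hC⟩, (hd.add hfin).congr fun n k hk => ?_⟩
  cases k with
  | zero => simp [qDiff]
  | succ k =>
    rw [qDiff, h n k hk, mul_div_cancel_left₀ _ (pow_ne_zero _ hq), if_neg k.succ_ne_zero, add_zero]

theorem const (hq : q ≠ 0) (hq1 : ‖q‖ < 1) {g : ℕ → ℂ} {B : ℝ} (hg : ∀ n, ‖g n‖ ≤ B) :
    QSmooth q J fun n _ => g n := by
  cases J with
  | zero => exact ⟨B, fun n _ _ => hg n⟩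
  | succ J =>
    refine of_qDiff hq hq1 (fun n _ _ => hg n) (d := fun _ _ => 0)
      (of_finite_support hq hq1 0 (C := 0) (by simp) (by simp)) (by simp)

theorem pow (hq : q ≠ 0) (hq1 : ‖q‖ < 1) : QSmooth q J fun _ k => q ^ k := by
  have hb : ∀ n : ℕ, ∀ k ≤ n, ‖q ^ k‖ ≤ 1 := fun n k _ => by
    rw [norm_pow]; exact pow_le_one₀ (norm_nonneg q) hq1.le
  cases J with
  | zero => exact ⟨1, hb⟩
  | succ J =>
    refine of_qDiff hq hq1 hb (d := fun _ _ => 1 - q⁻¹)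
      (const hq hq1 (B := ‖1 - q⁻¹‖) fun _ => le_rfl) fun n k _ => ?_
    field_simp
    ring

theorem qFac (hq : q ≠ 0) (hq1 : ‖q‖ < 1) {y : ℕ → ℂ} {B : ℝ} (hy : ∀ n, ‖y n‖ ≤ B) :
    QSmooth q J fun n k => qFac q (y n) k := by
  have hb : ∀ n : ℕ, ∀ k ≤ n, ‖_root_.qFac q (y n) k‖ ≤ _ := fun n k _ =>
    norm_qFac_le hq1 (hy n) k
  induction J with
  | zero => exact ⟨_, hb⟩
  | succ J ih =>
    refine of_qDiff hq hq1 hb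
      (ih.shift.const_mul (g := fun n => -(y n * q⁻¹)) (B := B * ‖q‖⁻¹) fun n => ?_)
      fun n k _ => ?_
    · rw [norm_neg, norm_mul, norm_inv]
      exact mul_le_mul_of_nonneg_right (hy n) (by positivity)
    · rw [qFac_succ, shiftRight, pow_succ]
      field_simp
      ring

theorem inv_qFac (hq : q ≠ 0) (hq1 : ‖q‖ < 1) {y : ℕ → ℂ} {B C : ℝ} (hy : ∀ n, ‖y n‖ ≤ B)
    (hC : ∀ n k, ‖(_root_.qFac q (y n) k)⁻¹‖ ≤ C) (h1 : ∀ n k : ℕ, y n * q ^ k ≠ 1) :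
    QSmooth q J fun n k => (_root_.qFac q (y n) k)⁻¹ := by
  have hb : ∀ n : ℕ, ∀ k ≤ n, ‖(_root_.qFac q (y n) k)⁻¹‖ ≤ _ := fun n k _ => hC n k
  induction J with
  | zero => exact ⟨_, hb⟩
  | succ J ih =>
    refine of_qDiff hq hq1 hb
      (ih.const_mul (g := fun n => y n * q⁻¹) (B := B * ‖q‖⁻¹) fun n => ?_)
      fun n k _ => ?_
    · rw [norm_mul, norm_inv]
      exact mul_le_mul_of_nonneg_right (hy n) (by positivity)
    · have h2 : 1 - y n * q ^ k ≠ 0 := sub_ne_zero.2 (h1 n k).symm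
      have h3 : _root_.qFac q (y n) k ≠ 0 := qFac_ne_zero fun j _ => h1 n j
      rw [qFac_succ, pow_succ]
      field_simp
      ring

theorem qFac_sub (hq : q ≠ 0) (hq1 : ‖q‖ < 1) (v : ℂ) :
    QSmooth q J fun n k => _root_.qFac q (v * q ^ (k + 1)) (n - k) := by
  have hb : ∀ n : ℕ, ∀ k ≤ n, ‖_root_.qFac q (v * q ^ (k + 1)) (n - k)‖ ≤ _ := fun n k _ =>
    norm_qFac_le hq1 (B := ‖v‖) (by
      rw [norm_mul, norm_pow]
      exact mul_le_of_le_one_right (norm_nonneg v) (pow_le_one₀ (norm_nonneg q) hq1.le)) _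
  induction J with
  | zero => exact ⟨_, hb⟩
  | succ J ih =>
    refine of_qDiff hq hq1 hb (ih.const_mul (g := fun _ => v) fun n => le_rfl) fun n k hk => ?_
    rw [show n - k = n - (k + 1) + 1 by omega, qFac_succ', pow_succ q (k + 1), ← mul_assoc]
    ring

end QSmooth

/-! ### Abel summation and the limit of terminating sums -/

/-- The truncation `q^k (q^{-n}; q)_k / (q^{1-n}/z; q)_k` of `z^k`, written with `qSub`: it vanishes
for `k > n` and tends to `z^k` as `n → ∞`. -/
noncomputable def truncPow (q z : ℂ) (n k : ℕ) : ℂ :=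
  z ^ k * (qSub q (q ^ n) k / qSub q (z * q ^ n / q) k)

/-- The truncated power series with coefficients `c`. -/
noncomputable def truncSum (q z : ℂ) (c : ℕ → ℂ) (n : ℕ) : ℂ :=
  ∑ k ∈ Finset.range (n + 1), c k * truncPow q z n k

theorem sub_mul_pow_ne_zero {q z : ℂ} (hq : q ≠ 0) (hz : ∀ j : ℕ, z * q ^ j ≠ 1) {n k : ℕ}
    (hk : k ≤ n) : q ^ k - z * q ^ n ≠ 0 := by
  obtain ⟨l, rfl⟩ := Nat.exists_eq_add_of_le hk
  have : q ^ k - z * q ^ (k + l) = q ^ k * (1 - z * q ^ l) := by ring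
  rw [this]
  exact mul_ne_zero (pow_ne_zero _ hq) (sub_ne_zero.2 (hz l).symm)

theorem truncPow_eq_sub {q z : ℂ} (hq : q ≠ 0) (hz : ∀ j : ℕ, z * q ^ j ≠ 1) {n k : ℕ}
    (hk : k ≤ n) :
    (1 - z) * truncPow q z n k = (1 - z * q ^ n) *
      (z ^ k * (qSub q (q ^ n) k / qSub q (z * q ^ n) k)
        - z ^ (k + 1) * (qSub q (q ^ n) (k + 1) / qSub q (z * q ^ n) (k + 1))) := by
  have h1 := sub_mul_pow_ne_zero hq hz hk
  have h2 : 1 - z * q ^ n ≠ 0 := sub_ne_zero.2 (hz n).symm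
  have h3 : z * q ^ n / q * q = z * q ^ n := by field_simp
  have h4 := inv_qSub_mul_left (q := q) (y := z * q ^ n / q) (k := k) (by rwa [h3])
  rw [h3] at h4
  have hw : q ^ k ≠ 0 := pow_ne_zero _ hq
  rw [truncPow, qSub_succ, qSub_succ, div_eq_mul_inv (qSub q (q ^ n) k) (qSub q (z * q ^ n) k),
    mul_div_mul_comm, div_eq_mul_inv (qSub q (q ^ n) k) (qSub q (z * q ^ n) k), h4,
    div_eq_mul_inv _ (qSub q (z * q ^ n / q) k)]
  generalize qSub q (q ^ n) k = R1
  generalize (qSub q (z * q ^ n / q) k)⁻¹ = R2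
  rw [pow_succ]
  generalize z ^ k = Z
  have e : q ^ k - q ^ n = (q ^ k - z * q ^ n) + (z - 1) * q ^ n := by ring
  rw [e]
  have e2 : 1 - z = ((q ^ k - z * q ^ n) - z * ((q ^ k - z * q ^ n) + (z - 1) * q ^ n)) / q ^ k := by
    rw [eq_div_iff hw]; ring
  generalize hD : q ^ k - z * q ^ n = D at *
  rw [e2]
  generalize 1 - z * q ^ n = D2 at *
  field_simp

theorem sum_range_sub_shiftRight_mul (c v : ℕ → ℂ) (n : ℕ) :
    ∑ k ∈ Finset.range (n + 1), (c k - shiftRight c k) * v k =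
      ∑ k ∈ Finset.range (n + 1), c k * (v k - v (k + 1)) + c n * v (n + 1) := by
  induction n with
  | zero => simp [shiftRight]; ring
  | succ n ih =>
    rw [Finset.sum_range_succ, ih, Finset.sum_range_succ _ (n + 1), shiftRight]
    ring

theorem qDiff_mul_pow {q : ℂ} (hq : q ≠ 0) (c : ℕ → ℂ) (k : ℕ) :
    qDiff q c k * q ^ k = c k - shiftRight c k := by
  cases k with
  | zero => simp [qDiff, shiftRight]
  | succ k => rw [qDiff, shiftRight, div_mul_cancel₀ _ (pow_ne_zero _ hq)]

/-- Abel summation: the truncated series at `z` is, up to an explicit factor, the truncated series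
of the `q`-difference at `zq`. -/
theorem truncSum_qDiff {q z : ℂ} (hq : q ≠ 0) (hz : ∀ j : ℕ, z * q ^ j ≠ 1) (c : ℕ → ℂ) (n : ℕ) :
    truncSum q z c n = (1 - z * q ^ n) / (1 - z) * truncSum q (z * q) (qDiff q c) n := by
  have h1 : 1 - z ≠ 0 := by simpa using sub_ne_zero.2 (hz 0).symm
  have h := sum_range_sub_shiftRight_mul c
    (fun k => z ^ k * (qSub q (q ^ n) k / qSub q (z * q ^ n) k)) n
  rw [qSub_pow_of_lt q n.lt_succ_self, zero_div, mul_zero, mul_zero, add_zero] at h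
  have h2 : truncSum q (z * q) (qDiff q c) n = ∑ k ∈ Finset.range (n + 1),
      (c k - shiftRight c k) * (z ^ k * (qSub q (q ^ n) k / qSub q (z * q ^ n) k)) := by
    refine Finset.sum_congr rfl fun k _ => ?_
    rw [← qDiff_mul_pow hq, truncPow, mul_pow,
      show z * q * q ^ n / q = z * q ^ n by field_simp]
    ring
  rw [h2, h, truncSum, div_mul_eq_mul_div, eq_div_iff h1, Finset.sum_mul, Finset.mul_sum]
  refine Finset.sum_congr rfl fun k hk => ?_
  have := truncPow_eq_sub hq hz (Nat.lt_succ_iff.1 (Finset.mem_range.1 hk))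
  linear_combination c k * this

theorem truncSum_iterate_qDiff {q z : ℂ} (hq : q ≠ 0) (hz : ∀ j : ℕ, z * q ^ j ≠ 1) (c : ℕ → ℂ)
    (n J : ℕ) :
    truncSum q z c n = qFac q (z * q ^ n) J / qFac q z J
      * truncSum q (z * q ^ J) ((qDiff q)^[J] c) n := by
  induction J with
  | zero => simp [qFac_zero]
  | succ J ih =>
    have hz' : ∀ j : ℕ, z * q ^ J * q ^ j ≠ 1 := fun j => by
      rw [mul_assoc, ← pow_add]; exact hz _
    rw [ih, truncSum_qDiff hq hz', Function.iterate_succ_apply', qFac_succ, qFac_succ, pow_succ q J,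
      show z * q ^ n * q ^ J = z * q ^ J * q ^ n by ring, ← mul_assoc z, mul_div_mul_comm]
    ring

theorem truncPow_eq {q z : ℂ} (hq : q ≠ 0) (hq1 : ‖q‖ < 1) (hz : ∀ j : ℕ, z * q ^ j ≠ 1) {n k : ℕ}
    (hk : k ≤ n) :
    truncPow q z n k = z ^ k * (qFac q q n * (qFac q q (n - k))⁻¹
      * (qFac q z (n - k) * (qFac q z n)⁻¹)) := by
  rw [truncPow]
  congr 1
  have hQ : ∀ j : ℕ, 1 - q * q ^ j ≠ 0 := fun j => by
    rw [← pow_succ']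
    exact sub_ne_zero.2 (pow_ne_one_of_norm_lt_one hq1 j.succ_ne_zero).symm
  have hQ' : ∀ j : ℕ, qFac q q j ≠ 0 := fun j =>
    qFac_ne_zero fun i _ => (sub_ne_zero.1 (hQ i)).symm
  have hZ' : ∀ j : ℕ, qFac q z j ≠ 0 := fun j => qFac_ne_zero fun i _ => hz i
  induction k with
  | zero => simp [qSub, hQ', hZ']
  | succ k ih =>
    obtain ⟨l, rfl⟩ := Nat.exists_eq_add_of_le hk
    have e1 : k + 1 + l - k = l + 1 := by omega
    have e2 : k + 1 + l - (k + 1) = l := by omega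
    rw [qSub_succ, qSub_succ, mul_div_mul_comm, ih (by omega), e1, e2, qFac_succ q q l,
      qFac_succ q z l]
    have h1 := hQ l
    have h2 : 1 - z * q ^ l ≠ 0 := sub_ne_zero.2 (hz l).symm
    have e3 : q ^ k - q ^ (k + 1 + l) = q ^ k * (1 - q * q ^ l) := by ring
    have e4 : q ^ k - z * q ^ (k + 1 + l) / q = q ^ k * (1 - z * q ^ l) := by field_simp; ring
    have h3 := hQ' l
    rw [e3, e4, mul_div_mul_left _ _ (pow_ne_zero _ hq), mul_inv]
    generalize 1 - z * q ^ l = D at *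
    generalize 1 - q * q ^ l = D' at *
    field_simp

theorem exists_norm_truncPow_le {q z : ℂ} (hq : q ≠ 0) (hq1 : ‖q‖ < 1)
    (hz : ∀ j : ℕ, z * q ^ j ≠ 1) :
    ∃ C : ℝ, 0 ≤ C ∧ ∀ n, ∀ k ≤ n, ‖truncPow q z n k‖ ≤ ‖z‖ ^ k * C := by
  have hQ : ∀ j : ℕ, q * q ^ j ≠ 1 := fun j => by
    rw [← pow_succ']
    exact pow_ne_one_of_norm_lt_one hq1 j.succ_ne_zero
  obtain ⟨C1, h1⟩ := exists_norm_inv_qFac_le hq1 hQ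
  obtain ⟨C2, h2⟩ := exists_norm_inv_qFac_le hq1 hz
  have h3 := norm_qFac_le hq1 (le_refl ‖q‖)
  have h4 := norm_qFac_le hq1 (le_refl ‖z‖)
  have n1 : 0 ≤ C1 := (norm_nonneg _).trans (h1 0)
  have n2 : 0 ≤ C2 := (norm_nonneg _).trans (h2 0)
  refine ⟨Real.exp (‖q‖ * (1 - ‖q‖)⁻¹) * C1 * (Real.exp (‖z‖ * (1 - ‖q‖)⁻¹) * C2), by positivity,
    fun n k hk => ?_⟩
  rw [truncPow_eq hq hq1 hz hk, norm_mul, norm_pow, norm_mul, norm_mul (qFac q q n),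
    norm_mul (qFac q z (n - k))]
  gcongr
  · exact h3 _
  · exact h1 _
  · exact h4 _
  · exact h2 _

theorem tendsto_truncPow {q z : ℂ} (hq : q ≠ 0) (hq1 : ‖q‖ < 1) (k : ℕ) :
    Tendsto (fun n => truncPow q z n k) atTop (𝓝 (z ^ k)) := by
  have hp : Tendsto (fun n : ℕ => q ^ n) atTop (𝓝 0) := tendsto_pow_atTop_nhds_zero_of_norm_lt_one hq1
  have hs : ∀ y : ℕ → ℂ, Tendsto y atTop (𝓝 0) →
      Tendsto (fun n => qSub q (y n) k) atTop (𝓝 (qSub q 0 k)) := fun y hy =>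
    tendsto_finsetProd _ fun j _ => tendsto_const_nhds.sub hy
  have h0 : qSub q 0 k ≠ 0 := qSub_ne_zero fun j _ => (pow_ne_zero j hq).symm
  have h2 : Tendsto (fun n : ℕ => z * q ^ n / q) atTop (𝓝 0) := by
    simpa using (hp.const_mul z).div_const q
  have := ((hs _ hp).div (hs _ h2) h0).const_mul (z ^ k)
  rwa [div_self h0, mul_one] at this

theorem tendsto_truncSum_of_norm_lt_one {q z : ℂ} (hq : q ≠ 0) (hq1 : ‖q‖ < 1) (hz1 : ‖z‖ < 1)
    (hz : ∀ j : ℕ, z * q ^ j ≠ 1) {c : ℕ → ℕ → ℂ} {u : ℕ → ℂ} {C : ℝ}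
    (hc : ∀ n, ∀ k ≤ n, ‖c n k‖ ≤ C) (hu : ∀ k, Tendsto (fun n => c n k) atTop (𝓝 (u k))) :
    Tendsto (fun n => truncSum q z (c n) n) atTop (𝓝 (∑' k, u k * z ^ k)) := by
  obtain ⟨B, hB0, hB⟩ := exists_norm_truncPow_le hq hq1 hz
  have hC : 0 ≤ C := (norm_nonneg _).trans (hc 0 0 le_rfl)
  have e : ∀ n, truncSum q z (c n) n = ∑' k, c n k * truncPow q z n k := fun n => by
    rw [truncSum, tsum_eq_sum]
    intro k hk
    rw [truncPow, qSub_pow_of_lt q (by simpa using hk)]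
    simp
  simp only [e]
  refine tendsto_tsum_of_dominated_convergence (bound := fun k => C * (‖z‖ ^ k * B))
    (((summable_geometric_of_lt_one (norm_nonneg z) hz1).mul_right B).mul_left C)
    (fun k => (hu k).mul (tendsto_truncPow hq hq1 k)) (Eventually.of_forall fun n k => ?_)
  rcases Nat.lt_or_ge n k with h | h
  · rw [truncPow, qSub_pow_of_lt q h]
    simp only [zero_div, mul_zero, norm_zero]
    positivity
  · rw [norm_mul]
    exact mul_le_mul (hc n k h) (hB n k h) (norm_nonneg _) hC

theorem tendsto_qDiff {q : ℂ} {c : ℕ → ℕ → ℂ} {u : ℕ → ℂ}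
    (hu : ∀ k, Tendsto (fun n => c n k) atTop (𝓝 (u k))) (k : ℕ) :
    Tendsto (fun n => qDiff q (c n) k) atTop (𝓝 (qDiff q u k)) := by
  cases k with
  | zero => exact hu 0
  | succ k => exact ((hu (k + 1)).sub (hu k)).div_const _

theorem tendsto_iterate_qDiff {q : ℂ} {c : ℕ → ℕ → ℂ} {u : ℕ → ℂ}
    (hu : ∀ k, Tendsto (fun n => c n k) atTop (𝓝 (u k))) (J k : ℕ) :
    Tendsto (fun n => (qDiff q)^[J] (c n) k) atTop (𝓝 ((qDiff q)^[J] u k)) := by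
  induction J generalizing k with
  | zero => exact hu k
  | succ J ih =>
    simp only [Function.iterate_succ_apply']
    exact tendsto_qDiff ih k

theorem QSmooth.iterate {q : ℂ} {J : ℕ} {c : ℕ → ℕ → ℂ} (h : QSmooth q J c) :
    ∃ C : ℝ, ∀ n, ∀ k ≤ n, ‖(qDiff q)^[J] (c n) k‖ ≤ C := by
  induction J generalizing c with
  | zero => exact h
  | succ J ih => exact ih h.2

theorem QSmooth.exists_norm_iterate_le {q : ℂ} {J : ℕ} {c : ℕ → ℕ → ℂ} {u : ℕ → ℂ}
    (h : QSmooth q J c) (hu : ∀ k, Tendsto (fun n => c n k) atTop (𝓝 (u k))) :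
    ∃ C : ℝ, ∀ k, ‖(qDiff q)^[J] u k‖ ≤ C := by
  obtain ⟨C, hC⟩ := h.iterate
  refine ⟨C, fun k => le_of_tendsto (tendsto_iterate_qDiff hu J k).norm ?_⟩
  filter_upwards [eventually_ge_atTop k] with n hn using hC n k hn

/-! ### The analytic continuation -/

/-- The power series `∑ u_k z^k` after `J` Abel summations; it converges for `|z q^J| < 1`. -/
noncomputable def abelSum (q : ℂ) (u : ℕ → ℂ) (J : ℕ) (z : ℂ) : ℂ :=
  (qFac q z J)⁻¹ * ∑' k, (qDiff q)^[J] u k * (z * q ^ J) ^ k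

theorem summable_mul_pow_of_bounded {v : ℕ → ℂ} {C : ℝ} (hv : ∀ k, ‖v k‖ ≤ C) {y : ℂ}
    (hy : ‖y‖ < 1) : Summable fun k => v k * y ^ k := by
  refine Summable.of_norm_bounded ((summable_geometric_of_lt_one (norm_nonneg y) hy).mul_left C)
    fun k => ?_
  rw [norm_mul, norm_pow]
  exact mul_le_mul_of_nonneg_right (hv k) (by positivity)

theorem one_sub_mul_tsum {q : ℂ} (hq : q ≠ 0) {v : ℕ → ℂ} {C : ℝ} (hv : ∀ k, ‖v k‖ ≤ C) {y : ℂ}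
    (hy : ‖y‖ < 1) :
    (1 - y) * ∑' k, v k * y ^ k = ∑' k, qDiff q v k * (y * q) ^ k := by
  have hs := summable_mul_pow_of_bounded hv hy
  have hs' : Summable fun k => v k * y ^ (k + 1) := by
    simpa only [pow_succ, mul_assoc] using hs.mul_right y
  have e : ∀ k, qDiff q v (k + 1) * (y * q) ^ (k + 1) = v (k + 1) * y ^ (k + 1) - v k * y ^ (k + 1) :=
    fun k => by
      have := qDiff_mul_pow hq v (k + 1)
      rw [shiftRight] at this
      rw [mul_pow]
      linear_combination y ^ (k + 1) * this
  have hs1 : Summable fun k => v (k + 1) * y ^ (k + 1) := (summable_nat_add_iff 1).2 hs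
  have hs2 : Summable fun k => qDiff q v k * (y * q) ^ k := by
    rw [← summable_nat_add_iff 1]
    simp only [e]
    exact hs1.sub hs'
  rw [hs2.tsum_eq_zero_add]
  simp only [e]
  rw [hs1.tsum_sub hs', sub_mul, one_mul, hs.tsum_eq_zero_add]
  have : ∑' k, v k * y ^ (k + 1) = y * (v 0 * y ^ 0 + ∑' k, v (k + 1) * y ^ (k + 1)) := by
    rw [← hs.tsum_eq_zero_add (f := fun k => v k * y ^ k), ← tsum_mul_left]
    exact tsum_congr fun k => by ring
  rw [this]
  simp [qDiff]
  ring

section Continuation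

variable {q : ℂ} {u : ℕ → ℂ}

theorem abelSum_succ (hq : q ≠ 0) (hu : ∀ J, ∃ C : ℝ, ∀ k, ‖(qDiff q)^[J] u k‖ ≤ C) {J : ℕ} {z : ℂ}
    (hz : ∀ j : ℕ, z * q ^ j ≠ 1) (hJ : ‖z * q ^ J‖ < 1) :
    abelSum q u (J + 1) z = abelSum q u J z := by
  obtain ⟨C, hC⟩ := hu J
  have h1 : 1 - z * q ^ J ≠ 0 := sub_ne_zero.2 (hz J).symm
  rw [abelSum, abelSum, qFac_succ, Function.iterate_succ_apply', pow_succ, ← mul_assoc z,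
    ← one_sub_mul_tsum hq hC hJ, mul_inv]
  field_simp

theorem abelSum_add (hq : q ≠ 0) (hq1 : ‖q‖ < 1)
    (hu : ∀ J, ∃ C : ℝ, ∀ k, ‖(qDiff q)^[J] u k‖ ≤ C) {J : ℕ} {z : ℂ}
    (hz : ∀ j : ℕ, z * q ^ j ≠ 1) (hJ : ‖z * q ^ J‖ < 1) (i : ℕ) :
    abelSum q u (J + i) z = abelSum q u J z := by
  induction i with
  | zero => rfl
  | succ i ih =>
    rw [← add_assoc, abelSum_succ hq hu hz, ih]
    rw [pow_add, ← mul_assoc, norm_mul, norm_pow]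
    exact mul_lt_one_of_nonneg_of_lt_one_left (norm_nonneg _) hJ
      (pow_le_one₀ (norm_nonneg q) hq1.le)

theorem abelSum_eq (hq : q ≠ 0) (hq1 : ‖q‖ < 1)
    (hu : ∀ J, ∃ C : ℝ, ∀ k, ‖(qDiff q)^[J] u k‖ ≤ C) {J J' : ℕ} {z : ℂ}
    (hz : ∀ j : ℕ, z * q ^ j ≠ 1) (hJ : ‖z * q ^ J‖ < 1) (hJ' : ‖z * q ^ J'‖ < 1) :
    abelSum q u J z = abelSum q u J' z := by
  rw [← abelSum_add hq hq1 hu hz hJ J', ← abelSum_add hq hq1 hu hz hJ' J, add_comm]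

theorem exists_norm_mul_pow_lt_one (hq1 : ‖q‖ < 1) (z : ℂ) : ∃ J : ℕ, ‖z * q ^ J‖ < 1 := by
  have h : Tendsto (fun n : ℕ => ‖z * q ^ n‖) atTop (𝓝 0) := by
    simpa using ((tendsto_pow_atTop_nhds_zero_of_norm_lt_one hq1).const_mul z).norm
  exact (h.eventually_lt_const one_pos).exists

theorem analyticAt_abelSum (hu : ∀ J, ∃ C : ℝ, ∀ k, ‖(qDiff q)^[J] u k‖ ≤ C) {J : ℕ}
    {z : ℂ} (hz : ∀ j : ℕ, z * q ^ j ≠ 1) (hJ : ‖z * q ^ J‖ < 1) :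
    AnalyticAt ℂ (abelSum q u J) z := by
  obtain ⟨C, hC⟩ := hu J
  have hC0 : 0 ≤ C := (norm_nonneg _).trans (hC 0)
  have hfac : AnalyticAt ℂ (fun z => qFac q z J) z := by
    simp only [qFac]
    fun_prop
  have hpow : AnalyticAt ℂ (fun y => ∑' k, (qDiff q)^[J] u k * y ^ k) (z * q ^ J) := by
    obtain ⟨r, hr1, hr2⟩ := exists_between hJ
    have hr0 : 0 ≤ r := (norm_nonneg _).trans hr1.le
    have hd : DifferentiableOn ℂ (fun y => ∑' k, (qDiff q)^[J] u k * y ^ k) (Metric.ball 0 r) := by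
      refine Complex.differentiableOn_tsum_of_summable_norm (u := fun k => C * r ^ k)
        ((summable_geometric_of_lt_one hr0 hr2).mul_left C) (fun k => by fun_prop)
        Metric.isOpen_ball fun k w hw => ?_
      rw [norm_mul, norm_pow]
      have hw' : ‖w‖ ≤ r := (mem_ball_zero_iff.1 hw).le
      gcongr
      exact hC k
    exact hd.analyticAt (Metric.isOpen_ball.mem_nhds (mem_ball_zero_iff.2 hr1))
  have hne : qFac q z J ≠ 0 := qFac_ne_zero fun j _ => hz j
  have hcomp : AnalyticAt ℂ (fun z : ℂ => z * q ^ J) z := by fun_prop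
  exact (hfac.inv hne).mul (AnalyticAt.fun_comp (f := fun z : ℂ => z * q ^ J) hpow hcomp)

/-- If all iterated `q`-differences of `u` are bounded, then `∑ u_k z^k` has a continuation. -/
theorem exists_isContinuation (hq : q ≠ 0) (hq1 : ‖q‖ < 1)
    (hu : ∀ J, ∃ C : ℝ, ∀ k, ‖(qDiff q)^[J] u k‖ ≤ C) :
    ∃ F, IsContinuation q u F ∧ ∀ J z, (∀ j : ℕ, z * q ^ j ≠ 1) → ‖z * q ^ J‖ < 1 →
      F z = abelSum q u J z := by
  choose N hN using exists_norm_mul_pow_lt_one (q := q) hq1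
  have hF : ∀ J z, (∀ j : ℕ, z * q ^ j ≠ 1) → ‖z * q ^ J‖ < 1 →
      abelSum q u (N z) z = abelSum q u J z :=
    fun J z hz hJ => abelSum_eq hq hq1 hu hz (hN z) hJ
  refine ⟨fun z => abelSum q u (N z) z, ⟨fun z hz => ?_, fun z hz1 => ?_⟩, hF⟩
  · refine (analyticAt_abelSum hu hz (hN z)).congr ?_
    -- near `z` finitely many of the conditions `w q^j ≠ 1` remain, the others follow from size
    have h1 : ∀ᶠ w in 𝓝 z, ‖w * q ^ N z‖ < 1 :=
      (by fun_prop : Continuous fun w : ℂ => ‖w * q ^ N z‖).continuousAt.eventually_lt_const (hN z)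
    have h2 : ∀ᶠ w in 𝓝 z, ∀ j ∈ Finset.range (N z), w * q ^ j ≠ 1 := by
      rw [Filter.eventually_all_finset]
      exact fun j _ =>
        (by fun_prop : Continuous fun w : ℂ => w * q ^ j).continuousAt.eventually_ne (hz j)
    filter_upwards [h1, h2] with w hw1 hw2
    refine (hF _ _ (fun j hj => ?_) hw1).symm
    rcases Nat.lt_or_ge j (N z) with h | h
    · exact hw2 j (Finset.mem_range.2 h) hj
    · obtain ⟨l, rfl⟩ := Nat.exists_eq_add_of_le h
      have h3 : ‖w * q ^ N z * q ^ l‖ < 1 := by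
        rw [norm_mul, norm_pow q l]
        exact mul_lt_one_of_nonneg_of_lt_one_left (norm_nonneg _) hw1
          (pow_le_one₀ (norm_nonneg q) hq1.le)
      rw [mul_assoc, ← pow_add, hj, norm_one] at h3
      exact lt_irrefl _ h3
  · have hz : ∀ j : ℕ, z * q ^ j ≠ 1 := fun j hj => by
      have h3 : ‖z * q ^ j‖ < 1 := by
        rw [norm_mul, norm_pow q j]
        exact mul_lt_one_of_nonneg_of_lt_one_left (norm_nonneg _) hz1
          (pow_le_one₀ (norm_nonneg q) hq1.le)
      rw [hj, norm_one] at h3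
      exact lt_irrefl _ h3
    obtain ⟨C, hC⟩ := hu 0
    have := hF 0 z hz (by simpa using hz1)
    change HasSum _ (abelSum q u (N z) z)
    rw [this, abelSum]
    simpa [qFac_zero] using (summable_mul_pow_of_bounded hC hz1).hasSum

/-- The truncated sums of a smooth array converge to the analytic continuation of the limiting
power series, also outside its disc of convergence. -/
theorem tendsto_truncSum {c : ℕ → ℕ → ℂ} (hq : q ≠ 0) (hq1 : ‖q‖ < 1)
    (hc : ∀ J, QSmooth q J c) (hu : ∀ k, Tendsto (fun n => c n k) atTop (𝓝 (u k))) {z : ℂ}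
    (hz : ∀ j : ℕ, z * q ^ j ≠ 1) :
    Tendsto (fun n => truncSum q z (c n) n) atTop
      (𝓝 (Classical.epsilon (IsContinuation q u) z)) := by
  obtain ⟨F, hF, hFz⟩ := exists_isContinuation hq hq1 fun J => (hc J).exists_norm_iterate_le hu
  obtain ⟨J, hJ⟩ := exists_norm_mul_pow_lt_one hq1 z
  rw [IsContinuation.unique (Classical.epsilon_spec ⟨F, hF⟩) hF z hz, hFz J z hz hJ, abelSum]
  have hz' : ∀ j : ℕ, z * q ^ J * q ^ j ≠ 1 := fun j => by
    rw [mul_assoc, ← pow_add]; exact hz _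
  obtain ⟨C, hC⟩ := (hc J).iterate
  have h1 := tendsto_truncSum_of_norm_lt_one hq hq1 hJ hz' hC (tendsto_iterate_qDiff hu J)
  have h2 : Tendsto (fun n : ℕ => qFac q (z * q ^ n) J) atTop (𝓝 1) := by
    have hp : Tendsto (fun n : ℕ => z * q ^ n) atTop (𝓝 0) := by
      simpa using (tendsto_pow_atTop_nhds_zero_of_norm_lt_one hq1).const_mul z
    have : Tendsto (fun n : ℕ => qFac q (z * q ^ n) J) atTop
        (𝓝 (∏ j ∈ Finset.range J, (1 - 0 * q ^ j))) :=
      tendsto_finsetProd _ fun j _ => tendsto_const_nhds.sub (hp.mul_const _)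
    simpa using this
  have h3 := (h2.div_const (qFac q z J)).mul h1
  rw [one_div] at h3
  exact h3.congr fun n => (truncSum_iterate_qDiff hq hz (c n) n J).symm

end Continuation

/-! ### The limit of the terminating series -/

theorem QSmooth.prod {q : ℂ} (hq : q ≠ 0) (hq1 : ‖q‖ < 1) {J : ℕ} {ι : Type*} (t : Finset ι)
    {c : ι → ℕ → ℕ → ℂ} (h : ∀ i, QSmooth q J (c i)) : QSmooth q J fun n k => ∏ i ∈ t, c i n k := by
  classical
  induction t using Finset.induction_on with
  | empty =>
    simp only [Finset.prod_empty]
    exact QSmooth.const hq hq1 (B := ‖(1 : ℂ)‖) fun _ => le_rfl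
  | insert i t hi ih =>
    simp only [Finset.prod_insert hi]
    exact (h i).mul ih

/-- The coefficients of `vwpSum` as a truncated power series in `s/(aq)`. -/
noncomputable def vwpCoeff (q a s : ℂ) (x : Fin 5 → ℂ) (n k : ℕ) : ℂ :=
  (1 - a * q ^ (2 * k)) / (1 - a) * (qFac q a k * (∏ i, qFac q (x i) k) / qFac q q k)
    * (∏ i, qFac q (a * q ^ (k + 1) / x i) (n - k))
    * (qFac q (s * q ^ n / q) k / qFac q (a * q ^ (n + 1)) k)

theorem vwpSum_eq_truncSum {q : ℂ} (hq : q ≠ 0) (a s : ℂ) (x : Fin 5 → ℂ) (n : ℕ) :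
    vwpSum q a s x n = truncSum q (s / (a * q)) (vwpCoeff q a s x n) n := by
  refine Finset.sum_congr rfl fun k _ => ?_
  rw [vwpTerm, vwpCoeff, truncPow, show s / (a * q) * q ^ n / q = s * q ^ n / (a * q ^ 2) by
    field_simp]

theorem qSmooth_vwpCoeff {q a : ℂ} (hq : q ≠ 0) (hq1 : ‖q‖ < 1) (ha : ∀ j : ℕ, a * q ^ j ≠ 1)
    (s : ℂ) (x : Fin 5 → ℂ) (J : ℕ) : QSmooth q J (vwpCoeff q a s x) := by
  have hQ : ∀ j : ℕ, q * q ^ j ≠ 1 := fun j => by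
    rw [← pow_succ']
    exact pow_ne_one_of_norm_lt_one hq1 j.succ_ne_zero
  have hpow : ∀ n : ℕ, ‖q ^ n‖ ≤ 1 := fun n => by
    rw [norm_pow]; exact pow_le_one₀ (norm_nonneg q) hq1.le
  have cst : ∀ y : ℂ, QSmooth q J fun _ _ => y := fun y =>
    QSmooth.const hq hq1 (g := fun _ => y) fun _ => le_rfl
  obtain ⟨C1, hC1⟩ := exists_norm_inv_qFac_le hq1 hQ
  obtain ⟨C2, hC2⟩ := exists_norm_inv_qFac_le hq1 (y := a * q) fun j => by
    rw [mul_assoc, ← pow_succ']; exact ha _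
  have f1 : QSmooth q J fun _ k => 1 - a * q ^ (2 * k) :=
    ((cst 1).add ((cst (-a)).mul ((QSmooth.pow hq hq1).mul (QSmooth.pow hq hq1)))).congr
      fun n k _ => by ring
  have f2 : ∀ y : ℂ, QSmooth q J fun _ k => qFac q y k := fun y =>
    QSmooth.qFac hq hq1 (y := fun _ => y) fun _ => le_rfl
  have f3 : QSmooth q J fun _ k => (qFac q q k)⁻¹ :=
    QSmooth.inv_qFac hq hq1 (y := fun _ => q) (fun _ => le_rfl) (fun _ k => hC1 k) fun _ => hQ
  have f4 : QSmooth q J fun n k => ∏ i, qFac q (a * q ^ (k + 1) / x i) (n - k) := by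
    refine QSmooth.prod hq hq1 _ fun i => (QSmooth.qFac_sub hq hq1 (a / x i)).congr fun n k _ => ?_
    rw [div_mul_eq_mul_div]
  have f5 : QSmooth q J fun n k => qFac q (s * q ^ n / q) k :=
    QSmooth.qFac hq hq1 (B := ‖s‖ * ‖q‖⁻¹) fun n => by
      rw [norm_div, norm_mul, div_eq_mul_inv]
      gcongr
      exact mul_le_of_le_one_right (norm_nonneg s) (hpow n)
  have f6 : QSmooth q J fun n k => (qFac q (a * q ^ (n + 1)) k)⁻¹ := by
    refine QSmooth.inv_qFac hq hq1 (B := ‖a‖)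
      (C := Real.exp (‖a * q‖ * (1 - ‖q‖)⁻¹) * C2) (fun n => ?_) (fun n k => ?_) fun n k => ?_
    · rw [norm_mul]
      exact mul_le_of_le_one_right (norm_nonneg a) (hpow _)
    · have e : qFac q (a * q) (n + k) = qFac q (a * q) n * qFac q (a * q ^ (n + 1)) k := by
        simp only [qFac, Finset.prod_range_add]
        congr 1
        refine Finset.prod_congr rfl fun j _ => ?_
        ring
      have h0 : qFac q (a * q) n ≠ 0 := qFac_ne_zero fun j _ => by
        rw [mul_assoc, ← pow_succ']; exact ha _
      have e' : (qFac q (a * q ^ (n + 1)) k)⁻¹ = qFac q (a * q) n * (qFac q (a * q) (n + k))⁻¹ := by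
        rw [e, mul_inv, mul_inv_cancel_left₀ h0]
      rw [e', norm_mul]
      exact mul_le_mul (norm_qFac_le hq1 le_rfl n) (hC2 _) (norm_nonneg _) (Real.exp_nonneg _)
    · rw [mul_assoc, ← pow_add]; exact ha _
  refine ((((f1.mul (cst (1 - a)⁻¹)).mul (((f2 a).mul
    (QSmooth.prod hq hq1 Finset.univ fun i => f2 (x i))).mul f3)).mul f4).mul (f5.mul f6)).congr
    fun n k _ => ?_
  simp only [vwpCoeff, div_eq_mul_inv]

theorem tendsto_vwpCoeff {q : ℂ} (hq1 : ‖q‖ < 1) (a s : ℂ) (x : Fin 5 → ℂ) (k : ℕ) :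
    Tendsto (fun n => vwpCoeff q a s x n k) atTop
      (𝓝 (wTildeCoeff q a (x 0) (x 1) (x 2) (x 3) (x 4) k)) := by
  have hp : Tendsto (fun n : ℕ => q ^ n) atTop (𝓝 0) :=
    tendsto_pow_atTop_nhds_zero_of_norm_lt_one hq1
  have h1 : ∀ y : ℕ → ℂ, Tendsto y atTop (𝓝 0) →
      Tendsto (fun n => qFac q (y n) k) atTop (𝓝 1) := fun y hy => by
    have : Tendsto (fun n : ℕ => qFac q (y n) k) atTop
        (𝓝 (∏ j ∈ Finset.range k, (1 - 0 * q ^ j))) :=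
      tendsto_finsetProd _ fun j _ => tendsto_const_nhds.sub (hy.mul_const _)
    simpa using this
  have h2 : Tendsto (fun n : ℕ => s * q ^ n / q) atTop (𝓝 0) := by
    simpa using (hp.const_mul s).div_const q
  have h3 : Tendsto (fun n : ℕ => a * q ^ (n + 1)) atTop (𝓝 0) := by
    simpa using ((tendsto_add_atTop_iff_nat 1).2 hp).const_mul a
  have h4 : Tendsto (fun n => ∏ i, qFac q (a * q ^ (k + 1) / x i) (n - k)) atTop
      (𝓝 (∏ i, qInf q (a * q ^ (k + 1) / x i))) :=
    tendsto_finsetProd _ fun i _ => (qFac_tendsto hq1 _).comp (tendsto_sub_atTop_nat k)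
  have h5 := (h4.const_mul ((1 - a * q ^ (2 * k)) / (1 - a)
    * (qFac q a k * (∏ i, qFac q (x i) k) / qFac q q k))).mul ((h1 _ h2).div (h1 _ h3) one_ne_zero)
  have e : wTildeCoeff q a (x 0) (x 1) (x 2) (x 3) (x 4) k =
      (1 - a * q ^ (2 * k)) / (1 - a) * (qFac q a k * (∏ i, qFac q (x i) k) / qFac q q k)
        * (∏ i, qInf q (a * q ^ (k + 1) / x i)) * (1 / 1) := by
    simp only [wTildeCoeff, qFacs, qInfs, List.map_cons, List.map_nil, List.prod_cons,
      List.prod_nil, Fin.prod_univ_five]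
    ring
  rw [e]
  exact h5

/-- The terminating series tends to `W̃` whether or not the power series that defines `W̃`
converges at `s/(aq)`. -/
theorem tendsto_vwpSum {q a s : ℂ} {x : Fin 5 → ℂ} (hq : q ≠ 0) (hq1 : ‖q‖ < 1)
    (ha : ∀ j : ℕ, a * q ^ j ≠ 1) (hz : ∀ j : ℕ, s / (a * q) * q ^ j ≠ 1)
    (hs : a ^ 2 * q ^ 2 / (x 0 * x 1 * x 2 * x 3 * x 4) = s / (a * q)) :
    Tendsto (vwpSum q a s x) atTop (𝓝 (wTilde q a (x 0) (x 1) (x 2) (x 3) (x 4))) := by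
  rw [wTilde, hs]
  exact (tendsto_truncSum hq hq1 (qSmooth_vwpCoeff hq hq1 ha s x) (tendsto_vwpCoeff hq1 a s x)
    hz).congr fun n => (vwpSum_eq_truncSum hq a s x n).symm

/-! ### Continued fractions and their recurrence -/

section ContFrac

variable {α β : ℕ → ℂ}

theorem contFrac_contsAux_succ (n : ℕ) :
    (contFrac α β).contsAux (n + 3) =
      ⟨α (n + 1) * ((contFrac α β).contsAux (n + 2)).a
          - β (n + 1) * ((contFrac α β).contsAux (n + 1)).a,
        α (n + 1) * ((contFrac α β).contsAux (n + 2)).b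
          - β (n + 1) * ((contFrac α β).contsAux (n + 1)).b⟩ := by
  have h : (contFrac α β).s.get? (n + 1) = some ⟨-β (n + 1), α (n + 1)⟩ := rfl
  rw [GenContFract.contsAux_recurrence h rfl rfl]
  simp [sub_eq_add_neg]

theorem contFrac_dens_zero : (contFrac α β).dens 0 = 1 := GenContFract.zeroth_den_eq_one

theorem contFrac_nums_zero : (contFrac α β).nums 0 = 0 := GenContFract.zeroth_num_eq_h

theorem contFrac_dens_one : (contFrac α β).dens 1 = α 0 := by
  have h : (contFrac α β).s.get? 0 = some ⟨1, α 0⟩ := rfl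
  exact GenContFract.first_den_eq h

theorem contFrac_nums_one : (contFrac α β).nums 1 = 1 := by
  have h : (contFrac α β).s.get? 0 = some ⟨1, α 0⟩ := rfl
  rw [GenContFract.first_num_eq h]
  simp [contFrac]

theorem contFrac_dens_succ (n : ℕ) : (contFrac α β).dens (n + 2) =
    α (n + 1) * (contFrac α β).dens (n + 1) - β (n + 1) * (contFrac α β).dens n := by
  have := congrArg GenContFract.Pair.b (contFrac_contsAux_succ (α := α) (β := β) n)
  exact this

theorem contFrac_nums_succ (n : ℕ) : (contFrac α β).nums (n + 2) =
    α (n + 1) * (contFrac α β).nums (n + 1) - β (n + 1) * (contFrac α β).nums n := by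
  have := congrArg GenContFract.Pair.a (contFrac_contsAux_succ (α := α) (β := β) n)
  exact this

/-- If `X` is the sequence of denominators and `Y` a second solution of the recurrence with
`Y₁ = α₀ Y₀ - δ`, then `Y = Y₀ X - δ P` with `P` the numerators; so a limit `l` of `Y / X` gives
the value of the continued fraction. -/
theorem cfConvergesTo_of_recurrence {X Y : ℕ → ℂ} {δ l : ℂ} (hX0 : X 0 = 1) (hX1 : X 1 = α 0)
    (hX : ∀ n, X (n + 2) = α (n + 1) * X (n + 1) - β (n + 1) * X n)
    (hY1 : Y 1 = α 0 * Y 0 - δ)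
    (hY : ∀ n, Y (n + 2) = α (n + 1) * Y (n + 1) - β (n + 1) * Y n) (hδ : δ ≠ 0)
    (hne : ∀ᶠ n in atTop, X n ≠ 0) (hl : Tendsto (fun n => Y n / X n) atTop (𝓝 l)) :
    CFConvergesTo (contFrac α β) ((Y 0 - l) / δ) := by
  have hd : ∀ n, (contFrac α β).dens n = X n ∧ (contFrac α β).dens (n + 1) = X (n + 1) := by
    intro n
    induction n with
    | zero => exact ⟨contFrac_dens_zero.trans hX0.symm, contFrac_dens_one.trans hX1.symm⟩
    | succ n ih => exact ⟨ih.2, by rw [contFrac_dens_succ, ih.1, ih.2, hX]⟩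
  have hn : ∀ n, Y n = Y 0 * X n - δ * (contFrac α β).nums n ∧
      Y (n + 1) = Y 0 * X (n + 1) - δ * (contFrac α β).nums (n + 1) := by
    intro n
    induction n with
    | zero =>
      rw [contFrac_nums_zero, zero_add, contFrac_nums_one, hX0, hX1, hY1]
      constructor <;> ring
    | succ n ih =>
      refine ⟨ih.2, ?_⟩
      rw [contFrac_nums_succ, hY, hX]
      linear_combination α (n + 1) * ih.2 - β (n + 1) * ih.1
  refine ⟨?_, ?_⟩
  · filter_upwards [hne] with n h
    rwa [(hd n).1]
  · refine ((tendsto_const_nhds (x := Y 0)).sub hl |>.div_const δ).congr' ?_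
    filter_upwards [hne] with n h
    rw [GenContFract.conv_eq_num_div_den, (hd n).1, (hn n).1]
    field_simp
    ring

end ContFrac

/-! ### The two solutions of the recurrence -/

theorem stepUp_mul_stepDown {q κ s a b c d e f : ℂ} (hq : q ≠ 0) (hκ : κ ^ 2 = q / s) (n : ℕ)
    (h1 : 1 - s * q ^ n / (a * q) ≠ 0) (h2 : 1 - a * q ^ (n + 1) ≠ 0) :
    stepUp q κ a s n * stepDown q κ a s ![b, c, d, e, f] (n + 1) =
      recB q s a b c d e f (n + 1) := by
  have hN : q ^ n ≠ 0 := pow_ne_zero _ hq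
  have z1 : q ^ (-2 * ((n + 1 : ℕ) : ℤ) + 3) = q / (q ^ n) ^ 2 := by
    rw [eq_div_iff (pow_ne_zero _ hN), ← pow_mul, ← zpow_natCast q (n * 2), ← zpow_add₀ hq]
    nth_rewrite 2 [← zpow_one q]
    congr 1
    push_cast
    ring
  have z2 : q ^ (((n + 1 : ℕ) : ℤ) - 2) = q ^ n / q := by
    rw [eq_div_iff hq, ← zpow_natCast q n]
    nth_rewrite 2 [← zpow_one q]
    rw [← zpow_add₀ hq]
    congr 1
    push_cast
    ring
  have z3 : q ^ (2 * ((n + 1 : ℕ) : ℤ) - 1) = (q ^ n) ^ 2 * q := by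
    rw [← pow_mul, ← pow_succ, ← zpow_natCast]
    congr 1
    push_cast
    ring
  have z4 : q ^ (2 * ((n + 1 : ℕ) : ℤ) - 2) = (q ^ n) ^ 2 := by
    rw [← pow_mul, ← zpow_natCast]
    congr 1
    push_cast
    ring
  have z5 : q ^ (2 * ((n + 1 : ℕ) : ℤ) - 3) = (q ^ n) ^ 2 / q := by
    rw [eq_div_iff hq, ← pow_mul, ← zpow_natCast]
    nth_rewrite 2 [← zpow_one q]
    rw [← zpow_add₀ hq]
    congr 1
    push_cast
    ring
  rw [recB, stepUp, stepDown, z1, z2, z3, z4, z5]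
  simp only [Fin.prod_univ_five, Matrix.cons_val]
  have e1 : ∀ y : ℂ, 1 - y * (s * q ^ (n + 1) / (a * q ^ 2)) = 1 - y * s / a * (q ^ n / q) :=
    fun y => by field_simp; ring
  have e2 : ∀ y : ℂ, 1 - a * q ^ (n + 1) / y = 1 - a / y * q ^ (n + 1) := fun y => by ring
  have e3 : 1 - s * q ^ (n + 1) / (a * q ^ 2) = 1 - s * q ^ n / (a * q) := by field_simp; ring
  have e4 : 1 - s * q ^ (2 * n) = 1 - s * (q ^ n) ^ 2 := by ring
  have e5 : 1 - s * q ^ (2 * n) / q = 1 - s * ((q ^ n) ^ 2 / q) := by ring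
  have e6 : 1 - s * q ^ (2 * (n + 1)) / q ^ 2 = 1 - s * (q ^ n) ^ 2 := by field_simp; ring
  have e7 : 1 - s * q ^ (2 * (n + 1)) / q = 1 - s * ((q ^ n) ^ 2 * q) := by field_simp; ring
  have e8 : 1 - s * q ^ n / q = 1 - s * (q ^ n / q) := by ring
  simp only [e1, e2, e3, e4, e5, e6, e7, e8]
  have e9 : q / (q ^ n) ^ 2 / s = κ ^ 2 * q * (q ^ n)⁻¹ * (q ^ (n + 1))⁻¹ := by
    rw [hκ, pow_succ]
    field_simp
    ring
  rw [e9]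
  generalize q ^ (n + 1) = M at *
  generalize 1 - s * q ^ n / (a * q) = D1 at *
  generalize 1 - a * M = D2 at *
  generalize 1 - s * (q ^ n / q) = D3
  generalize 1 - s * (q ^ n) ^ 2 = D4
  generalize 1 - s * ((q ^ n) ^ 2 / q) = D5
  generalize 1 - s * ((q ^ n) ^ 2 * q) = D6
  generalize q ^ n / q = L
  generalize q ^ n = N
  generalize 1 - b * s / a * L = x1
  generalize 1 - c * s / a * L = x2
  generalize 1 - d * s / a * L = x3
  generalize 1 - e * s / a * L = x4
  generalize 1 - f * s / a * L = x5
  generalize 1 - a / b * M = y1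
  generalize 1 - a / c * M = y2
  generalize 1 - a / d * M = y3
  generalize 1 - a / e * M = y4
  generalize 1 - a / f * M = y5
  generalize 1 - M = D7
  trans (κ ^ 2 * q * N⁻¹ * M⁻¹ * D7 * D3 * y1 * y2 * y3 * y4 * y5
    * (x1 * x2 * x3 * x4 * x5 / (D6 * D4 ^ 2 * D5))) * ((D1 * D1⁻¹) * (D2 * D2⁻¹))
  · ring
  · rw [mul_inv_cancel₀ h1, mul_inv_cancel₀ h2]
    ring

set_option maxRecDepth 20000 in
set_option maxHeartbeats 1000000 in
/-- The invariance of the middle coefficient under the reflection, with `N = q^n`,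
`u = s q^n / (a q²)`, and `E y`, `R y` for `∏ (1 - x_i y)`, `∏ (1 - y/x_i)`. -/
theorem reflection_identity_aux {K : Type*} [Field K]
    {a q N u e1 e2 e3 e4 d1 d2 d3 d4 d5 d6 d7 : K} {E : K → K}
    {R : K → K}
    (ha : a ≠ 0) (hq : q ≠ 0) (hN : N ≠ 0) (hu : u ≠ 0)
    (h2 : d2 ≠ 0) (h3 : d3 ≠ 0) (h4 : d4 ≠ 0) (h5 : d5 ≠ 0) (h6 : d6 ≠ 0) (h7 : d7 ≠ 0)
    (k1 : d1 = 1 - a * q * u * N) (k2 : d2 = 1 - a * q ^ 2 * u * N) (k3 : d3 = 1 - a * u * N)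
    (k4 : d4 = 1 - a * q * N) (k5 : d5 = 1 - u) (k6 : d6 = 1 - a * N / q) (k7 : d7 = 1 - q ^ 2 * u)
    (hE : ∀ y, E y = 1 - e1 * y + e2 * y ^ 2 - e3 * y ^ 3 + e4 * y ^ 4
      - (a ^ 2 * q * N / u) * y ^ 5)
    (hR : ∀ y, R y = 1 + (-e4 * y + e3 * y ^ 2 - e2 * y ^ 3 + e1 * y ^ 4 - y ^ 5)
      / (a ^ 2 * q * N / u)) :
    (1 - q * N) * (1 - a * N) * E (q * u) / (d2 * d7)
        + q * (1 - a * u) * (1 - q * u) * R (a * N) / (d3 * d6)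
        + a * N * d1 * (a * u - a * N / q) * R q / (d6 * d7)
      = (1 - a * q * u) * (1 - q * u) * R (a * q * N) / (d2 * d4)
        + q * (1 - N) * (1 - a * N) * E u / (d3 * d5)
        + q * u * d1 * (N - u) * E 1 / (d5 * d4) := by
  have k6' : q * d6 = q - a * N := by rw [k6]; field_simp
  obtain ⟨d6', hd6'⟩ : ∃ d6', d6' = q - a * N := ⟨_, rfl⟩
  have hd6 : d6 = d6' / q := by rw [hd6', ← k6']; field_simp
  have h6' : d6' ≠ 0 := by rw [hd6', ← k6']; exact mul_ne_zero hq h6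
  subst hd6
  clear k6 k6'
  simp only [hE, hR]
  field_simp
  subst k1 k2 k3 k4 k5 k7 hd6'
  ring

/-- The middle coefficient is invariant under `a ↦ q/a`, `x ↦ q/x`, `s ↦ q⁴/s`, combined with the
index change `q^n ↦ s q^{n-2}`. -/
theorem stepMid_reflect {q κ κ' a s : ℂ} {x : Fin 5 → ℂ} {n n' : ℕ} (hq : q ≠ 0) (ha : a ≠ 0)
    (hs : s ≠ 0) (hx : ∀ i, x i ≠ 0) (hprod : (∏ i, x i) * s = a ^ 3 * q ^ 3)
    (hn : q ^ n' = s * q ^ n / q ^ 2) (hκ : κ' * q ^ 2 = κ * s)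
    (h2 : 1 - s * q ^ (2 * n) ≠ 0) (h3 : 1 - s * q ^ (2 * n) / q ^ 2 ≠ 0)
    (h4 : 1 - a * q * q ^ n ≠ 0) (h5 : 1 - s * q ^ n / (a * q ^ 2) ≠ 0)
    (h6 : 1 - a * q ^ n / q ≠ 0) (h7 : 1 - s * q ^ n / a ≠ 0) :
    stepMid q κ' (q / a) (q ^ 4 / s) (fun i => q / x i) n' = stepMid q κ a s x n := by
  have hN : q ^ n ≠ 0 := pow_ne_zero _ hq
  -- all quantities are expressed through `a`, `q`, `q^n` and `u = s q^n / (a q²)`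
  obtain ⟨e1, e2, e3, e4, hE, hR⟩ := exists_prod_expansion x hx
  have hP : ∏ i, x i = a ^ 2 * q * q ^ n / (s * q ^ n / (a * q ^ 2)) := by
    field_simp
    linear_combination hprod
  rw [hP] at hE hR
  have hu : s * q ^ n / (a * q ^ 2) ≠ 0 :=
    div_ne_zero (mul_ne_zero hs hN) (mul_ne_zero ha (pow_ne_zero _ hq))
  have f1 : s * q ^ n / q = a * q * (s * q ^ n / (a * q ^ 2)) := by field_simp
  have f2 : s * q ^ n / (a * q) = q * (s * q ^ n / (a * q ^ 2)) := by field_simp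
  have f3 : s * q ^ (2 * n) = a * q ^ 2 * (s * q ^ n / (a * q ^ 2)) * q ^ n := by
    field_simp; ring
  have f4 : s * q ^ (2 * n) / q = a * q * (s * q ^ n / (a * q ^ 2)) * q ^ n := by
    field_simp; ring
  have f5 : s * q ^ (2 * n) / q ^ 2 = a * (s * q ^ n / (a * q ^ 2)) * q ^ n := by
    field_simp; ring
  have f7 : s * q ^ n / a = q ^ 2 * (s * q ^ n / (a * q ^ 2)) := by field_simp
  have g0 : q ^ n' = a * (s * q ^ n / (a * q ^ 2)) := by rw [hn]; field_simp
  have g1 : q ^ 4 / s * q ^ n' / q = q * q ^ n := by rw [hn]; field_simp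
  have g2 : q ^ 4 / s * q ^ n' / (q / a * q) = a * q ^ n := by rw [hn]; field_simp
  have g3 : q ^ 4 / s * q ^ (2 * n') = s * q ^ (2 * n) := by
    rw [pow_mul', hn]; field_simp; ring
  have g4 : q / a * q * q ^ n' = q ^ 2 * (s * q ^ n / (a * q ^ 2)) := by rw [hn]; field_simp
  have g5 : q ^ 4 / s * q ^ n' / (q / a * q ^ 2) = a * q ^ n / q := by rw [hn]; field_simp
  have g6 : q / a * q ^ n' = q * (s * q ^ n / (a * q ^ 2)) := by rw [hn]; field_simp
  have p1 : ∏ i, (1 - q / a * q * q ^ n' / (q / x i)) =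
      ∏ i, (1 - x i * (q * (s * q ^ n / (a * q ^ 2)))) :=
    Finset.prod_congr rfl fun i _ => by rw [g4]; have := hx i; field_simp
  have p2 : ∏ i, (1 - q / x i * (a * q ^ n / q)) = ∏ i, (1 - a * q ^ n / x i) :=
    Finset.prod_congr rfl fun i _ => by have := hx i; field_simp
  have key := reflection_identity_aux ha hq hN hu (by rwa [← f3]) (by rwa [← f5])
    h4 h5 h6 (by rwa [← f7]) rfl rfl rfl rfl rfl rfl rfl hE hR
  have hk : κ' / q ^ n' = κ / q ^ n := by
    rw [hn, div_eq_div_iff (by positivity) hN]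
    field_simp
    linear_combination hκ
  simp only [mul_one] at key
  rw [stepMid, stepMid, p1, g1, g2, g3, g4, g5, g6, p2, hk, g0, f1, f2, f4, f5, f3]
  have g7 : q * (a * q ^ n / q) = a * q ^ n := mul_div_cancel₀ _ hq
  rw [g7, key]

/-! ### The terminating series as a `₁₀φ₉` -/

theorem qFac_inv {q y : ℂ} (hy : y ≠ 0) (k : ℕ) :
    qFac q y⁻¹ k = (-y⁻¹) ^ k * qSub q y k := by
  rw [qFac, qSub, ← Finset.card_range k, ← Finset.prod_const, Finset.card_range,
    ← Finset.prod_mul_distrib]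
  refine Finset.prod_congr rfl fun j _ => ?_
  field_simp
  ring

theorem basicHypCoeff_phi109 {q a g h : ℂ} (x : Fin 5 → ℂ) (k : ℕ)
    (ha : ∀ j : ℕ, a * q ^ j ≠ 1) :
    basicHypCoeff q (vwpUpper q a [x 0, x 1, x 2, x 3, x 4, g, h])
        (vwpLower q a [x 0, x 1, x 2, x 3, x 4, g, h]) k =
      (1 - a * q ^ (2 * k)) / (1 - a) * (qFac q a k * (∏ i, qFac q (x i) k) / qFac q q k)
        * (∏ i, qFac q (a * q / x i) k)⁻¹
        * (qFac q g k * qFac q h k / (qFac q (a * q / g) k * qFac q (a * q / h) k)) := by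
  have h1 : (1 : ℂ) - a ≠ 0 := sub_ne_zero.2 (by simpa using (ha 0).symm)
  have hr := sqrtC_sq a
  have hs : qFac q (sqrtC a) k * qFac q (-sqrtC a) k ≠ 0 := by
    rw [qFac, qFac, ← Finset.prod_mul_distrib]
    refine Finset.prod_ne_zero_iff.2 fun j _ => ?_
    have : (1 - sqrtC a * q ^ j) * (1 - -sqrtC a * q ^ j) = 1 - a * q ^ (2 * j) := by
      linear_combination -(q ^ (2 * j)) * hr
    rw [this]
    exact sub_ne_zero.2 (ha (2 * j)).symm
  have e0 : (1 - a * q ^ (2 * k)) / (1 - a) =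
      qFac q (q * sqrtC a) k * qFac q (-(q * sqrtC a)) k /
        (qFac q (sqrtC a) k * qFac q (-sqrtC a) k) := by
    rw [div_eq_div_iff h1 hs, qFac_sqrt_ratio]
    ring
  rw [e0]
  simp only [basicHypCoeff, vwpUpper, vwpLower, qFacs, List.map_cons, List.map_nil,
    List.prod_cons, List.prod_nil, Fin.prod_univ_five]
  simp only [div_eq_mul_inv, mul_inv]
  ring

/-- `phi109` is an infinite sum of which only the terms `k ≤ n` are nonzero, because of the
parameter `g = q^{-n}`. -/
theorem vwpSum_eq_phi109 {q a s g h : ℂ} {x : Fin 5 → ℂ} {n : ℕ} (hq : q ≠ 0) (hs : s ≠ 0)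
    (ha0 : a ≠ 0) (ha : ∀ j : ℕ, a * q ^ j ≠ 1) (hx : ∀ i, ∀ j : ℕ, a * q / x i * q ^ j ≠ 1)
    (hg : g * q ^ n = 1) (hh : h = s * q ^ n / q) :
    vwpSum q a s x n =
      (∏ i, qFac q (a * q / x i) n) * phi109 q a (x 0) (x 1) (x 2) (x 3) (x 4) g h := by
  have hN : q ^ n ≠ 0 := pow_ne_zero _ hq
  have hg' : g = (q ^ n)⁻¹ := eq_inv_of_mul_eq_one_left hg
  have hu : s * q ^ n / (a * q ^ 2) ≠ 0 :=
    div_ne_zero (mul_ne_zero hs hN) (mul_ne_zero ha0 (pow_ne_zero _ hq))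
  rw [phi109, basicHyp, tsum_eq_sum (s := Finset.range (n + 1)), vwpSum, Finset.mul_sum]
  · refine Finset.sum_congr rfl fun k hk => ?_
    have hk' : k ≤ n := Nat.lt_succ_iff.1 (Finset.mem_range.1 hk)
    rw [basicHypCoeff_phi109 x k ha, vwpTerm]
    have e1 : (∏ i, qFac q (a * q / x i) n) =
        (∏ i, qFac q (a * q / x i) k) * ∏ i, qFac q (a * q ^ (k + 1) / x i) (n - k) := by
      rw [← Finset.prod_mul_distrib]
      refine Finset.prod_congr rfl fun i _ => ?_
      simp only [qFac]
      rw [← Finset.prod_range_mul_prod_Ico _ hk', Finset.prod_Ico_eq_prod_range]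
      congr 1
      refine Finset.prod_congr rfl fun j _ => ?_
      rw [pow_add]
      ring
    have e2 : (∏ i, qFac q (a * q / x i) k) ≠ 0 :=
      Finset.prod_ne_zero_iff.2 fun i _ => qFac_ne_zero fun j _ => hx i j
    have e3 : qFac q g k = (-(q ^ n)⁻¹) ^ k * qSub q (q ^ n) k := by rw [hg', qFac_inv hN]
    have e4 : a * q / h = (s * q ^ n / (a * q ^ 2))⁻¹ := by rw [hh]; field_simp
    have e5 : a * q / g = a * q ^ (n + 1) := by rw [hg']; field_simp; ring
    have e6 : s / (a * q) = (-(q ^ n)⁻¹) / (-(s * q ^ n / (a * q ^ 2))⁻¹) * q := by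
      field_simp
    rw [e1, e3, e4, e5, qFac_inv hu, e6, ← hh, mul_pow, div_pow]
    have e7 := mul_inv_cancel₀ e2
    generalize (∏ i, qFac q (a * q / x i) k) = P at *
    generalize (-(s * q ^ n / (a * q ^ 2))⁻¹) ^ k = A
    generalize (-(q ^ n)⁻¹) ^ k = B
    generalize (∏ i, qFac q (a * q ^ (k + 1) / x i) (n - k)) = C
    generalize qSub q (s * q ^ n / (a * q ^ 2)) k = D
    generalize qFac q (a * q ^ (n + 1)) k = E
    generalize (1 - a * q ^ (2 * k)) / (1 - a) * (qFac q a k * (∏ i, qFac q (x i) k) / qFac q q k)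
      = F
    simp only [div_eq_mul_inv, mul_inv]
    linear_combination -(F * C * (qFac q h k * E⁻¹) * (B * A⁻¹ * q ^ k)
      * (qSub q (q ^ n) k * D⁻¹)) * e7
  · intro k hk
    have hk' : n < k := by simpa [Nat.lt_succ_iff] using hk
    have e3 : qFac q g k = 0 := by rw [hg', qFac_inv hN, qSub_pow_of_lt q hk', mul_zero]
    rw [basicHypCoeff_phi109 x k ha, e3]
    simp

/-! ### The reflected solution -/

/-- When the parameter `s q^{n-1}` is `1`, only the first term of the series survives. -/
theorem vwpSum_eq_prod {q a s : ℂ} {x : Fin 5 → ℂ} {n : ℕ} (ha : 1 - a ≠ 0)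
    (h : s * q ^ n / q = 1) : vwpSum q a s x n = ∏ i, qFac q (a * q / x i) n := by
  rw [vwpSum, Finset.sum_range_succ', Finset.sum_eq_zero, zero_add]
  · simp [vwpTerm, qFac_zero, qSub, div_self ha]
  · intro k _
    have : qFac q (s * q ^ n / q) (k + 1) = 0 := by rw [h, qFac_succ', sub_self, zero_mul]
    rw [vwpTerm, this]
    ring

theorem stepUp_reflect {q κ κ' a s : ℂ} {n n' : ℕ} (hq : q ≠ 0) (ha : a ≠ 0) (hs : s ≠ 0)
    (hn : q ^ n' = s * q ^ n / q ^ 2) (hκ : κ' * q ^ 2 = κ * s) :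
    stepUp q κ' (q / a) (q ^ 4 / s) n' = κ / q ^ n * (1 - q * q ^ n) * (1 - a * q ^ n)
      / ((1 - s * q ^ (2 * n)) * (1 - s * q ^ (2 * n) / q) * (1 - s / a * q ^ n)) := by
  have hN : q ^ n ≠ 0 := pow_ne_zero _ hq
  have hκ' : κ' = κ * s / q ^ 2 := by field_simp; exact hκ
  have hk : κ' / q ^ n' = κ / q ^ n := by rw [hn, hκ']; field_simp
  have g1 : q ^ 4 / s * q ^ n' / q = q * q ^ n := by rw [hn]; field_simp
  have g2 : q ^ 4 / s * q ^ n' / (q / a * q) = a * q ^ n := by rw [hn]; field_simp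
  have g3 : q ^ 4 / s * q ^ (2 * n') = s * q ^ (2 * n) := by
    rw [pow_mul', hn]; field_simp; ring
  have g4 : q / a * q ^ (n' + 1) = s / a * q ^ n := by rw [pow_succ, hn]; field_simp
  rw [stepUp, hk, g1, g2, g3, g4]

theorem stepDown_reflect {q κ κ' a s : ℂ} {x : Fin 5 → ℂ} {n n' : ℕ} (hq : q ≠ 0) (ha : a ≠ 0)
    (hs : s ≠ 0) (hx : ∀ i, x i ≠ 0) (hn : q ^ n' = s * q ^ n / q ^ 2)
    (hκ : κ' * q ^ 2 = κ * s) :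
    stepDown q κ' (q / a) (q ^ 4 / s) (fun i => q / x i) n' =
      κ * q / q ^ n * (1 - s * q ^ n / q ^ 2) * (1 - s * q ^ n / (a * q))
        * (∏ i, (1 - a * q ^ n / x i)) * (∏ i, (1 - x i * (s * q ^ n / (a * q ^ 2))))
        / ((1 - s * q ^ (2 * n) / q ^ 2) * (1 - s * q ^ (2 * n) / q) * (1 - a * q ^ n / q)) := by
  have hN : q ^ n ≠ 0 := pow_ne_zero _ hq
  have hκ' : κ' = κ * s / q ^ 2 := by field_simp; exact hκ
  have hk : κ' * q / q ^ n' = κ * q / q ^ n := by rw [hn, hκ']; field_simp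
  have g3 : q ^ 4 / s * q ^ (2 * n') = s * q ^ (2 * n) := by
    rw [pow_mul', hn]; field_simp; ring
  have g5 : q ^ 4 / s * q ^ n' / (q / a * q ^ 2) = a * q ^ n / q := by rw [hn]; field_simp
  have g6 : q / a * q ^ n' = s * q ^ n / (a * q) := by rw [hn]; field_simp
  have p1 : ∏ i, (1 - s * q ^ n / (a * q) / (q / x i)) =
      ∏ i, (1 - x i * (s * q ^ n / (a * q ^ 2))) :=
    Finset.prod_congr rfl fun i _ => by have := hx i; field_simp
  have p2 : ∏ i, (1 - q / x i * (a * q ^ n / q)) = ∏ i, (1 - a * q ^ n / x i) :=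
    Finset.prod_congr rfl fun i _ => by have := hx i; field_simp
  rw [stepDown, hk, g3, g5, g6, p1, p2, hn]

/-- The product of the two outer coefficients of the recurrence is invariant under the
reflection, although the factors are not. -/
theorem stepUp_mul_stepDown_reflect {q κ κ' a s : ℂ} {x : Fin 5 → ℂ} {n n' : ℕ} (hq : q ≠ 0)
    (ha : a ≠ 0) (hs : s ≠ 0) (hx : ∀ i, x i ≠ 0) (hn : q ^ n' = s * q ^ n / q ^ 2)
    (hκ : κ' * q ^ 2 = κ * s)
    (h1 : 1 - s * q ^ n / (a * q) ≠ 0) (h2 : 1 - a * q ^ (n + 1) ≠ 0)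
    (h3 : 1 - a * q ^ n ≠ 0) (h4 : 1 - s / a * q ^ n ≠ 0) :
    stepUp q κ' (q / a) (q ^ 4 / s) n'
        * stepDown q κ' (q / a) (q ^ 4 / s) (fun i => q / x i) (n' + 1) =
      stepUp q κ a s n * stepDown q κ a s x (n + 1) := by
  have hn' : q ^ (n' + 1) = s * q ^ (n + 1) / q ^ 2 := by rw [pow_succ, hn, pow_succ]; ring
  rw [stepUp_reflect hq ha hs hn hκ, stepDown_reflect hq ha hs hx hn' hκ, stepUp, stepDown]
  have e1 : s * q ^ (n + 1) / q ^ 2 = s * q ^ n / q := by field_simp; ring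
  have e2 : s * q ^ (n + 1) / (a * q) = s / a * q ^ n := by field_simp; ring
  have e3 : a * q ^ (n + 1) / q = a * q ^ n := by field_simp; ring
  have e4 : s * q ^ (n + 1) / (a * q ^ 2) = s * q ^ n / (a * q) := by field_simp; ring
  have e5 : q * q ^ n = q ^ (n + 1) := by ring
  rw [e1, e2, e3, e4, e5]
  generalize (∏ i, (1 - a * q ^ (n + 1) / x i)) = P
  generalize (∏ i, (1 - x i * (s * q ^ n / (a * q)))) = P'
  generalize 1 - s * q ^ n / (a * q) = A1 at *
  generalize 1 - a * q ^ (n + 1) = A2 at *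
  generalize 1 - a * q ^ n = A3 at *
  generalize 1 - s / a * q ^ n = A4 at *
  generalize 1 - s * q ^ (2 * n) / q = B1
  generalize 1 - s * q ^ (2 * n) = B2
  generalize 1 - s * q ^ (2 * (n + 1)) / q ^ 2 = B3
  generalize 1 - s * q ^ (2 * (n + 1)) / q = B4
  trans (κ / q ^ n * (κ * q / q ^ (n + 1)) * (1 - q ^ (n + 1)) * (1 - s * q ^ n / q) * P * P'
    / (B1 * B2 * B3 * B4))
  · trans (κ / q ^ n * (κ * q / q ^ (n + 1)) * (1 - q ^ (n + 1)) * (1 - s * q ^ n / q) * P * P'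
      / (B1 * B2 * B3 * B4)) * ((A3 * A3⁻¹) * (A4 * A4⁻¹))
    · ring
    · rw [mul_inv_cancel₀ h3, mul_inv_cancel₀ h4]; ring
  · trans (κ / q ^ n * (κ * q / q ^ (n + 1)) * (1 - q ^ (n + 1)) * (1 - s * q ^ n / q) * P * P'
      / (B1 * B2 * B3 * B4)) * ((A1 * A1⁻¹) * (A2 * A2⁻¹))
    · rw [mul_inv_cancel₀ h1, mul_inv_cancel₀ h2]; ring
    · ring

theorem stepUp_reflect_eq {q κ κ' a s : ℂ} {n n' : ℕ} (hq : q ≠ 0) (ha : a ≠ 0) (hs : s ≠ 0)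
    (hn : q ^ n' = s * q ^ n / q ^ 2) (hκ : κ' * q ^ 2 = κ * s)
    (h1 : 1 - s / q * q ^ n ≠ 0) (h2 : 1 - s / (a * q) * q ^ n ≠ 0)
    (h3 : 1 - a * q * q ^ n ≠ 0) :
    stepUp q κ' (q / a) (q ^ 4 / s) n' = stepUp q κ a s n *
      ((1 - q * q ^ n) * (1 - a * q ^ n) * (1 - a * q * q ^ n)
        / ((1 - s / a * q ^ n) * (1 - s / q * q ^ n) * (1 - s / (a * q) * q ^ n))) := by
  rw [stepUp_reflect hq ha hs hn hκ, stepUp]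
  have e1 : 1 - s * q ^ n / q = 1 - s / q * q ^ n := by ring
  have e2 : 1 - s * q ^ n / (a * q) = 1 - s / (a * q) * q ^ n := by ring
  have e3 : 1 - a * q ^ (n + 1) = 1 - a * q * q ^ n := by ring
  rw [e1, e2, e3]
  generalize 1 - s / q * q ^ n = A1 at *
  generalize 1 - s / (a * q) * q ^ n = A2 at *
  generalize 1 - a * q * q ^ n = A3 at *
  generalize 1 - s / a * q ^ n = A4
  generalize 1 - s * q ^ (2 * n) / q = B1
  generalize 1 - s * q ^ (2 * n) = B2
  trans (κ / q ^ n * (1 - q * q ^ n) * (1 - a * q ^ n) / (B2 * B1 * A4))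
    * ((A1 * A1⁻¹) * (A2 * A2⁻¹) * (A3 * A3⁻¹))
  · rw [mul_inv_cancel₀ h1, mul_inv_cancel₀ h2, mul_inv_cancel₀ h3]; ring
  · ring

/-- The quotient of the normalizing factors of the two solutions. -/
theorem prod_stepUp_reflect {q κ κ' a s : ℂ} {l : ℕ} (hq : q ≠ 0) (ha : a ≠ 0) (hs : s ≠ 0)
    (hl : q ^ l = s / q ^ 2) (hκ : κ' * q ^ 2 = κ * s)
    (h1 : ∀ n : ℕ, 1 - s / q * q ^ n ≠ 0) (h2 : ∀ n : ℕ, 1 - s / (a * q) * q ^ n ≠ 0)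
    (h3 : ∀ n : ℕ, 1 - a * q * q ^ n ≠ 0) (n : ℕ) :
    ∏ j ∈ Finset.range n, stepUp q κ' (q / a) (q ^ 4 / s) (j + l) =
      (∏ j ∈ Finset.range n, stepUp q κ a s j) *
        (qFac q q n * qFac q a n * qFac q (a * q) n
          / (qFac q (s / a) n * qFac q (s / q) n * qFac q (s / (a * q)) n)) := by
  simp only [qFac, ← Finset.prod_mul_distrib, ← Finset.prod_div_distrib]
  refine Finset.prod_congr rfl fun j _ => ?_
  refine stepUp_reflect_eq hq ha hs ?_ hκ (h1 j) (h2 j) (h3 j)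
  rw [pow_add, hl]
  ring

/-- A solution of a three-term recurrence, rescaled so that the leading coefficient is `1`. -/
theorem rescaled_recurrence {U M D S : ℕ → ℂ}
    (h : ∀ n, U (n + 1) * S (n + 2) - M (n + 1) * S (n + 1) + D (n + 1) * S n = 0) (n : ℕ) :
    (∏ j ∈ Finset.range (n + 2), U j) * S (n + 2) =
      M (n + 1) * ((∏ j ∈ Finset.range (n + 1), U j) * S (n + 1))
        - U n * D (n + 1) * ((∏ j ∈ Finset.range n, U j) * S n) := by
  rw [Finset.prod_range_succ _ (n + 1), Finset.prod_range_succ _ n]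
  linear_combination ((∏ j ∈ Finset.range n, U j) * U n) * h n

/-! ### The continued fraction -/

theorem stepRegular_of_zpow {q a : ℂ} {x : Fin 5 → ℂ} {t : ℤ} {n : ℕ} (hq : q ≠ 0)
    (hq1 : ‖q‖ < 1) (ha0 : a ≠ 0) (hx : ∀ i, x i ≠ 0) (ha : ∀ k : ℤ, a ≠ q ^ k)
    (hprod : (∏ i, x i) * q ^ t = a ^ 3 * q ^ 3) (hlow : 1 < t + n) (hdown : t + 2 * n ≠ 2) :
    StepRegular q a (q ^ t) x n where
  q_ne := hq
  a_ne := ha0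
  s_ne := zpow_ne_zero _ hq
  x_ne := hx
  prod_eq := hprod
  pow_ne j hj := pow_ne_one_of_norm_lt_one hq1 hj
  a_pow_ne j h := ha (-j) (by
    rw [zpow_neg, zpow_natCast]; exact eq_inv_of_mul_eq_one_left h)
  s_pow_ne i j h := ha (t + i - j) (by
    rw [zpow_sub₀ hq, zpow_add₀ hq, zpow_natCast, zpow_natCast, h,
      mul_div_cancel_right₀ _ (pow_ne_zero _ hq)])
  low_ne j h := zpow_ne_one_of_norm_lt_one hq1 (k := t + n + j - 1) (by omega) (by
    rw [zpow_sub₀ hq, zpow_add₀ hq, zpow_add₀ hq, zpow_natCast, zpow_natCast, h, zpow_one,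
      div_self hq])
  down_ne h := zpow_ne_one_of_norm_lt_one hq1 (k := t + (2 * n : ℕ) - (2 : ℕ)) (by
    push_cast; omega) (by
    rw [zpow_sub₀ hq, zpow_add₀ hq, zpow_natCast, zpow_natCast, h,
      div_self (pow_ne_zero _ hq)])

theorem StepRegular.stepUp_ne_zero {q κ a s : ℂ} {x : Fin 5 → ℂ} {n : ℕ}
    (h : StepRegular q a s x n) (hκ : κ ≠ 0) (h1 : 1 - s * q ^ (2 * n) ≠ 0) :
    stepUp q κ a s n ≠ 0 := by
  have hq := h.q_ne
  have ha := h.a_ne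
  have d1 : 1 - s * q ^ n / q ≠ 0 := by simpa using h.low_ne' 0
  have d2 : 1 - s * q ^ n / (a * q) ≠ 0 := by
    intro h0
    refine h.s_pow_ne n 1 ?_
    field_simp at h0
    linear_combination -h0
  have d3 : 1 - s * q ^ (2 * n) / q ≠ 0 := by
    have := h.low_ne' n
    convert this using 2
    ring
  exact div_ne_zero (mul_ne_zero (mul_ne_zero (div_ne_zero hκ (pow_ne_zero _ hq)) d1) d2)
    (mul_ne_zero (mul_ne_zero h1 d3) (h.one_sub_ne _))

/-- The continued fraction attached to the recurrence of `vwpSum`, in terms of the two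
terminating series: its denominators are the multiples of `vwpSum q a s x n` that start with `1`,
and the reflected series `vwpSum q (q/a) (q⁴/s) (q/x) (n + p + 1)`, suitably rescaled, solves the
same recurrence. -/
theorem cfConvergesTo_vwpSum {q κ κ' a : ℂ} {x : Fin 5 → ℂ} {p : ℕ} {α β : ℕ → ℂ}
    (hq : q ≠ 0) (hq1 : ‖q‖ < 1) (ha0 : a ≠ 0) (hx : ∀ i, x i ≠ 0) (ha : ∀ k : ℤ, a ≠ q ^ k)
    (hprod : (∏ i, x i) * q ^ (p + 3) = a ^ 3 * q ^ 3)
    (hden : ∀ i, ∀ k : ℕ, x i * q ^ k ≠ a)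
    (hκ0 : κ ≠ 0) (hκ : κ' * q ^ 2 = κ * q ^ (p + 3))
    (hα : ∀ n, α n = stepMid q κ a (q ^ (p + 3)) x n)
    (hβ : ∀ n, β (n + 1) =
      stepUp q κ a (q ^ (p + 3)) n * stepDown q κ a (q ^ (p + 3)) x (n + 1))
    (hW : wTilde q a (x 0) (x 1) (x 2) (x 3) (x 4) ≠ 0) :
    CFConvergesTo (contFrac α β)
      ((vwpSum q (q / a) (q ^ 4 / q ^ (p + 3)) (fun i => q / x i) (p + 1)
          - qInf q q * qInf q a * qInf q (a * q) / (qInf q (q ^ (p + 3) / a)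
              * qInf q (q ^ (p + 3) / q) * qInf q (q ^ (p + 3) / (a * q)))
            * (wTilde q (q / a) (q / x 0) (q / x 1) (q / x 2) (q / x 3) (q / x 4)
              / wTilde q a (x 0) (x 1) (x 2) (x 3) (x 4)))
        / (stepDown q κ' (q / a) (q ^ 4 / q ^ (p + 3)) (fun i => q / x i) (p + 1)
          * vwpSum q (q / a) (q ^ 4 / q ^ (p + 3)) (fun i => q / x i) p)) := by
  have ht : q ^ ((p : ℤ) + 3) = q ^ (p + 3) := by exact_mod_cast zpow_natCast q (p + 3)
  have ht' : q ^ (1 - (p : ℤ)) = q ^ 4 / q ^ (p + 3) := by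
    rw [← ht, show 1 - (p : ℤ) = (4 : ℕ) - ((p : ℤ) + 3) by push_cast; ring, zpow_sub₀ hq,
      zpow_natCast]
  have ha' : ∀ k : ℤ, q / a ≠ q ^ k := by
    intro k h
    refine ha (1 - k) ?_
    rw [zpow_sub₀ hq, ← h, zpow_one]
    field_simp
  have hs0 : q ^ (p + 3) ≠ 0 := pow_ne_zero _ hq
  have hprod' : (∏ i, q / x i) * q ^ (1 - (p : ℤ)) = (q / a) ^ 3 * q ^ 3 := by
    have hP : ∏ i, x i ≠ 0 := Finset.prod_ne_zero_iff.2 fun i _ => hx i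
    have hP' : ∏ i, x i = a ^ 3 * q ^ 3 / q ^ (p + 3) := by rw [eq_div_iff hs0, hprod]
    rw [Finset.prod_div_distrib, ht', hP']
    simp only [Finset.prod_const, Finset.card_univ, Fintype.card_fin]
    field_simp
  have hR : ∀ n : ℕ, StepRegular q a (q ^ (p + 3)) x n := fun n => by
    rw [← ht]
    exact stepRegular_of_zpow hq hq1 ha0 hx ha (by rw [ht, hprod]) (by omega) (by omega)
  -- the reflected series starts at index `m - 2 = p + 1`; at index `p` the condition `low_ne` fails
  have hR' : ∀ n : ℕ, StepRegular q (q / a) (q ^ 4 / q ^ (p + 3)) (fun i => q / x i)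
      (n + (p + 1)) := fun n => by
    rw [← ht']
    exact stepRegular_of_zpow hq hq1 (div_ne_zero hq ha0) (fun i => div_ne_zero hq (hx i)) ha'
      hprod' (by push_cast; omega) (by push_cast; omega)
  have hs : ∀ k : ℕ, 1 - q ^ (p + 3) * q ^ k ≠ 0 := fun k => by
    rw [← pow_add]
    exact sub_ne_zero.2 (pow_ne_one_of_norm_lt_one hq1 (by omega)).symm
  have hl : q ^ (p + 1) = q ^ (p + 3) / q ^ 2 := by field_simp; ring
  have hln : ∀ n : ℕ, q ^ (n + (p + 1)) = q ^ (p + 3) * q ^ n / q ^ 2 := fun n => by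
    rw [pow_add, hl]; ring
  have sa : ∀ i j : ℕ, 1 - q ^ (p + 3) * q ^ i / (a * q ^ j) ≠ 0 := by
    intro i j h0
    refine (hR 0).s_pow_ne i j ?_
    field_simp at h0
    linear_combination -h0
  have sa0 : ∀ n : ℕ, 1 - q ^ (p + 3) / a * q ^ n ≠ 0 := fun n => by
    have := sa n 0
    convert this using 2
    ring
  have sa1 : ∀ n : ℕ, 1 - q ^ (p + 3) / (a * q) * q ^ n ≠ 0 := fun n => by
    have := sa n 1
    convert this using 2
    ring
  have sq1 : ∀ n : ℕ, 1 - q ^ (p + 3) / q * q ^ n ≠ 0 := fun n => by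
    have := (hR 0).low_ne' n
    convert this using 2
    ring
  have haq : ∀ n : ℕ, 1 - a * q * q ^ n ≠ 0 := fun n => by
    have := (hR 0).one_sub_ne (n + 1)
    convert this using 2
    ring
  have hmid : ∀ n : ℕ, stepMid q κ' (q / a) (q ^ 4 / q ^ (p + 3)) (fun i => q / x i)
      (n + (p + 1)) = α n := fun n => by
    rw [hα]
    refine stepMid_reflect hq ha0 hs0 hx hprod (hln n) hκ (hs _) ?_ (haq n) (sa n 2) ?_ ?_
    · have := (hR n).down_ne
      intro h0
      apply this
      field_simp at h0
      linear_combination -h0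
    · intro h0
      refine ha (1 - n) ?_
      rw [zpow_sub₀ hq, zpow_one, zpow_natCast]
      field_simp at h0 ⊢
      linear_combination -h0
    · have := sa n 0
      simpa using this
  have hX := rescaled_recurrence (U := stepUp q κ a (q ^ (p + 3)))
    (M := stepMid q κ a (q ^ (p + 3)) x) (D := stepDown q κ a (q ^ (p + 3)) x)
    (S := vwpSum q a (q ^ (p + 3)) x) fun n => (hR (n + 1)).recurrence κ
  have hY := rescaled_recurrence
    (U := fun n => stepUp q κ' (q / a) (q ^ 4 / q ^ (p + 3)) (n + (p + 1)))
    (M := fun n => stepMid q κ' (q / a) (q ^ 4 / q ^ (p + 3)) (fun i => q / x i) (n + (p + 1)))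
    (D := fun n => stepDown q κ' (q / a) (q ^ 4 / q ^ (p + 3)) (fun i => q / x i) (n + (p + 1)))
    (S := fun n => vwpSum q (q / a) (q ^ 4 / q ^ (p + 3)) (fun i => q / x i) (n + (p + 1)))
    fun n => by
      have := (hR' (n + 1)).recurrence κ'
      simp only [show n + 1 + (p + 1) - 1 = n + (p + 1) by omega,
        show n + 1 + (p + 1) + 1 = n + 2 + (p + 1) by omega] at this
      exact this
  have hup : ∀ n : ℕ, stepUp q κ a (q ^ (p + 3)) n ≠ 0 := fun n =>
    (hR n).stepUp_ne_zero hκ0 (hs _)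
  have hUprod : ∀ n : ℕ, ∏ j ∈ Finset.range n, stepUp q κ a (q ^ (p + 3)) j ≠ 0 := fun n =>
    Finset.prod_ne_zero_iff.2 fun j _ => hup j
  have hz : q ^ (p + 3) / (a * q) = a ^ 2 * q ^ 2 / (x 0 * x 1 * x 2 * x 3 * x 4) := by
    have h5 : x 0 * x 1 * x 2 * x 3 * x 4 = ∏ i, x i := by rw [Fin.prod_univ_five]
    have hP : ∏ i, x i ≠ 0 := Finset.prod_ne_zero_iff.2 fun i _ => hx i
    rw [h5, div_eq_div_iff (mul_ne_zero ha0 hq) hP]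
    linear_combination hprod
  have hz' : q ^ 4 / q ^ (p + 3) / (q / a * q) =
      (q / a) ^ 2 * q ^ 2 / (q / x 0 * (q / x 1) * (q / x 2) * (q / x 3) * (q / x 4)) := by
    have h5 : q / x 0 * (q / x 1) * (q / x 2) * (q / x 3) * (q / x 4) = ∏ i, q / x i := by
      rw [Fin.prod_univ_five]
    have hP : ∏ i, q / x i ≠ 0 := Finset.prod_ne_zero_iff.2 fun i _ => div_ne_zero hq (hx i)
    rw [h5, div_eq_div_iff (mul_ne_zero (div_ne_zero hq ha0) hq) hP, ← ht']
    linear_combination hprod'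
  have hS := tendsto_vwpSum (x := x) hq hq1 (hR 0).a_pow_ne
    (fun j => (sub_ne_zero.1 (sa1 j)).symm) hz.symm
  have hS' := tendsto_vwpSum (x := fun i => q / x i) hq hq1 (hR' 0).a_pow_ne (fun j h0 => by
    refine ha ((p : ℤ) + 1 - j) ?_
    rw [zpow_sub₀ hq, zpow_natCast, zpow_add₀ hq, zpow_natCast, zpow_one]
    have h1 : q ^ 4 / q ^ (p + 3) / (q / a * q) = a / q ^ (p + 1) := by field_simp; ring
    rw [h1] at h0
    have hp1 := pow_ne_zero (p + 1) hq
    have hj := pow_ne_zero j hq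
    field_simp at h0 ⊢
    linear_combination h0) hz'.symm
  have hne : ∀ᶠ n in atTop, vwpSum q a (q ^ (p + 3)) x n ≠ 0 := hS.eventually_ne hW
  have hquot : Tendsto (fun n =>
      ((∏ j ∈ Finset.range n, stepUp q κ' (q / a) (q ^ 4 / q ^ (p + 3)) (j + (p + 1)))
        * vwpSum q (q / a) (q ^ 4 / q ^ (p + 3)) (fun i => q / x i) (n + (p + 1)))
      / ((∏ j ∈ Finset.range n, stepUp q κ a (q ^ (p + 3)) j) * vwpSum q a (q ^ (p + 3)) x n))
      atTop (𝓝 (qInf q q * qInf q a * qInf q (a * q) / (qInf q (q ^ (p + 3) / a)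
              * qInf q (q ^ (p + 3) / q) * qInf q (q ^ (p + 3) / (a * q)))
            * (wTilde q (q / a) (q / x 0) (q / x 1) (q / x 2) (q / x 3) (q / x 4)
              / wTilde q a (x 0) (x 1) (x 2) (x 3) (x 4)))) := by
    have hS'' := hS'.comp (tendsto_add_atTop_nat (p + 1))
    refine (((((qFac_tendsto hq1 q).mul (qFac_tendsto hq1 a)).mul
      (qFac_tendsto hq1 (a * q))).div (((qFac_tendsto hq1 (q ^ (p + 3) / a)).mul
      (qFac_tendsto hq1 (q ^ (p + 3) / q))).mul (qFac_tendsto hq1 (q ^ (p + 3) / (a * q)))) ?_).mul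
      (hS''.div hS hW)).congr fun n => ?_
    · exact mul_ne_zero (mul_ne_zero (qInf_ne_zero hq1 fun j => (sub_ne_zero.1 (sa0 j)).symm)
        (qInf_ne_zero hq1 fun j => (sub_ne_zero.1 (sq1 j)).symm))
        (qInf_ne_zero hq1 fun j => (sub_ne_zero.1 (sa1 j)).symm)
    · rw [prod_stepUp_reflect hq ha0 hs0 hl hκ sq1 sa1 haq, mul_assoc,
        mul_div_mul_left _ _ (hUprod n)]
      simp only [Pi.div_apply, Function.comp_apply]
      ring
  have h0' : 1 - q / a ≠ 0 := by simpa using (hR' 0).one_sub_ne 0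
  have hlast : vwpSum q (q / a) (q ^ 4 / q ^ (p + 3)) (fun i => q / x i) p ≠ 0 := by
    rw [vwpSum_eq_prod h0' (by field_simp; ring)]
    refine Finset.prod_ne_zero_iff.2 fun i _ => qFac_ne_zero fun j _ h1 => hden i (j + 1) ?_
    have := hx i
    field_simp at h1
    rw [pow_succ]
    linear_combination h1
  have hdown : stepDown q κ' (q / a) (q ^ 4 / q ^ (p + 3)) (fun i => q / x i) (p + 1) ≠ 0 := by
    rw [stepDown_reflect (n := 0) hq ha0 hs0 hx (by rw [pow_zero, mul_one, hl]) hκ]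
    have k1 : 1 - q ^ (p + 3) * q ^ 0 / q ^ 2 ≠ 0 := by
      rw [pow_zero, mul_one, ← hl]
      exact sub_ne_zero.2 (pow_ne_one_of_norm_lt_one hq1 (by omega)).symm
    have k2 : 1 - q ^ (p + 3) * q ^ (2 * 0) / q ≠ 0 := by simpa using sq1 0
    have k3 : 1 - a * q ^ 0 / q ≠ 0 := by
      intro h0
      refine ha 1 ?_
      rw [pow_zero, mul_one] at h0
      field_simp at h0
      rw [zpow_one]
      linear_combination -h0
    refine div_ne_zero (mul_ne_zero (mul_ne_zero (mul_ne_zero (mul_ne_zero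
      (div_ne_zero (mul_ne_zero hκ0 hq) (pow_ne_zero _ hq)) k1) (by simpa using sa 0 1))
      (Finset.prod_ne_zero_iff.2 fun i _ h0 => ?_)) (Finset.prod_ne_zero_iff.2 fun i _ h0 => ?_))
      (mul_ne_zero (mul_ne_zero (by simpa using k1) k2) k3)
    · have := hx i
      refine hden i 0 ?_
      field_simp at h0
      linear_combination h0
    · have := hx i
      have e : q ^ (p + 3) * q ^ 0 / (a * q ^ 2) = q ^ (p + 1) / a := by rw [hl]; field_simp
      rw [e] at h0
      refine hden i (p + 1) ?_
      field_simp at h0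
      linear_combination -h0
  have hX0 : vwpSum q a (q ^ (p + 3)) x 0 = 1 := by
    have h1 : 1 - a ≠ 0 := by simpa using (hR 0).one_sub_ne 0
    simp [vwpSum, vwpTerm, qFac_zero, qSub, div_self h1]
  have key := cfConvergesTo_of_recurrence (α := α) (β := β)
    (X := fun n => (∏ j ∈ Finset.range n, stepUp q κ a (q ^ (p + 3)) j)
      * vwpSum q a (q ^ (p + 3)) x n)
    (Y := fun n =>
      (∏ j ∈ Finset.range n, stepUp q κ' (q / a) (q ^ 4 / q ^ (p + 3)) (j + (p + 1)))
        * vwpSum q (q / a) (q ^ 4 / q ^ (p + 3)) (fun i => q / x i) (n + (p + 1)))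
    (δ := stepDown q κ' (q / a) (q ^ 4 / q ^ (p + 3)) (fun i => q / x i) (p + 1)
      * vwpSum q (q / a) (q ^ 4 / q ^ (p + 3)) (fun i => q / x i) p)
    (by rw [hX0, Finset.prod_range_zero, mul_one]) ?_ ?_ ?_ ?_ (mul_ne_zero hdown hlast) ?_ hquot
  · simpa using key
  · have h1 := (hR 0).recurrence κ
    -- the factor `1 - q^n` ends the recurrence at `n = 0`
    have h2 : stepDown q κ a (q ^ (p + 3)) x 0 = 0 := by simp [stepDown]
    rw [hX0, h2] at h1
    rw [hα, Finset.prod_range_one]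
    linear_combination h1
  · intro n
    rw [hα, hβ]
    exact hX n
  · have h1 := (hR' 0).recurrence κ'
    simp only [zero_add, Nat.add_sub_cancel] at h1
    simp only [← hmid, Finset.prod_range_one, Finset.prod_range_zero, zero_add, one_mul,
      add_comm 1 (p + 1)]
    linear_combination h1
  · intro n
    rw [hβ, ← hmid, ← stepUp_mul_stepDown_reflect hq ha0 hs0 hx (hln n) hκ (by simpa using sa n 1)
      ((hR 0).one_sub_ne _) ((hR 0).one_sub_ne _) (sa0 n)]
    have := hY n
    simp only [show n + 1 + (p + 1) = n + (p + 1) + 1 by omega] at this ⊢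
    exact this
  · filter_upwards [hne] with n hn
    exact mul_ne_zero (hUprod n) hn

theorem corollary9 (q rq a b c d e f : ℂ) (m : ℕ) (hm : 3 ≤ m)
    (hq0 : q ≠ 0) (hq1 : ‖q‖ < 1) (hrq : rq ^ 2 = q)
    (hbcdef : b ≠ 0 ∧ c ≠ 0 ∧ d ≠ 0 ∧ e ≠ 0 ∧ f ≠ 0)
    (hs : a ^ 3 * q ^ 3 / (b * c * d * e * f) = q ^ m)
    (ha : ∀ k : ℤ, a ≠ q ^ k)
    (hden : ∀ x ∈ [b, c, d, e, f], ∀ k : ℕ, x * q ^ k ≠ a)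
    (hW : wTilde q a b c d e f ≠ 0) :
    CFConvergesTo
      (contFrac (recA q rq (q ^ m) (rq ^ m) a b c d e f) (recB q (q ^ m) a b c d e f))
      (rq ^ (m - 3) * (1 - q ^ (m - 1)) * (1 - a / q)
          / ((1 - q ^ (m - 1) / a)
            * (1 - a / b) * (1 - a / c) * (1 - a / d) * (1 - a / e) * (1 - a / f))
        * (phi109 q (q / a) (q / b) (q / c) (q / d) (q / e) (q / f) (q ^ (-(m : ℤ) + 2)) q
          - wTilde q (q / a) (q / b) (q / c) (q / d) (q / e) (q / f) / wTilde q a b c d e f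
            * (qInf q a * qInf q (a * q) * qInf q q
                / (qInf q (q ^ m / a) * qInf q (q ^ (m - 1) / a) * qInf q (q ^ m)))
            * (1 / (1 - q ^ (m - 1)))
            * (qInfs q [b / a * q ^ (m - 1), c / a * q ^ (m - 1), d / a * q ^ (m - 1),
                  e / a * q ^ (m - 1), f / a * q ^ (m - 1)]
                / qInfs q [b * q / a, c * q / a, d * q / a, e * q / a, f * q / a]))) := by
  obtain ⟨p, rfl⟩ : ∃ p, m = p + 3 := ⟨m - 3, by omega⟩
  obtain ⟨hb, hc, hd, he, hf⟩ := hbcdef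
  have ha0 : a ≠ 0 := by
    rintro rfl
    apply pow_ne_zero (p + 3) hq0
    rw [← hs]
    simp
  have hrq0 : rq ≠ 0 := by
    rintro rfl
    exact hq0 (by simpa using hrq.symm)
  have hs0 : q ^ (p + 3) ≠ 0 := pow_ne_zero _ hq0
  have hx : ∀ i, ![b, c, d, e, f] i ≠ 0 := by
    intro i
    fin_cases i <;> assumption
  have hden' : ∀ i, ∀ k : ℕ, ![b, c, d, e, f] i * q ^ k ≠ a := by
    intro i
    fin_cases i
    exacts [hden b (by simp), hden c (by simp), hden d (by simp), hden e (by simp),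
      hden f (by simp)]
  have hrs : (rq ^ (p + 3)) ^ 2 = q ^ (p + 3) := by rw [← hrq]; ring
  have hprod : (∏ i, ![b, c, d, e, f] i) * q ^ (p + 3) = a ^ 3 * q ^ 3 := by
    rw [← hs, Fin.prod_univ_five]
    simp only [Matrix.cons_val]
    field_simp
  have ha1 : ∀ j : ℕ, 1 - a * q * q ^ j ≠ 0 := by
    intro j h0
    refine ha (-(j + 1 : ℕ)) ?_
    rw [zpow_neg, zpow_natCast]
    refine eq_inv_of_mul_eq_one_left ?_
    linear_combination -h0
  have ha2 : ∀ i j : ℕ, 1 - q ^ (p + 3) * q ^ i / (a * q ^ j) ≠ 0 := by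
    intro i j h0
    refine ha ((p + 3 + i : ℕ) - (j : ℕ)) ?_
    rw [zpow_sub₀ hq0, zpow_natCast, zpow_natCast, pow_add q (p + 3) i]
    have := pow_ne_zero j hq0
    field_simp at h0 ⊢
    linear_combination h0
  have hs1 : ∀ n : ℕ, 1 - q ^ (p + 3) * q ^ (2 * n) / q ≠ 0 := by
    intro n h0
    refine pow_ne_one_of_norm_lt_one hq1 (k := p + 2 + 2 * n) (by omega) ?_
    field_simp at h0
    refine mul_left_cancel₀ hq0 ?_
    linear_combination -h0
  -- `κ = q^{1/2}/√s`, and `κ'` is the same number for `q⁴/s` in place of `s`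
  have key := cfConvergesTo_vwpSum (x := ![b, c, d, e, f]) (p := p) (κ := rq / rq ^ (p + 3))
    (κ' := rq / rq ^ (p + 3) * q ^ (p + 3) / q ^ 2)
    (α := recA q rq (q ^ (p + 3)) (rq ^ (p + 3)) a b c d e f)
    (β := recB q (q ^ (p + 3)) a b c d e f) hq0 hq1 ha0 hx ha hprod hden'
    (div_ne_zero hrq0 (pow_ne_zero _ hrq0)) (by field_simp)
    (fun n => recA_eq hq0 hrq hrs hs0 ha0 (hs1 n) (ha1 n) (ha2 n 2))
    (fun n => (stepUp_mul_stepDown hq0 (by rw [div_pow, hrq, hrs]) n (by simpa using ha2 n 1)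
      (by have := ha1 n; rwa [mul_assoc, ← pow_succ'] at this)).symm)
    hW
  have ha' : ∀ j : ℕ, q / a * q ^ j ≠ 1 := by
    intro j h0
    refine ha (j + 1 : ℕ) ?_
    rw [zpow_natCast]
    field_simp at h0
    linear_combination -h0
  have hlow : ∀ i, ∀ j : ℕ, q / a * q / (q / ![b, c, d, e, f] i) * q ^ j ≠ 1 := by
    intro i j h0
    refine hden' i (j + 1) ?_
    have := hx i
    field_simp at h0
    linear_combination h0
  have hp : q ^ 4 / q ^ (p + 3) ≠ 0 := div_ne_zero (pow_ne_zero _ hq0) hs0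
  have e1 := vwpSum_eq_phi109 (s := q ^ 4 / q ^ (p + 3)) (g := q ^ (-((p + 3 : ℕ) : ℤ) + 2))
    (h := q) (n := p + 1) (x := fun i => q / ![b, c, d, e, f] i) hq0 hp
    (div_ne_zero hq0 ha0) ha' hlow
    (by
      rw [← zpow_natCast, ← zpow_add₀ hq0]
      push_cast
      ring_nf
      exact zpow_zero q)
    (by field_simp; ring)
  have e2 := vwpSum_eq_prod (s := q ^ 4 / q ^ (p + 3)) (n := p)
    (x := fun i => q / ![b, c, d, e, f] i)
    (by simpa using (sub_ne_zero.2 (ha' 0).symm)) (by field_simp; ring)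
  have e3 := stepDown_reflect (κ := rq / rq ^ (p + 3))
    (κ' := rq / rq ^ (p + 3) * q ^ (p + 3) / q ^ 2) (n := 0) (n' := p + 1) hq0 ha0 hs0 hx
    (by field_simp; ring) (by field_simp)
  have hfac : ∀ x : ℂ, x ≠ 0 → (∀ k : ℕ, x * q ^ k ≠ a) →
      qFac q (q / a * q / (q / x)) (p + 1) =
        qFac q (q / a * q / (q / x)) p * (1 - x * (q ^ (p + 3) * q ^ 0 / (a * q ^ 2))) ∧
      (qFac q (q / a * q / (q / x)) (p + 1))⁻¹ =
        qInf q (x / a * q ^ (p + 3 - 1)) / qInf q (x * q / a) := by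
    intro x hx hxa
    constructor
    · rw [qFac_succ]
      congr 2
      field_simp
      ring
    · have e : q / a * q / (q / x) = x * q / a := by field_simp
      rw [e]
      have h1 := qFac_mul_qInf hq1 (x * q / a) (p + 1)
      have e' : x * q / a * q ^ (p + 1) = x / a * q ^ (p + 3 - 1) := by
        rw [show p + 3 - 1 = p + 1 + 1 by omega, pow_succ]
        ring
      rw [e'] at h1
      have h2 : qInf q (x / a * q ^ (p + 3 - 1)) ≠ 0 := qInf_ne_zero hq1 fun j h0 => by
        refine hxa (p + 3 - 1 + j) ?_
        rw [pow_add]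
        field_simp at h0
        linear_combination h0
      rw [← h1, div_mul_cancel_right₀ h2]
  have e4 : qInf q (q ^ (p + 3) / q) = (1 - q ^ (p + 3 - 1)) * qInf q (q ^ (p + 3)) := by
    have h1 := qFac_mul_qInf hq1 (q ^ (p + 3) / q) 1
    have h2 : q ^ (p + 3) / q = q ^ (p + 3 - 1) := by
      rw [show p + 3 - 1 = p + 2 by omega]; field_simp; ring
    rw [pow_one, div_mul_cancel₀ _ hq0, qFac_succ, qFac_zero, h2] at h1
    rw [h2, ← h1]
    simp
  obtain ⟨b1, b2⟩ := hfac b hb (hden b (by simp))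
  obtain ⟨c1, c2⟩ := hfac c hc (hden c (by simp))
  obtain ⟨d1, d2⟩ := hfac d hd (hden d (by simp))
  obtain ⟨f1, f2⟩ := hfac f hf (hden f (by simp))
  obtain ⟨g1, g2⟩ := hfac e he (hden e (by simp))
  have hI : qInfs q [b / a * q ^ (p + 3 - 1), c / a * q ^ (p + 3 - 1), d / a * q ^ (p + 3 - 1),
      e / a * q ^ (p + 3 - 1), f / a * q ^ (p + 3 - 1)]
      / qInfs q [b * q / a, c * q / a, d * q / a, e * q / a, f * q / a] =
      (∏ i, qFac q (q / a * q / (q / ![b, c, d, e, f] i)) (p + 1))⁻¹ := by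
    simp only [Fin.prod_univ_five, Matrix.cons_val, mul_inv, b2, c2, d2, f2, g2, qInfs,
      List.map_cons, List.map_nil, List.prod_cons, List.prod_nil]
    simp only [div_eq_mul_inv, mul_inv]
    ring
  have hQ : ∏ i, qFac q (q / a * q / (q / ![b, c, d, e, f] i)) (p + 1) =
      (∏ i, (1 - ![b, c, d, e, f] i * (q ^ (p + 3) * q ^ 0 / (a * q ^ 2))))
        * ∏ i, qFac q (q / a * q / (q / ![b, c, d, e, f] i)) p := by
    simp only [Fin.prod_univ_five, Matrix.cons_val, b1, c1, d1, f1, g1]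
    ring
  have hQ0 : ∏ i, qFac q (q / a * q / (q / ![b, c, d, e, f] i)) (p + 1) ≠ 0 :=
    Finset.prod_ne_zero_iff.2 fun i _ => qFac_ne_zero fun j _ => hlow i j
  have hP : ∏ i, (1 - a * q ^ 0 / ![b, c, d, e, f] i) =
      (1 - a / b) * (1 - a / c) * (1 - a / d) * (1 - a / e) * (1 - a / f) := by
    simp only [Fin.prod_univ_five, Matrix.cons_val, pow_zero, mul_one]
  have hk : rq / rq ^ (p + 3) * q / q ^ 0 = (rq ^ (p + 3 - 3))⁻¹ := by
    rw [← hrq, Nat.add_sub_cancel, pow_add]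
    field_simp
  have k1 : 1 - q ^ (p + 3) * q ^ 0 / q ^ 2 ≠ 0 := by
    have h1 : q ^ (p + 3) * q ^ 0 / q ^ 2 = q ^ (p + 1) := by field_simp; ring
    rw [h1]
    exact sub_ne_zero.2 (pow_ne_one_of_norm_lt_one hq1 (by omega)).symm
  have k2 : q ^ (p + 3) * q ^ 0 / (a * q) = q ^ (p + 3 - 1) / a := by
    rw [show p + 3 - 1 = p + 2 by omega]; field_simp; ring
  have k3 : q ^ (p + 3) * q ^ (2 * 0) / q = q ^ (p + 3 - 1) := by
    rw [show p + 3 - 1 = p + 2 by omega]; field_simp; ring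
  have k4 : q ^ (p + 3) / (a * q) = q ^ (p + 3 - 1) / a := by rw [← k2, pow_zero, mul_one]
  convert key using 1
  rw [e1, e2, e3, hI, hP, hk, k2, k3, e4, k4]
  generalize ∏ i, qFac q (q / a * q / (q / ![b, c, d, e, f] i)) p = Q' at *
  generalize ∏ i, (1 - ![b, c, d, e, f] i * (q ^ (p + 3) * q ^ 0 / (a * q ^ 2))) = L at *
  generalize ∏ i, qFac q (q / a * q / (q / ![b, c, d, e, f] i)) (p + 1) = Q at *
  simp only [Matrix.cons_val, mul_zero, pow_zero, mul_one]
  rw [pow_zero, mul_one] at k1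
  subst hQ
  generalize phi109 q (q / a) (q / b) (q / c) (q / d) (q / e) (q / f)
    (q ^ (-((p + 3 : ℕ) : ℤ) + 2)) q = Φ
  generalize wTilde q (q / a) (q / b) (q / c) (q / d) (q / e) (q / f) = W2
  generalize wTilde q a b c d e f = W1
  generalize (1 - a / b) = p1
  generalize (1 - a / c) = p2
  generalize (1 - a / d) = p3
  generalize (1 - a / e) = p4
  generalize (1 - a / f) = p5
  generalize 1 - q ^ (p + 3) / q ^ 2 = K at *
  generalize 1 - q ^ (p + 3 - 1) = D
  generalize 1 - q ^ (p + 3 - 1) / a = D'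
  generalize 1 - a / q = D''
  generalize rq ^ (p + 3 - 3) = G
  generalize qInf q a = i1
  generalize qInf q (a * q) = i2
  generalize qInf q q = i3
  generalize qInf q (q ^ (p + 3) / a) = i4
  generalize qInf q (q ^ (p + 3 - 1) / a) = i5
  generalize qInf q (q ^ (p + 3)) = i6
  have c1 := mul_inv_cancel₀ k1
  have c2 := mul_inv_cancel₀ hQ0
  generalize hT : i3 * i1 * i2 / (i4 * (D * i6) * i5) * (W2 / W1) = T
  trans G * D * D'' * (D' * p1 * p2 * p3 * p4 * p5)⁻¹ * (Φ - T * (L * Q')⁻¹)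
  · rw [← hT]
    simp only [div_eq_mul_inv, mul_inv]
    ring
  · trans G * D * D'' * (D' * p1 * p2 * p3 * p4 * p5)⁻¹ * (K * K⁻¹)
      * (((L * Q') * (L * Q')⁻¹) * Φ - T * (L * Q')⁻¹)
    · rw [c1, c2, mul_one, one_mul]
    · simp only [div_eq_mul_inv, mul_inv, inv_inv]
      ring
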